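/- **Local error estimate.** Let $d\ge 1$, $0<s<1$ and $\sigma\in\mathbb R$. For functions on $\mathbb R^d$ put $$(v,w)_s=\frac{C_{d,s}}2\int_{\mathbb R^d}\int_{\mathbb R^d}\frac{(v(x)-v(y))(w(x)-w(y))}{|x-y|^{d+2s}}\,dy\,dx,\qquad |v|_{H^s(D)}=\Big(\frac{C_{d,s}}2\int_D\int_D\frac{|v(x)-v(y)|^2}{|x-y|^{d+2s}}\,dy\,dx\Big)^{1/2},$$ where $C_{d,s}=\frac{2^{2s}s\,\Gamma(s+d/2)}{\pi^{d/2}\Gamma(1-s)}$. For an open set $\Omega$ let $\widetilde H^s(\Omega)$ be the space of all $v\in L^2(\mathbb R^d)$ with $|v|_{H^s(\mathbb R^d)}<\infty$ and $v=0$ a.e. outside $\overline\Omega$, normed by $|\cdot|_{H^s(\mathbb R^d)}$ when $\Omega$ is bounded, and let $H^{-s}(\Omega)$ be its dual, with pairing $\langle\cdot,\cdot\rangle$. There is a constant $C$, depending only on $d$, $s$ and $\sigma$, with the following property. Let $\Omega\subset\mathbb R^d$ be a bounded open set whose boundary has Lebesgue measure zero (e.g. a bounded Lipschitz domain). Let $\mathcal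 T_h$ be a finite conforming triangulation of $\Omega$, i.e. a finite set of closed nondegenerate $d$-simplices with union $\overline\Omega$, any two of which are disjoint or meet in a common face. Write $h_T$ for the diameter of $T$ and $\rho_T$ for the diameter of the largest ball contained in $T$. Assume that $\mathcal T_h$ is shape-regular with constant $\sigma$: $h_T\le\sigma\rho_T$ for all $T\in\mathcal T_h$ and, if $d=1$, also $h_T\le\sigma h_{T'}$ whenever $T\cap T'\neq\emptyset$. Let $\mathbb V_h$ be the space of continuous functions on $\mathbb R^d$ that vanish outside $\Omega$ and are affine on each $T\in\mathcal T_h$. Let $f\in H^{-s}(\Omega)$, let $u\in\widetilde H^s(\Omega)$ be the weak solution of the fractional Dirichlet problem, and let $u_h\in\mathbb V_h$ be its finite element (Galerkin) approximation, i.e. $$(u,v)_s=\langle f,v\rangle\quad\forall v\in\widetilde H^s(\Omega),\qquad (u_h,v_h)_s=\langle f,v_h\rangle\quad\forall v_h\in\mathbb V_h .$$ Let $R>0$ and $x_0\in\mathbb R^d$ be such that $B_R=B(x_0,R)\subset\Omega$ and $16\,h_R\le R$, where $h_R=\max\{h_T: T\in\mathcal T_h,\ T\cap B_R\ne\emptyset\}$,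 and let $B_{R/2}=B(x_0,R/2)$. Then $$|u-u_h|_{H^s(B_{R/2})}\le C\inf_{v_h\in\mathbb V_h}\Big(|u-v_h|_{H^s(B_R)}+\frac1{R^s}\|u-v_h\|_{L^2(\Omega)}\Big)+\frac C{R^s}\|u-u_h\|_{L^2(\Omega)} .$$ -/

import Mathlib

open MeasureTheory Set
open scoped NNReal ENNReal

noncomputable section

/-- The normalization constant `C_{d,s} = 2^{2s} s Γ(s + d/2) / (π^{d/2} Γ(1 - s))` of the integral
fractional Laplacian of order `s` in dimension `d`. -/
def fracConst (d : ℕ) (s : ℝ) : ℝ :=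
  2 ^ (2 * s) * s * Real.Gamma (s + d / 2) / (Real.pi ^ ((d : ℝ) / 2) * Real.Gamma (1 - s))

/-- The double integral `∫_D ∫_D |v(x) - v(y)|² / |x - y|^{d+2s} dy dx ∈ [0, ∞]`. -/
def gagliardoEnergy {d : ℕ} (s : ℝ) (D : Set (EuclideanSpace ℝ (Fin d)))
    (v : EuclideanSpace ℝ (Fin d) → ℝ) : ℝ≥0∞ :=
  ∫⁻ x in D, ∫⁻ y in D, ENNReal.ofReal ((v x - v y) ^ 2 / ‖x - y‖ ^ ((d : ℝ) + 2 * s))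

/-- The fractional seminorm
`|v|_{H^s(D)} = (C_{d,s}/2 ∫_D ∫_D |v(x) - v(y)|² / |x - y|^{d+2s} dy dx)^{1/2} ∈ [0, ∞]`. -/
def fracSeminorm {d : ℕ} (s : ℝ) (D : Set (EuclideanSpace ℝ (Fin d)))
    (v : EuclideanSpace ℝ (Fin d) → ℝ) : ℝ≥0∞ :=
  (ENNReal.ofReal (fracConst d s / 2) * gagliardoEnergy s D v) ^ (1 / 2 : ℝ)

/-- The bilinear form
`(v, w)_s = C_{d,s}/2 ∫∫ (v(x) - v(y)) (w(x) - w(y)) / |x - y|^{d+2s} dy dx` over `ℝ^d × ℝ^d`;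
the integrand is integrable whenever `v, w ∈ H^s(ℝ^d)`. -/
def fracForm {d : ℕ} (s : ℝ) (v w : EuclideanSpace ℝ (Fin d) → ℝ) : ℝ :=
  fracConst d s / 2 *
    ∫ x, ∫ y, (v x - v y) * (w x - w y) / ‖x - y‖ ^ ((d : ℝ) + 2 * s)

/-- The norm `‖v‖_{L²(D)} ∈ [0, ∞]`. -/
def l2Norm {d : ℕ} (D : Set (EuclideanSpace ℝ (Fin d)))
    (v : EuclideanSpace ℝ (Fin d) → ℝ) : ℝ≥0∞ :=
  eLpNorm v 2 (volume.restrict D)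

lemma gagliardoEnergy_add_le {d : ℕ} (s : ℝ) (D : Set (EuclideanSpace ℝ (Fin d)))
    {v w : EuclideanSpace ℝ (Fin d) → ℝ} (hv : AEStronglyMeasurable v volume) :
    gagliardoEnergy s D (v + w) ≤ 2 * gagliardoEnergy s D v + 2 * gagliardoEnergy s D w := by
  set μ := (volume : Measure (EuclideanSpace ℝ (Fin d))).restrict D with hμ
  have hvm : AEMeasurable v μ := hv.aemeasurable.restrict
  have hk : Measurable fun p : EuclideanSpace ℝ (Fin d) × EuclideanSpace ℝ (Fin d) =>
      ‖p.1 - p.2‖ ^ ((d : ℝ) + 2 * s) := by fun_prop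
  have h1 : AEMeasurable (fun p : EuclideanSpace ℝ (Fin d) × EuclideanSpace ℝ (Fin d) =>
      ENNReal.ofReal ((v p.1 - v p.2) ^ 2 / ‖p.1 - p.2‖ ^ ((d : ℝ) + 2 * s))) (μ.prod μ) := by
    have a1 : AEMeasurable (fun p : EuclideanSpace ℝ (Fin d) × EuclideanSpace ℝ (Fin d) => v p.1)
        (μ.prod μ) := hvm.comp_quasiMeasurePreserving Measure.quasiMeasurePreserving_fst
    have a2 : AEMeasurable (fun p : EuclideanSpace ℝ (Fin d) × EuclideanSpace ℝ (Fin d) => v p.2)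
        (μ.prod μ) := hvm.comp_quasiMeasurePreserving Measure.quasiMeasurePreserving_snd
    exact (((a1.sub a2).pow_const 2).div hk.aemeasurable).ennreal_ofReal
  have h2 : ∀ x, AEMeasurable (fun y =>
      ENNReal.ofReal ((v x - v y) ^ 2 / ‖x - y‖ ^ ((d : ℝ) + 2 * s))) μ := fun x =>
    (((aemeasurable_const.sub hvm).pow_const 2).div
      (by fun_prop : Measurable fun y : EuclideanSpace ℝ (Fin d) =>
        ‖x - y‖ ^ ((d : ℝ) + 2 * s)).aemeasurable).ennreal_ofReal
  unfold gagliardoEnergy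
  rw [← hμ, ← lintegral_const_mul' _ _ (by simp), ← lintegral_const_mul' _ _ (by simp),
    ← lintegral_add_left' (h1.lintegral_prod_right'.const_mul 2)]
  refine lintegral_mono fun x => ?_
  dsimp only
  rw [← lintegral_const_mul' _ _ (by simp), ← lintegral_const_mul' _ _ (by simp),
    ← lintegral_add_left' ((h2 x).const_mul 2)]
  refine lintegral_mono fun y => ?_
  have hp : 0 ≤ ‖x - y‖ ^ ((d : ℝ) + 2 * s) := by positivity
  have e2 : ∀ a : ℝ≥0∞, 2 * a = ENNReal.ofReal 2 * a := fun a => by simp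
  dsimp only
  rw [e2, e2, ← ENNReal.ofReal_mul (by norm_num), ← ENNReal.ofReal_mul (by norm_num),
    ← ENNReal.ofReal_add (by positivity) (by positivity)]
  refine ENNReal.ofReal_le_ofReal ?_
  rw [← mul_div_assoc, ← mul_div_assoc, ← add_div]
  refine div_le_div_of_nonneg_right ?_ hp
  simp only [Pi.add_apply]
  nlinarith [sq_nonneg ((v x - v y) - (w x - w y))]

lemma gagliardoEnergy_smul {d : ℕ} (s : ℝ) (D : Set (EuclideanSpace ℝ (Fin d))) (c : ℝ)
    (v : EuclideanSpace ℝ (Fin d) → ℝ) :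
    gagliardoEnergy s D (c • v) = ENNReal.ofReal (c ^ 2) * gagliardoEnergy s D v := by
  unfold gagliardoEnergy
  rw [← lintegral_const_mul' _ _ (by simp)]
  refine lintegral_congr fun x => ?_
  rw [← lintegral_const_mul' _ _ (by simp)]
  refine lintegral_congr fun y => ?_
  rw [← ENNReal.ofReal_mul (by positivity)]
  congr 1
  simp only [Pi.smul_apply, smul_eq_mul]
  ring

lemma fracSeminorm_lt_top_iff {d : ℕ} (hd : 1 ≤ d) {s : ℝ} (h0 : 0 < s) (h1 : s < 1)
    (D : Set (EuclideanSpace ℝ (Fin d))) (v : EuclideanSpace ℝ (Fin d) → ℝ) :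
    fracSeminorm s D v < ⊤ ↔ gagliardoEnergy s D v < ⊤ := by
  have hd' : (1 : ℝ) ≤ d := by exact_mod_cast hd
  have hc : 0 < fracConst d s / 2 := by
    have g1 : 0 < Real.Gamma (s + d / 2) := Real.Gamma_pos_of_pos (by positivity)
    have g2 : 0 < Real.Gamma (1 - s) := Real.Gamma_pos_of_pos (by linarith)
    unfold fracConst
    positivity
  have hc' : ENNReal.ofReal (fracConst d s / 2) ≠ 0 := by simpa using hc
  unfold fracSeminorm
  rw [ENNReal.rpow_lt_top_iff_of_pos (by norm_num)]
  constructor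
  · intro h
    rcases ENNReal.mul_lt_top_iff.1 h with h | h | h
    · exact h.2
    · exact absurd h hc'
    · simp [h]
  · exact fun h => ENNReal.mul_lt_top ENNReal.ofReal_lt_top h

/-- The zero-extension space `H̃^s(Ω) = {v ∈ H^s(ℝ^d) : supp v ⊆ closure Ω}`, where `H^s(ℝ^d)` is the
set of `L²(ℝ^d)` functions with finite fractional seminorm on `ℝ^d`. Elements are represented by
functions on `ℝ^d`; the support is the essential one. For `d ≥ 1` and `0 < s < 1` a finite
`gagliardoEnergy` is the same as a finite `fracSeminorm` (`fracSeminorm_lt_top_iff`). -/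
def fracSobolevZero {d : ℕ} (s : ℝ) (Ω : Set (EuclideanSpace ℝ (Fin d))) :
    Submodule ℝ (EuclideanSpace ℝ (Fin d) → ℝ) where
  carrier := {v | MemLp v 2 volume ∧ gagliardoEnergy s univ v < ⊤ ∧
    ∀ᵐ x, x ∉ closure Ω → v x = 0}
  add_mem' := by
    rintro v w ⟨hv1, hv2, hv3⟩ ⟨hw1, hw2, hw3⟩
    refine ⟨hv1.add hw1, (gagliardoEnergy_add_le s univ hv1.1).trans_lt ?_, ?_⟩
    · exact ENNReal.add_lt_top.2
        ⟨ENNReal.mul_lt_top (by simp) hv2, ENNReal.mul_lt_top (by simp) hw2⟩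
    · filter_upwards [hv3, hw3] with x h1 h2 hx
      simp [h1 hx, h2 hx]
  zero_mem' := by
    refine ⟨MemLp.zero, ?_, by simp⟩
    simp [gagliardoEnergy]
  smul_mem' := by
    rintro c v ⟨hv1, hv2, hv3⟩
    refine ⟨hv1.const_smul c, ?_, ?_⟩
    · rw [gagliardoEnergy_smul]
      exact ENNReal.mul_lt_top ENNReal.ofReal_lt_top hv2
    · filter_upwards [hv3] with x h1 hx
      simp [h1 hx]

/-- `f` belongs to the dual `H^{-s}(Ω)` of `H̃^s(Ω)`, the latter normed by `|·|_{H^s(ℝ^d)}`. -/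
def IsDualElement {d : ℕ} {s : ℝ} {Ω : Set (EuclideanSpace ℝ (Fin d))}
    (f : fracSobolevZero s Ω →ₗ[ℝ] ℝ) : Prop :=
  ∃ M : ℝ≥0, ∀ v : fracSobolevZero s Ω,
    ENNReal.ofReal |f v| ≤ M * fracSeminorm s univ (v : EuclideanSpace ℝ (Fin d) → ℝ)

/-- The weak formulation `(u, v)_s = ⟨f, v⟩` for all `v ∈ H̃^s(Ω)`, with `u ∈ H̃^s(Ω)`. -/
def IsWeakSolution {d : ℕ} {s : ℝ} {Ω : Set (EuclideanSpace ℝ (Fin d))}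
    (f : fracSobolevZero s Ω →ₗ[ℝ] ℝ) (u : EuclideanSpace ℝ (Fin d) → ℝ) : Prop :=
  u ∈ fracSobolevZero s Ω ∧ ∀ v : fracSobolevZero s Ω, fracForm s u v = f v

/-- The elements of a triangulation: its simplices of full dimension `d`, as closed subsets of
`ℝ^d`. -/
def elements {d : ℕ} (K : Geometry.SimplicialComplex ℝ (EuclideanSpace ℝ (Fin d))) :
    Set (Set (EuclideanSpace ℝ (Fin d))) :=
  {T | ∃ F ∈ K.faces, F.card = d + 1 ∧ T = convexHull ℝ (F : Set (EuclideanSpace ℝ (Fin d)))}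

/-- `K` is a (conforming, finite) triangulation of `Ω`: its elements, which intersect only along
common faces, fill the closure of `Ω`. -/
def IsTriangulation {d : ℕ} (Ω : Set (EuclideanSpace ℝ (Fin d)))
    (K : Geometry.SimplicialComplex ℝ (EuclideanSpace ℝ (Fin d))) : Prop :=
  K.faces.Finite ∧ ⋃₀ elements K = closure Ω

/-- `ρ_T`: the diameter of the largest ball contained in `T`. -/
def inDiam {d : ℕ} (T : Set (EuclideanSpace ℝ (Fin d))) : ℝ :=
  sSup {ρ | ∃ c r, 0 ≤ r ∧ Metric.closedBall c r ⊆ T ∧ ρ = 2 * r}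

/-- Shape regularity with constant `σ`: `h_T ≤ σ ρ_T` for every element `T`, where `h_T = diam T`.
In dimension one this holds trivially with `σ = 1`, and one asks, as usual, that the lengths of
neighboring elements be comparable with constant `σ` (the property which in higher dimension is a
consequence of `h_T ≤ σ ρ_T`). -/
def IsShapeRegular {d : ℕ} (σ : ℝ)
    (K : Geometry.SimplicialComplex ℝ (EuclideanSpace ℝ (Fin d))) : Prop :=
  (∀ T ∈ elements K, Metric.diam T ≤ σ * inDiam T) ∧
    (d = 1 → ∀ T ∈ elements K, ∀ T' ∈ elements K, (T ∩ T').Nonempty →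
      Metric.diam T ≤ σ * Metric.diam T')

/-- `max {h_T : T ∩ B ≠ ∅}`, the local mesh size on `B`. -/
def localMeshSize {d : ℕ} (K : Geometry.SimplicialComplex ℝ (EuclideanSpace ℝ (Fin d)))
    (B : Set (EuclideanSpace ℝ (Fin d))) : ℝ :=
  sSup {h | ∃ T ∈ elements K, (T ∩ B).Nonempty ∧ h = Metric.diam T}

/-- The finite element space `𝕍_h`: continuous functions which vanish outside `Ω` and are affine on
every element, i.e. the functions of `C_0(Ω)` that are combinations of the piecewise linear nodal
basis functions of the interior vertices. -/
def feSpace {d : ℕ} (Ω : Set (EuclideanSpace ℝ (Fin d)))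
    (K : Geometry.SimplicialComplex ℝ (EuclideanSpace ℝ (Fin d))) :
    Submodule ℝ (EuclideanSpace ℝ (Fin d) → ℝ) where
  carrier := {v | Continuous v ∧ (∀ x, x ∉ Ω → v x = 0) ∧
    ∀ T ∈ elements K, ∃ g : EuclideanSpace ℝ (Fin d) →ᵃ[ℝ] ℝ, ∀ x ∈ T, v x = g x}
  add_mem' := by
    rintro v w ⟨hv1, hv2, hv3⟩ ⟨hw1, hw2, hw3⟩
    refine ⟨hv1.add hw1, fun x hx => by simp [hv2 x hx, hw2 x hx], fun T hT => ?_⟩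
    obtain ⟨g, hg⟩ := hv3 T hT
    obtain ⟨k, hk⟩ := hw3 T hT
    exact ⟨g + k, fun x hx => by simp [hg x hx, hk x hx]⟩
  zero_mem' := ⟨continuous_const, fun _ _ => rfl, fun _ _ => ⟨0, fun _ _ => by simp⟩⟩
  smul_mem' := by
    rintro c v ⟨hv1, hv2, hv3⟩
    refine ⟨hv1.const_smul c, fun x hx => by simp [hv2 x hx], fun T hT => ?_⟩
    obtain ⟨g, hg⟩ := hv3 T hT
    exact ⟨c • g, fun x hx => by simp [hg x hx]⟩

/-- The finite element solution: `u_h ∈ 𝕍_h` with `(u_h, v_h)_s = ⟨f, v_h⟩` for all `v_h ∈ 𝕍_h`.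
(A function `v_h ∈ 𝕍_h` is Lipschitz with bounded support, hence an element of `H̃^s(Ω)`.) -/
def IsGalerkinSolution {d : ℕ} {s : ℝ} {Ω : Set (EuclideanSpace ℝ (Fin d))}
    (K : Geometry.SimplicialComplex ℝ (EuclideanSpace ℝ (Fin d)))
    (f : fracSobolevZero s Ω →ₗ[ℝ] ℝ) (uh : EuclideanSpace ℝ (Fin d) → ℝ) : Prop :=
  uh ∈ feSpace Ω K ∧
    ∀ v : fracSobolevZero s Ω, (v : EuclideanSpace ℝ (Fin d) → ℝ) ∈ feSpace Ω K →
      fracForm s uh v = f v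

end

/-!
The proof compares `u_h` with an arbitrary `v_h ∈ 𝕍_h`. Put `z = u_h - v_h ∈ 𝕍_h` and `w = u - v_h`.
Galerkin orthogonality says that `(z, χ)_s = (w, χ)_s` for all `χ ∈ 𝕍_h`, and the triangle
inequality reduces the claim to a discrete Caccioppoli inequality (`exists_caccioppoli`):
`|z|²_{H^s(B_{R/2})} ≲ |w|²_{H^s(B_R)} + R^{-2s} (‖w‖² + ‖z‖²)`.

Let `η` be a cutoff function between `B_{R/2}` and `B_{3R/4}`. With `δv(x, y) = v(x) - v(y)`,
`(δ(η z))² = δz δ(η² z) + z(x) z(y) (δη)²`,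
and the last term is harmless, because the kernel multiplied by `(δη)² ≲ min(|x - y|/R, 1)²` is
integrable in `y`, with integral of order `R^{-2s}`. Since `η² z` is no finite element function, one
splits `η² z = ψ + e` with the nodal interpolant `ψ ∈ 𝕍_h`.

* The term `δz δψ` may be replaced by `δw δψ`. As `ψ` is supported well inside `B_R`, this is bounded
  by the energy of `w` on `B_R` and `L²` norms (`exists_localized_form_le`).
* The term `δz δe` is small by superapproximation (`exists_superapproximation`): on an element of
  size `h` the slope of `e` is of the order `(h/R) (η |∇z| + m/R)`, where `m` is the size of `z` on
  the element, because `z` has no second derivatives there. Inverse estimates control `η |∇z|` and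
  `m` by the energy of `η z` and the `L²` norm of `z` on the element (`exists_element_estimates`).
  The double integral is split according to whether `|x - y|` is smaller or larger than the local
  mesh size (`exists_near_far_le`); nearby points lie in a common vertex star, where
  elementwise Lipschitz bounds can be chained (`abs_sub_le_of_near`).

Every term with the energy of `η z` comes with a small factor and is absorbed.

The mesh enters through two consequences of shape regularity for the star of an interior vertex:
the number of its elements is bounded (`card_star_le`), and their sizes are comparable
(`cellSize_le_of_common_vertex`). The latter is obtained without angle conditions: if the elements
of a star split into two groups that share no vertex besides the centre, these groups would separate
a small sphere around the centre, which is connected for `d ≥ 2`; and two elements with a common edge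
have comparable sizes (`exists_bridge`). For `d = 1` it is part of the hypothesis.
-/

section LocalError

variable {d : ℕ}
local notation "𝔼" => EuclideanSpace ℝ (Fin d)
local notation "𝕂" => Geometry.SimplicialComplex ℝ (EuclideanSpace ℝ (Fin d))

/-! ### The Gagliardo kernel -/

lemma integrable_truncated_kernel (hd : 1 ≤ d) {s β : ℝ} (hs : 0 < s) (hβ : 2 * s < β) :
    Integrable (fun y : 𝔼 => min ‖y‖ 1 ^ β / ‖y‖ ^ ((d : ℝ) + 2 * s)) := by
  have : Nonempty (Fin d) := ⟨⟨0, hd⟩⟩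
  have hnt : Nontrivial 𝔼 := inferInstance
  rw [integrable_fun_norm_addHaar volume (f := fun t : ℝ => min t 1 ^ β / t ^ ((d : ℝ) + 2 * s)),
    ← Ioc_union_Ioi_eq_Ioi (zero_le_one' ℝ)]
  have hcast : ((d - 1 : ℕ) : ℝ) = (d : ℝ) - 1 := by push_cast [hd]; ring
  refine IntegrableOn.union ?_ ?_
  · have h := (intervalIntegral.intervalIntegrable_rpow' (a := 0) (b := 1) (r := β - 1 - 2 * s)
      (by linarith)).1
    refine h.congr_fun (fun t ht => ?_) measurableSet_Ioc
    have h0 : 0 < t := ht.1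
    simp only [finrank_euclideanSpace, Fintype.card_fin, smul_eq_mul, min_eq_left ht.2]
    rw [← Real.rpow_natCast, ← mul_div_assoc, ← Real.rpow_add h0, ← Real.rpow_sub h0, hcast]
    congr 1; ring
  · have h := integrableOn_Ioi_rpow_of_lt (a := -1 - 2 * s) (c := 1) (by linarith) one_pos
    refine h.congr_fun (fun t ht => ?_) measurableSet_Ioi
    have h0 : 0 < t := one_pos.trans ht
    simp only [finrank_euclideanSpace, Fintype.card_fin, smul_eq_mul, min_eq_right (mem_Ioi.1 ht).le,
      Real.one_rpow]
    rw [← Real.rpow_natCast, mul_one_div, ← Real.rpow_sub h0, hcast]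
    congr 1; ring

/-- All integrals of the kernel that are needed, near the singularity as well as in the far field,
are dominated by this one, whose value scales like `R ^ (-2 s)`. -/
lemma exists_lintegral_truncated_kernel_le (hd : 1 ≤ d) {s β : ℝ} (hs : 0 < s)
    (hβ : 2 * s < β) :
    ∃ C : ℝ, 0 < C ∧ ∀ R : ℝ, 0 < R → ∀ x : 𝔼,
      ∫⁻ y : 𝔼, ENNReal.ofReal (min (‖x - y‖ / R) 1 ^ β / ‖x - y‖ ^ ((d : ℝ) + 2 * s)) ≤
        ENNReal.ofReal (C * R ^ (-(2 * s))) := by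
  set F : 𝔼 → ℝ := fun y => min ‖y‖ 1 ^ β / ‖y‖ ^ ((d : ℝ) + 2 * s) with hF
  have hFi : Integrable F := integrable_truncated_kernel hd hs hβ
  have hF0 : ∀ y, 0 ≤ F y := fun y => by simp only [hF]; positivity
  have hI : 0 ≤ ∫ y, F y := integral_nonneg hF0
  refine ⟨(∫ y, F y) + 1, by linarith, fun R hR x => ?_⟩
  have hscale : ∀ y : 𝔼, min (‖y‖ / R) 1 ^ β / ‖y‖ ^ ((d : ℝ) + 2 * s) =
      R ^ (-((d : ℝ) + 2 * s)) * F (R⁻¹ • y) := by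
    intro y
    have hn : ‖R⁻¹ • y‖ = ‖y‖ / R := by
      rw [norm_smul, norm_inv, Real.norm_of_nonneg hR.le]; field_simp
    simp only [hF, hn]
    rw [Real.div_rpow (norm_nonneg y) hR.le, Real.rpow_neg hR.le]
    have : R ^ ((d : ℝ) + 2 * s) ≠ 0 := (Real.rpow_pos_of_pos hR _).ne'
    field_simp
  rw [lintegral_sub_left_eq_self
    (fun y : 𝔼 => ENNReal.ofReal (min (‖y‖ / R) 1 ^ β / ‖y‖ ^ ((d : ℝ) + 2 * s))) x]
  simp_rw [hscale]
  have hGi : Integrable fun y : 𝔼 => R ^ (-((d : ℝ) + 2 * s)) * F (R⁻¹ • y) :=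
    (hFi.comp_smul (inv_ne_zero hR.ne')).const_mul _
  rw [← ofReal_integral_eq_lintegral_ofReal hGi
    (Filter.Eventually.of_forall fun y => mul_nonneg (by positivity) (hF0 _))]
  refine ENNReal.ofReal_le_ofReal ?_
  rw [integral_const_mul, Measure.integral_comp_smul]
  simp only [finrank_euclideanSpace, Fintype.card_fin, smul_eq_mul, inv_pow, inv_inv]
  rw [abs_of_pos (by positivity), ← mul_assoc, ← Real.rpow_natCast, ← Real.rpow_add hR,
    show -((d : ℝ) + 2 * s) + d = -(2 * s) by ring, mul_comm]
  exact mul_le_mul_of_nonneg_right (by linarith) (by positivity)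

/-- The measure `|x - y|^{-(d + 2s)} dx dy` on `ℝ^d × ℝ^d`. With it the Gagliardo form becomes the
`L²` inner product of the increments `v x - v y`. -/
noncomputable def gagliardoMeasure (d : ℕ) (s : ℝ) :
    Measure (EuclideanSpace ℝ (Fin d) × EuclideanSpace ℝ (Fin d)) :=
  (volume.prod volume).withDensity fun p =>
    ENNReal.ofReal (1 / ‖p.1 - p.2‖ ^ ((d : ℝ) + 2 * s))

lemma measurable_kernel (s : ℝ) : Measurable fun p : 𝔼 × 𝔼 =>
    ENNReal.ofReal (1 / ‖p.1 - p.2‖ ^ ((d : ℝ) + 2 * s)) := by fun_prop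

lemma gagliardoMeasure_absolutelyContinuous (s : ℝ) :
    gagliardoMeasure d s ≪ (volume : Measure 𝔼).prod volume :=
  withDensity_absolutelyContinuous _ _

lemma lintegral_gagliardoMeasure (s : ℝ) {f : 𝔼 × 𝔼 → ℝ≥0∞}
    (hf : AEMeasurable f ((volume : Measure 𝔼).prod volume)) :
    ∫⁻ p, f p ∂gagliardoMeasure d s =
      ∫⁻ x, ∫⁻ y, f (x, y) * ENNReal.ofReal (1 / ‖x - y‖ ^ ((d : ℝ) + 2 * s)) := by
  rw [gagliardoMeasure, lintegral_withDensity_eq_lintegral_mul₀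
    (measurable_kernel s).aemeasurable hf, lintegral_prod _
    ((measurable_kernel s).aemeasurable.mul hf)]
  simp only [Pi.mul_apply, mul_comm]

lemma map_swap_gagliardoMeasure (s : ℝ) :
    (gagliardoMeasure d s).map Prod.swap = gagliardoMeasure d s := by
  ext A hA
  rw [Measure.map_apply measurable_swap hA, gagliardoMeasure, withDensity_apply _ hA,
    withDensity_apply _ (measurable_swap hA), ← lintegral_indicator hA,
    ← lintegral_indicator (measurable_swap hA)]
  conv_rhs => rw [← Measure.prod_swap]
  rw [lintegral_map ((measurable_kernel s).indicator hA) measurable_swap]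
  refine lintegral_congr fun p => ?_
  simp only [indicator, mem_preimage, Prod.fst_swap, Prod.snd_swap, norm_sub_rev p.1 p.2]
  rfl

lemma lintegral_swap_gagliardoMeasure (s : ℝ) (f : 𝔼 × 𝔼 → ℝ≥0∞) :
    ∫⁻ p, f p.swap ∂gagliardoMeasure d s = ∫⁻ p, f p ∂gagliardoMeasure d s := by
  conv_rhs => rw [← map_swap_gagliardoMeasure]
  exact (lintegral_map_equiv f (MeasurableEquiv.prodComm (α := 𝔼) (β := 𝔼))).symm

/-- Integrating out the second variable against a truncated kernel. -/
lemma exists_lintegral_mul_trunc_le (hd : 1 ≤ d) {s β : ℝ} (hs : 0 < s) (hβ : 2 * s < β) :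
    ∃ C : ℝ, 0 < C ∧ ∀ R : ℝ, 0 < R → ∀ g : 𝔼 → ℝ≥0∞, AEMeasurable g →
      ∫⁻ p, g p.1 * ENNReal.ofReal (min (‖p.1 - p.2‖ / R) 1 ^ β) ∂gagliardoMeasure d s ≤
        ENNReal.ofReal (C * R ^ (-(2 * s))) * ∫⁻ x, g x := by
  obtain ⟨C, hC, h⟩ := exists_lintegral_truncated_kernel_le (d := d) hd hs hβ
  refine ⟨C, hC, fun R hR g hg => ?_⟩
  rw [lintegral_gagliardoMeasure]
  · rw [← lintegral_const_mul'' _ hg]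
    refine lintegral_mono fun x => ?_
    dsimp only
    simp_rw [mul_assoc, ← ENNReal.ofReal_mul (Real.rpow_nonneg
      (le_min (div_nonneg (norm_nonneg _) hR.le) zero_le_one) β), mul_one_div]
    rw [lintegral_const_mul _ (by fun_prop), mul_comm]
    exact mul_le_mul_left (h R hR x) _
  · exact (hg.comp_quasiMeasurePreserving Measure.quasiMeasurePreserving_fst).mul
      (by fun_prop : Measurable fun p : 𝔼 × 𝔼 =>
        ENNReal.ofReal (min (‖p.1 - p.2‖ / R) 1 ^ β)).aemeasurable

/-- Integrating out the first variable against a truncated kernel. -/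
lemma exists_lintegral_mul_trunc_le' (hd : 1 ≤ d) {s β : ℝ} (hs : 0 < s) (hβ : 2 * s < β) :
    ∃ C : ℝ, 0 < C ∧ ∀ R : ℝ, 0 < R → ∀ g : 𝔼 → ℝ≥0∞, AEMeasurable g →
      ∫⁻ p, g p.2 * ENNReal.ofReal (min (‖p.1 - p.2‖ / R) 1 ^ β) ∂gagliardoMeasure d s ≤
        ENNReal.ofReal (C * R ^ (-(2 * s))) * ∫⁻ x, g x := by
  obtain ⟨C, hC, h⟩ := exists_lintegral_mul_trunc_le (d := d) hd hs hβ
  refine ⟨C, hC, fun R hR g hg => ?_⟩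
  refine le_trans (le_of_eq ?_) (h R hR g hg)
  rw [← lintegral_swap_gagliardoMeasure]
  simp only [Prod.fst_swap, Prod.snd_swap, norm_sub_rev]

/-- The increment `(x, y) ↦ v x - v y`. -/
def incr (v : 𝔼 → ℝ) (p : 𝔼 × 𝔼) : ℝ := v p.1 - v p.2

lemma aestronglyMeasurable_incr {v : 𝔼 → ℝ} (hv : AEStronglyMeasurable v) :
    AEStronglyMeasurable (incr v) ((volume : Measure 𝔼).prod volume) :=
  (hv.comp_quasiMeasurePreserving Measure.quasiMeasurePreserving_fst).sub
    (hv.comp_quasiMeasurePreserving Measure.quasiMeasurePreserving_snd)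

/-- The squared `L²` norm, as an integral of squares. -/
noncomputable def sqNorm (v : 𝔼 → ℝ) : ℝ≥0∞ := ∫⁻ x, ENNReal.ofReal (v x ^ 2)

lemma gagliardoEnergy_eq (s : ℝ) {D : Set 𝔼} (hD : MeasurableSet D) {v : 𝔼 → ℝ}
    (hv : AEStronglyMeasurable v) :
    gagliardoEnergy s D v =
      ∫⁻ p in D ×ˢ D, ENNReal.ofReal (incr v p ^ 2) ∂gagliardoMeasure d s := by
  have hm : AEMeasurable (fun p => ENNReal.ofReal (incr v p ^ 2))
      ((volume : Measure 𝔼).prod volume) :=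
    ((aestronglyMeasurable_incr hv).aemeasurable.pow_const 2).ennreal_ofReal
  rw [← lintegral_indicator (hD.prod hD), lintegral_gagliardoMeasure _
    (hm.indicator (hD.prod hD)), gagliardoEnergy, ← lintegral_indicator hD]
  refine lintegral_congr fun x => ?_
  by_cases hx : x ∈ D
  · rw [indicator_of_mem hx, ← lintegral_indicator hD]
    refine lintegral_congr fun y => ?_
    by_cases hy : y ∈ D
    · rw [indicator_of_mem hy, indicator_of_mem (mk_mem_prod hx hy),
        ← ENNReal.ofReal_mul (sq_nonneg _), mul_one_div]
      rfl
    · rw [indicator_of_notMem hy, indicator_of_notMem (fun h => hy h.2), zero_mul]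
  · rw [indicator_of_notMem hx]
    refine (lintegral_eq_zero_of_ae_eq_zero ?_).symm
    refine Filter.Eventually.of_forall fun y => ?_
    simp only [Pi.zero_apply]
    rw [indicator_of_notMem (fun h => hx h.1), zero_mul]

lemma gagliardoEnergy_univ_eq (s : ℝ) {v : 𝔼 → ℝ} (hv : AEStronglyMeasurable v) :
    gagliardoEnergy s univ v = ∫⁻ p, ENNReal.ofReal (incr v p ^ 2) ∂gagliardoMeasure d s := by
  rw [gagliardoEnergy_eq s MeasurableSet.univ hv, univ_prod_univ, Measure.restrict_univ]

/-- A function of finite energy has square integrable increments. -/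
lemma memLp_incr (s : ℝ) {v : 𝔼 → ℝ} (hv : AEStronglyMeasurable v)
    (h : gagliardoEnergy s univ v < ⊤) : MemLp (incr v) 2 (gagliardoMeasure d s) := by
  have hm : AEStronglyMeasurable (incr v) (gagliardoMeasure d s) :=
    (aestronglyMeasurable_incr hv).mono_ac (gagliardoMeasure_absolutelyContinuous s)
  rw [memLp_two_iff_integrable_sq hm]
  refine ⟨hm.pow 2, ?_⟩
  rw [hasFiniteIntegral_iff_ofReal (Filter.Eventually.of_forall fun p => sq_nonneg _),
    ← gagliardoEnergy_univ_eq s hv]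
  exact h

lemma fracForm_eq (s : ℝ) {v w : 𝔼 → ℝ} (hv : AEStronglyMeasurable v)
    (hw : AEStronglyMeasurable w) (hv' : gagliardoEnergy s univ v < ⊤)
    (hw' : gagliardoEnergy s univ w < ⊤) :
    fracForm s v w = fracConst d s / 2 * ∫ p, incr v p * incr w p ∂gagliardoMeasure d s := by
  have hi : Integrable (fun p => incr v p * incr w p) (gagliardoMeasure d s) :=
    (memLp_incr s hv hv').integrable_mul (memLp_incr s hw hw')
  have hfin : ∀ᵐ p ∂(volume : Measure 𝔼).prod volume,
      ENNReal.ofReal (1 / ‖p.1 - p.2‖ ^ ((d : ℝ) + 2 * s)) < ⊤ :=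
    Filter.Eventually.of_forall fun p => ENNReal.ofReal_lt_top
  rw [gagliardoMeasure, integrable_withDensity_iff_integrable_smul₀'
    (measurable_kernel s).aemeasurable hfin] at hi
  rw [fracForm, gagliardoMeasure, integral_withDensity_eq_integral_toReal_smul₀
    (measurable_kernel s).aemeasurable hfin, integral_prod _ hi]
  congr 1
  refine integral_congr_ae (Filter.Eventually.of_forall fun x => ?_)
  refine integral_congr_ae (Filter.Eventually.of_forall fun y => ?_)
  dsimp only
  rw [ENNReal.toReal_ofReal (by positivity), smul_eq_mul]
  simp only [incr]
  ring

/-! ### Energy estimates for products, cutoffs and tails -/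

lemma exists_lintegral_symm_trunc_le (hd : 1 ≤ d) {s β : ℝ} (hs : 0 < s) (hβ : 2 * s < β) :
    ∃ C : ℝ, 0 < C ∧ ∀ R : ℝ, 0 < R → ∀ g : 𝔼 → ℝ≥0∞, AEMeasurable g →
      ∫⁻ p, (g p.1 + g p.2) * ENNReal.ofReal (min (‖p.1 - p.2‖ / R) 1 ^ β)
          ∂gagliardoMeasure d s ≤
        ENNReal.ofReal (C * R ^ (-(2 * s))) * ∫⁻ x, g x := by
  obtain ⟨C, hC, h⟩ := exists_lintegral_mul_trunc_le (d := d) hd hs hβ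
  obtain ⟨C', hC', h'⟩ := exists_lintegral_mul_trunc_le' (d := d) hd hs hβ
  refine ⟨C + C', by positivity, fun R hR g hg => ?_⟩
  simp_rw [add_mul]
  rw [lintegral_add_left', ENNReal.ofReal_add (by positivity) (by positivity), add_mul]
  · exact add_le_add (h R hR g hg) (h' R hR g hg)
  · refine (((hg.comp_quasiMeasurePreserving Measure.quasiMeasurePreserving_fst)).mul
      (by fun_prop : Measurable fun p : 𝔼 × 𝔼 =>
        ENNReal.ofReal (min (‖p.1 - p.2‖ / R) 1 ^ β)).aemeasurable).mono_ac
        (gagliardoMeasure_absolutelyContinuous s)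

lemma aemeasurable_sq_incr (s : ℝ) {v : 𝔼 → ℝ} (hv : AEStronglyMeasurable v) :
    AEMeasurable (fun p => ENNReal.ofReal (incr v p ^ 2)) (gagliardoMeasure d s) :=
  (((aestronglyMeasurable_incr hv).aemeasurable.pow_const 2).ennreal_ofReal).mono_ac
    (gagliardoMeasure_absolutelyContinuous s)

lemma lintegral_const_mul_sq (c : ℝ) (hc : 0 ≤ c) (v : 𝔼 → ℝ) :
    ∫⁻ x, ENNReal.ofReal (c * v x ^ 2) = ENNReal.ofReal c * sqNorm v := by
  simp_rw [ENNReal.ofReal_mul hc]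
  rw [lintegral_const_mul' _ _ (by simp), sqNorm]

/-- If `F` is bounded by a constant multiple of `(v(x)² + v(y)²) min(|x - y|/R, 1)^β`, its integral
against the Gagliardo kernel is bounded by `R^{-2s} ‖v‖²`. -/
lemma exists_lintegral_le_sqNorm (hd : 1 ≤ d) {s β : ℝ} (hs : 0 < s) (hβ : 2 * s < β) :
    ∃ C : ℝ, 0 < C ∧ ∀ R : ℝ, 0 < R → ∀ c : ℝ, 0 ≤ c → ∀ v : 𝔼 → ℝ, AEStronglyMeasurable v →
      ∫⁻ p, ENNReal.ofReal (c * (v p.1 ^ 2 + v p.2 ^ 2) * min (‖p.1 - p.2‖ / R) 1 ^ β)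
          ∂gagliardoMeasure d s ≤
        ENNReal.ofReal (C * c * R ^ (-(2 * s))) * sqNorm v := by
  obtain ⟨C, hC, h⟩ := exists_lintegral_symm_trunc_le (d := d) hd hs hβ
  refine ⟨C, hC, fun R hR c hc v hv => ?_⟩
  have := h R hR (fun x => ENNReal.ofReal (c * v x ^ 2))
    ((hv.aemeasurable.pow_const 2).const_mul c).ennreal_ofReal
  rw [lintegral_const_mul_sq c hc, ← mul_assoc, ← ENNReal.ofReal_mul (by positivity)] at this
  refine le_trans (le_of_eq (lintegral_congr fun p => ?_)) (this.trans (le_of_eq ?_))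
  · rw [← ENNReal.ofReal_add (by positivity) (by positivity), ← ENNReal.ofReal_mul (by positivity)]
    congr 1; ring
  · congr 2; ring

/-- Multiplication by a bounded function that varies on the scale `R` costs `R^{-2s} ‖g‖²`. -/
lemma exists_energy_mul_le (hd : 1 ≤ d) {s : ℝ} (hs0 : 0 < s) (hs1 : s < 1) :
    ∃ C : ℝ, 0 < C ∧ ∀ R : ℝ, 0 < R → ∀ L : ℝ, ∀ ζ g : 𝔼 → ℝ,
      AEStronglyMeasurable g → (∀ x, |ζ x| ≤ 1) →
      (∀ x y, |ζ x - ζ y| ≤ L * min (‖x - y‖ / R) 1) →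
      ∫⁻ p, ENNReal.ofReal (incr (fun x => ζ x * g x) p ^ 2) ∂gagliardoMeasure d s ≤
        2 * ∫⁻ p, ENNReal.ofReal (incr g p ^ 2) ∂gagliardoMeasure d s +
          ENNReal.ofReal (C * L ^ 2 * R ^ (-(2 * s))) * sqNorm g := by
  obtain ⟨C, hC, h⟩ := exists_lintegral_le_sqNorm (d := d) (s := s) (β := 2) hd hs0 (by linarith)
  refine ⟨C * 2, by positivity, fun R hR L ζ g hg h1 hζ => ?_⟩
  have := h R hR (2 * L ^ 2) (by positivity) g hg
  rw [show C * 2 * L ^ 2 * R ^ (-(2 * s)) = C * (2 * L ^ 2) * R ^ (-(2 * s)) by ring]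
  refine le_trans ?_ (add_le_add_right this _)
  rw [← lintegral_const_mul' _ _ (by simp), ← lintegral_add_left'
    ((aemeasurable_sq_incr s hg).const_mul 2)]
  refine lintegral_mono fun p => ?_
  dsimp only
  have e2 : ∀ a : ℝ≥0∞, 2 * a = ENNReal.ofReal 2 * a := fun a => by simp
  rw [e2, ← ENNReal.ofReal_mul (by norm_num), ← ENNReal.ofReal_add (by positivity) (by positivity)]
  refine ENNReal.ofReal_le_ofReal ?_
  rw [Real.rpow_two]
  have hm : 0 ≤ min (‖p.1 - p.2‖ / R) 1 := by positivity
  have hb : (ζ p.1 - ζ p.2) ^ 2 ≤ L ^ 2 * min (‖p.1 - p.2‖ / R) 1 ^ 2 := by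
    rw [← mul_pow, ← sq_abs]
    exact pow_le_pow_left₀ (abs_nonneg _) (hζ _ _) 2
  have ha : ζ p.1 ^ 2 ≤ 1 := by
    rw [← sq_abs]; exact pow_le_one₀ (abs_nonneg _) (h1 _)
  have e1 : incr (fun x => ζ x * g x) p ^ 2 ≤
      2 * (ζ p.1 ^ 2 * incr g p ^ 2) + 2 * (g p.2 ^ 2 * (ζ p.1 - ζ p.2) ^ 2) := by
    simp only [incr]
    nlinarith [sq_nonneg (ζ p.1 * (g p.1 - g p.2) - g p.2 * (ζ p.1 - ζ p.2))]
  have e3 : ζ p.1 ^ 2 * incr g p ^ 2 ≤ incr g p ^ 2 :=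
    mul_le_of_le_one_left (sq_nonneg _) ha
  have e4 : g p.2 ^ 2 * (ζ p.1 - ζ p.2) ^ 2 ≤
      (g p.1 ^ 2 + g p.2 ^ 2) * (L ^ 2 * min (‖p.1 - p.2‖ / R) 1 ^ 2) :=
    mul_le_mul (by linarith [sq_nonneg (g p.1)]) hb (sq_nonneg _) (by positivity)
  nlinarith

/-- The commutator term in the identity
`δz δ(η² z) = (δ(η z))² - z(x) z(y) (δη)²` is of lower order. -/
lemma exists_commutator_le (hd : 1 ≤ d) {s : ℝ} (hs0 : 0 < s) (hs1 : s < 1) :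
    ∃ C : ℝ, 0 < C ∧ ∀ R : ℝ, 0 < R → ∀ L : ℝ, ∀ η z : 𝔼 → ℝ,
      AEStronglyMeasurable z → (∀ x y, |η x - η y| ≤ L * min (‖x - y‖ / R) 1) →
      ∫⁻ p, ENNReal.ofReal (|z p.1 * z p.2| * incr η p ^ 2) ∂gagliardoMeasure d s ≤
        ENNReal.ofReal (C * L ^ 2 * R ^ (-(2 * s))) * sqNorm z := by
  obtain ⟨C, hC, h⟩ := exists_lintegral_le_sqNorm (d := d) (s := s) (β := 2) hd hs0 (by linarith)
  refine ⟨C, hC, fun R hR L η z hz hη => ?_⟩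
  refine le_trans (lintegral_mono fun p => ENNReal.ofReal_le_ofReal ?_)
    (h R hR (L ^ 2) (by positivity) z hz)
  rw [Real.rpow_two]
  have hb : incr η p ^ 2 ≤ L ^ 2 * min (‖p.1 - p.2‖ / R) 1 ^ 2 := by
    rw [← mul_pow, ← sq_abs]
    exact pow_le_pow_left₀ (abs_nonneg _) (hη _ _) 2
  have ha : |z p.1 * z p.2| ≤ z p.1 ^ 2 + z p.2 ^ 2 := by
    rw [abs_le]; constructor <;> nlinarith [sq_nonneg (z p.1 + z p.2), sq_nonneg (z p.1 - z p.2)]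
  calc |z p.1 * z p.2| * incr η p ^ 2
      ≤ (z p.1 ^ 2 + z p.2 ^ 2) * (L ^ 2 * min (‖p.1 - p.2‖ / R) 1 ^ 2) :=
        mul_le_mul ha hb (sq_nonneg _) (by positivity)
    _ = _ := by ring

/-- Lipschitz functions that vanish outside a bounded set have finite energy. -/
lemma gagliardoEnergy_lt_top_of_lipschitz (hd : 1 ≤ d) {s : ℝ} (hs0 : 0 < s) (hs1 : s < 1)
    {v : 𝔼 → ℝ} {Ω : Set 𝔼} (hΩ : IsOpen Ω) (hΩb : Bornology.IsBounded Ω) {L M : ℝ} (hM : 0 ≤ M)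
    (hv : Continuous v) (hvΩ : ∀ x, x ∉ Ω → v x = 0) (hvM : ∀ x, |v x| ≤ M)
    (hvL : ∀ x y, |v x - v y| ≤ L * ‖x - y‖) : gagliardoEnergy s univ v < ⊤ := by
  obtain ⟨C, hC, h⟩ := exists_lintegral_le_sqNorm (d := d) (s := s) (β := 2) hd hs0 (by linarith)
  set χ : 𝔼 → ℝ := Ω.indicator 1
  have hχ : AEStronglyMeasurable χ :=
    (aestronglyMeasurable_const (b := (1 : ℝ))).indicator hΩ.measurableSet
  have hfin : sqNorm χ < ⊤ := by
    have : sqNorm χ ≤ volume Ω := by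
      rw [← lintegral_indicator_one hΩ.measurableSet, sqNorm]
      refine lintegral_mono fun x => ?_
      by_cases hx : x ∈ Ω <;> simp [χ, hx]
    exact this.trans_lt hΩb.measure_lt_top
  rw [gagliardoEnergy_univ_eq s hv.aestronglyMeasurable]
  refine lt_of_le_of_lt (lintegral_mono fun p => ENNReal.ofReal_le_ofReal ?_)
    ((h 1 one_pos ((|L| + 2 * M) ^ 2) (by positivity) χ hχ).trans_lt
      (ENNReal.mul_lt_top ENNReal.ofReal_lt_top hfin))
  by_cases h0 : p.1 ∉ Ω ∧ p.2 ∉ Ω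
  · simp only [incr, hvΩ _ h0.1, hvΩ _ h0.2, sub_self]
    rw [zero_pow two_ne_zero]
    positivity
  have h1 : 1 ≤ χ p.1 ^ 2 + χ p.2 ^ 2 := by
    by_cases a : p.1 ∈ Ω <;> by_cases b : p.2 ∈ Ω <;> simp_all [χ]
  have hm : 0 ≤ min (‖p.1 - p.2‖ / 1) 1 := by positivity
  have h2 : |v p.1 - v p.2| ≤ (|L| + 2 * M) * min (‖p.1 - p.2‖ / 1) 1 := by
    rcases le_total (‖p.1 - p.2‖ / 1) 1 with h' | h'
    · rw [min_eq_left h', div_one]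
      have := hvL p.1 p.2
      nlinarith [norm_nonneg (p.1 - p.2), le_abs_self L]
    · rw [min_eq_right h', mul_one]
      have := abs_sub (v p.1) (v p.2)
      linarith [hvM p.1, hvM p.2, abs_nonneg L]
  rw [Real.rpow_two]
  calc incr v p ^ 2 = |v p.1 - v p.2| ^ 2 := by rw [sq_abs]; rfl
    _ ≤ ((|L| + 2 * M) * min (‖p.1 - p.2‖ / 1) 1) ^ 2 :=
        pow_le_pow_left₀ (abs_nonneg _) h2 2
    _ = (|L| + 2 * M) ^ 2 * 1 * min (‖p.1 - p.2‖ / 1) 1 ^ 2 := by ring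
    _ ≤ _ := by gcongr

/-- The form of `w` with a function supported well inside `B_R` only sees the local energy of `w`
and its `L²` norm. -/
lemma exists_localized_form_le (hd : 1 ≤ d) {s : ℝ} (hs0 : 0 < s) (hs1 : s < 1) :
    ∃ C : ℝ, 0 < C ∧ ∀ R : ℝ, 0 < R → ∀ ε : ℝ, 0 < ε → ∀ x₀ : 𝔼, ∀ w ψ : 𝔼 → ℝ,
      AEStronglyMeasurable w → AEStronglyMeasurable ψ →
      (∀ x, x ∉ Metric.ball x₀ (7 / 8 * R) → ψ x = 0) →
      ∫⁻ p, ENNReal.ofReal |incr w p * incr ψ p| ∂gagliardoMeasure d s ≤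
        ENNReal.ofReal ε * ∫⁻ p, ENNReal.ofReal (incr ψ p ^ 2) ∂gagliardoMeasure d s +
        ENNReal.ofReal ε⁻¹ * gagliardoEnergy s (Metric.ball x₀ R) w +
        (ENNReal.ofReal (C * ε * R ^ (-(2 * s))) * sqNorm ψ +
          ENNReal.ofReal (C * ε⁻¹ * R ^ (-(2 * s))) * sqNorm w) := by
  obtain ⟨C, hC, h⟩ := exists_lintegral_le_sqNorm (d := d) (s := s) (β := 2) hd hs0 (by linarith)
  refine ⟨C * (1 / 8) ^ (-(2 * s)), by positivity, fun R hR ε hε x₀ w ψ hw hψ hsupp => ?_⟩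
  have hR8 : 0 < 1 / 8 * R := by positivity
  have hc : ∀ a : ℝ, C * (1 / 8) ^ (-(2 * s)) * a * R ^ (-(2 * s)) =
      C * a * (1 / 8 * R) ^ (-(2 * s)) := fun a => by
    rw [Real.mul_rpow (by norm_num) hR.le]; ring
  rw [hc, hc]
  have hB : MeasurableSet (Metric.ball x₀ R ×ˢ Metric.ball x₀ R) :=
    Metric.isOpen_ball.measurableSet.prod Metric.isOpen_ball.measurableSet
  refine le_trans ?_ (add_le_add_right (add_le_add (h _ hR8 ε hε.le ψ hψ)
    (h _ hR8 ε⁻¹ (by positivity) w hw)) _)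
  have mt : ∀ (a : ℝ) {v : 𝔼 → ℝ}, AEStronglyMeasurable v → AEMeasurable (fun p : 𝔼 × 𝔼 =>
      ENNReal.ofReal (a * (v p.1 ^ 2 + v p.2 ^ 2) * min (‖p.1 - p.2‖ / (1 / 8 * R)) 1 ^ (2 : ℝ)))
      (gagliardoMeasure d s) := by
    intro a v hv
    refine AEMeasurable.mono_ac ?_ (gagliardoMeasure_absolutelyContinuous s)
    have h1 := hv.aemeasurable.comp_quasiMeasurePreserving
      (Measure.quasiMeasurePreserving_fst (μ := (volume : Measure 𝔼)) (ν := (volume : Measure 𝔼)))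
    have h2 := hv.aemeasurable.comp_quasiMeasurePreserving
      (Measure.quasiMeasurePreserving_snd (μ := (volume : Measure 𝔼)) (ν := (volume : Measure 𝔼)))
    exact ((((h1.pow_const 2).add (h2.pow_const 2)).const_mul a).mul
      (by fun_prop : Measurable fun p : 𝔼 × 𝔼 =>
        min (‖p.1 - p.2‖ / (1 / 8 * R)) 1 ^ (2 : ℝ)).aemeasurable).ennreal_ofReal
  rw [gagliardoEnergy_eq s Metric.isOpen_ball.measurableSet hw, ← lintegral_indicator hB,
    ← lintegral_const_mul' _ _ (by simp), ← lintegral_const_mul' _ _ (by simp),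
    ← lintegral_add_left' ((aemeasurable_sq_incr s hψ).const_mul _),
    ← lintegral_add_left' (mt ε hψ), ← lintegral_add_left' (by
      exact ((aemeasurable_sq_incr s hψ).const_mul _).add
        (((aemeasurable_sq_incr s hw).indicator hB).const_mul _))]
  refine lintegral_mono fun p => ?_
  dsimp only
  have hi : ε * ε⁻¹ = 1 := mul_inv_cancel₀ hε.ne'
  have young : ∀ a b : ℝ, |a * b| ≤ ε * b ^ 2 + ε⁻¹ * a ^ 2 / 2 := by
    intro a b
    have h1 := sq_nonneg (ε * b - a)
    have h2 := sq_nonneg (ε * b + a)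
    have e : ε * b ^ 2 + ε⁻¹ * a ^ 2 / 2 = ε⁻¹ * ((ε * b) ^ 2 + a ^ 2 / 2) := by
      field_simp
    rw [e, abs_le]
    have e' : a * b = ε⁻¹ * (ε * b * a) := by field_simp
    have hp : 0 < ε⁻¹ := by positivity
    constructor
    · rw [e', ← mul_neg_one, ← sub_nonneg]
      have : 0 ≤ ε⁻¹ * ((ε * b) ^ 2 + a ^ 2 / 2 + ε * b * a) :=
        mul_nonneg hp.le (by nlinarith)
      linarith
    · rw [e']
      exact mul_le_mul_of_nonneg_left (by nlinarith) hp.le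
  have far : ∀ x y : 𝔼, x ∈ Metric.ball x₀ (7 / 8 * R) → y ∉ Metric.ball x₀ R →
      min (‖x - y‖ / (1 / 8 * R)) 1 = 1 := by
    intro x y hx hy
    refine min_eq_right ?_
    rw [Metric.mem_ball] at hx hy
    rw [le_div_iff₀ hR8, ← dist_eq_norm]
    linarith [dist_triangle y x x₀, dist_comm x y]
  by_cases hpB : p ∈ Metric.ball x₀ R ×ˢ Metric.ball x₀ R
  · rw [indicator_of_mem hpB]
    refine le_trans ?_ le_self_add
    rw [← ENNReal.ofReal_mul hε.le, ← ENNReal.ofReal_mul (by positivity),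
      ← ENNReal.ofReal_add (by positivity) (by positivity)]
    refine ENNReal.ofReal_le_ofReal ((young _ _).trans ?_)
    have : 0 ≤ ε⁻¹ * incr w p ^ 2 := by positivity
    linarith
  rw [indicator_of_notMem hpB]
  refine le_trans ?_ le_add_self
  rw [← ENNReal.ofReal_add (by positivity) (by positivity)]
  refine ENNReal.ofReal_le_ofReal ?_
  have hw4 : ∀ a b : ℝ, ε⁻¹ * (a - b) ^ 2 / 2 ≤ ε⁻¹ * (a ^ 2 + b ^ 2) := by
    intro a b
    rw [mul_div_assoc]
    exact mul_le_mul_of_nonneg_left (by nlinarith [sq_nonneg (a + b)]) (by positivity)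
  by_cases h1 : p.1 ∈ Metric.ball x₀ (7 / 8 * R)
  · have hy : p.2 ∉ Metric.ball x₀ R := fun hy =>
      hpB ⟨Metric.ball_subset_ball (by linarith) h1, hy⟩
    have hψ2 : ψ p.2 = 0 := hsupp _ fun h' => hy (Metric.ball_subset_ball (by linarith) h')
    rw [far _ _ h1 hy, Real.one_rpow, mul_one, mul_one, hψ2]
    have := young (incr w p) (ψ p.1)
    have h4 := hw4 (w p.1) (w p.2)
    simp only [incr, hψ2, sub_zero] at this ⊢
    linarith
  by_cases h2 : p.2 ∈ Metric.ball x₀ (7 / 8 * R)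
  · have hy : p.1 ∉ Metric.ball x₀ R := fun hy =>
      hpB ⟨hy, Metric.ball_subset_ball (by linarith) h2⟩
    have hψ1 : ψ p.1 = 0 := hsupp _ h1
    rw [norm_sub_rev, far _ _ h2 hy, Real.one_rpow, mul_one, mul_one, hψ1]
    have := young (incr w p) (ψ p.2)
    have h4 := hw4 (w p.1) (w p.2)
    simp only [incr, hψ1, zero_sub, mul_neg, abs_neg] at this ⊢
    linarith
  · simp only [incr, hsupp _ h1, hsupp _ h2, sub_self, mul_zero, abs_zero]
    positivity

/-! ### Pairing with a function that is small on the scale of a mesh -/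

/-- Young's inequality with the weight `t`. -/
lemma abs_mul_le_of_sq_le {t a b A B : ℝ} (ht : 0 < t) (ha : t * a ^ 2 ≤ A)
    (hb : t⁻¹ * b ^ 2 ≤ B) : |a * b| ≤ A + B := by
  have h1 : |a * b| ≤ t * a ^ 2 + t⁻¹ * b ^ 2 := by
    have e : t * a ^ 2 + t⁻¹ * b ^ 2 = t⁻¹ * ((t * a) ^ 2 + b ^ 2) := by field_simp
    have e' : a * b = t⁻¹ * (t * a * b) := by field_simp
    rw [e, e', abs_mul, abs_of_pos (by positivity : 0 < t⁻¹)]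
    refine mul_le_mul_of_nonneg_left ?_ (by positivity)
    rw [abs_le]
    constructor <;> nlinarith [sq_nonneg (t * a + b), sq_nonneg (t * a - b)]
  linarith

/-- The integrand `|δv δe|` at a pair of points whose distance `r` is below the size `h` of the cell
that contains the first one: `a` and `b` are the increments of `v` and `e`, and `D` stands for
`h ^ d`. Young's inequality is used with the weight `(h / R) ^ (2 s) / ε`, which distributes the
powers of `h` and `R` as in the claim. -/
lemma near_pointwise {s C₁ c h R ε P Q a b r D : ℝ} (hs0 : 0 < s) (hs1 : s < 1) (hC₁ : 0 < C₁)
    (hc : 0 < c) (hc1 : c ≤ 1) (hh : 0 < h) (hhR : h ≤ R) (hε : 0 < ε) (hP : 0 ≤ P) (hQ : 0 ≤ Q)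
    (hD : 0 < D) (hr0 : 0 ≤ r) (hr : r < c * h)
    (ha : h ^ 2 * D * a ^ 2 ≤ C₁ * P * r ^ 2)
    (hb : R ^ 2 * D * b ^ 2 ≤ C₁ * h ^ (2 * s) * Q * r ^ 2) :
    |a * b| ≤ h ^ (2 * s) / D * C₁ * (ε⁻¹ * R ^ (-(2 * s)) * P + 2 * ε * Q) *
      min (r / (c * h)) 1 ^ (2 : ℝ) := by
  have hR : 0 < R := hh.trans_le hhR
  have hch : 0 < c * h := by positivity
  rw [Real.rpow_two, min_eq_left ((div_le_one hch).2 hr.le)]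
  have hrr : r ^ 2 / h ^ 2 ≤ (r / (c * h)) ^ 2 := by
    rw [← div_pow]
    refine pow_le_pow_left₀ (by positivity) ?_ 2
    exact div_le_div_of_nonneg_left hr0 hch (by nlinarith)
  have hl : (h / R) ^ (2 * s) = h ^ (2 * s) * R ^ (-(2 * s)) := by
    rw [Real.div_rpow hh.le hR.le, Real.rpow_neg hR.le, div_eq_mul_inv]
  have hlp : 0 < (h / R) ^ (2 * s) := by positivity
  have hhs : 0 < h ^ (2 * s) := by positivity
  have hmul : h ^ 2 * R ^ (2 * s) ≤ R ^ 2 * h ^ (2 * s) := by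
    have e : ∀ t : ℝ, 0 < t → t ^ 2 = t ^ (2 - 2 * s) * t ^ (2 * s) := fun t ht => by
      rw [← Real.rpow_add ht, ← Real.rpow_two]; congr 1; ring
    rw [e h hh, e R hR]
    have := Real.rpow_le_rpow hh.le hhR (by linarith : 0 ≤ 2 - 2 * s)
    have hRs : 0 < R ^ (2 * s) := by positivity
    nlinarith [mul_pos hhs hRs]
  refine (abs_mul_le_of_sq_le (t := (h / R) ^ (2 * s) / ε)
    (A := h ^ (2 * s) / D * C₁ * (ε⁻¹ * R ^ (-(2 * s)) * P) * (r ^ 2 / h ^ 2))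
    (B := h ^ (2 * s) / D * C₁ * (ε * Q) * (r ^ 2 / h ^ 2)) (by positivity) ?_ ?_).trans ?_
  · have h1 : a ^ 2 ≤ C₁ * P * r ^ 2 / (h ^ 2 * D) := by
      rw [le_div_iff₀ (by positivity)]; linarith
    refine (mul_le_mul_of_nonneg_left h1 (by positivity)).trans (le_of_eq ?_)
    rw [hl]; field_simp
  · have h1 : b ^ 2 ≤ C₁ * h ^ (2 * s) * Q * r ^ 2 / (R ^ 2 * D) := by
      rw [le_div_iff₀ (by positivity)]; linarith
    refine (mul_le_mul_of_nonneg_left h1 (by positivity)).trans ?_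
    have e1 : ((h / R) ^ (2 * s) / ε)⁻¹ * (C₁ * h ^ (2 * s) * Q * r ^ 2 / (R ^ 2 * D)) =
        ((h ^ 2 * R ^ (2 * s)) / (R ^ 2 * h ^ (2 * s))) *
          (h ^ (2 * s) / D * C₁ * (ε * Q) * (r ^ 2 / h ^ 2)) := by
      rw [Real.div_rpow hh.le hR.le]; field_simp
    rw [e1]
    refine mul_le_of_le_one_left (by positivity) ?_
    rw [div_le_one (by positivity)]
    exact hmul
  · rw [← add_mul, ← mul_add]
    refine mul_le_mul ?_ hrr (by positivity) (by positivity)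
    refine mul_le_mul_of_nonneg_left ?_ (by positivity)
    nlinarith [mul_nonneg hε.le hQ]

/-- The integrand `|δv δe|` at a pair of points whose distance `r` is at least the size `h` of the
cell that contains the first one. Here `b` is the value of `e` at that point only, and the increment
`a` of `v` is estimated by the values of `v`. -/
lemma far_pointwise {s C₁ c h R ε P Q a b vx vy r D : ℝ} (hs0 : 0 < s) (hs1 : s < 1)
    (hC₁ : 0 < C₁) (hc : 0 < c) (hc1 : c ≤ 1) (hh : 0 < h) (hhR : h ≤ R) (hε : 0 < ε)
    (hP : 0 ≤ P) (hQ : 0 ≤ Q) (hD : 0 < D) (hr : c * h ≤ r) (ha : a = vx - vy)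
    (hb : D * b ^ 2 ≤ C₁ * (h / R) ^ 2 * h ^ (2 * s) * Q) :
    |a * b| ≤ h ^ (2 * s) / D * C₁ * (ε⁻¹ * R ^ (-(2 * s)) * P + 2 * ε * Q) *
      min (r / (c * h)) 1 ^ (2 : ℝ) +
      2 * (c ^ 2)⁻¹ * ε⁻¹ * (vx ^ 2 + vy ^ 2) * min (r / R) 1 ^ (1 + s) := by
  have hR : 0 < R := hh.trans_le hhR
  have hch : 0 < c * h := by positivity
  rw [min_eq_right ((one_le_div hch).2 hr), Real.one_rpow, mul_one]
  have hr0 : 0 ≤ r := hch.le.trans hr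
  have hlam : 0 < h / R := by positivity
  have hlam1 : h / R ≤ 1 := (div_le_one hR).2 hhR
  rw [add_comm]
  refine abs_mul_le_of_sq_le (t := (h / R) ^ (1 + s) / ε) (by positivity) ?_ ?_
  · have h1 : a ^ 2 ≤ 2 * (vx ^ 2 + vy ^ 2) := by
      rw [ha]; nlinarith [sq_nonneg (vx + vy)]
    have h2 : (h / R) ^ (1 + s) ≤ (c ^ 2)⁻¹ * min (r / R) 1 ^ (1 + s) := by
      have h3 : c * (h / R) ≤ min (r / R) 1 := by
        refine le_min ?_ (by nlinarith)
        rw [← mul_div_assoc]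
        exact div_le_div_of_nonneg_right hr hR.le
      have h4 := Real.rpow_le_rpow (by positivity) h3 (by linarith : 0 ≤ 1 + s)
      rw [Real.mul_rpow hc.le hlam.le] at h4
      have h5 : c ^ 2 ≤ c ^ (1 + s) := by
        rw [← Real.rpow_two]
        exact Real.rpow_le_rpow_of_exponent_ge hc hc1 (by linarith)
      rw [inv_mul_eq_div, le_div_iff₀ (by positivity)]
      have h6 : 0 < (h / R) ^ (1 + s) := by positivity
      nlinarith
    have h6 : 0 < (h / R) ^ (1 + s) := by positivity
    calc (h / R) ^ (1 + s) / ε * a ^ 2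
        ≤ ((c ^ 2)⁻¹ * min (r / R) 1 ^ (1 + s)) / ε * (2 * (vx ^ 2 + vy ^ 2)) := by gcongr
      _ = _ := by field_simp
  · have h1 : b ^ 2 ≤ C₁ * (h / R) ^ 2 * h ^ (2 * s) * Q / D := by
      rw [le_div_iff₀ hD]; linarith
    have h2 : (h / R) ^ 2 ≤ (h / R) ^ (1 + s) := by
      rw [← Real.rpow_two]
      exact Real.rpow_le_rpow_of_exponent_ge hlam hlam1 (by linarith)
    calc ((h / R) ^ (1 + s) / ε)⁻¹ * b ^ 2
        ≤ ((h / R) ^ (1 + s) / ε)⁻¹ * (C₁ * (h / R) ^ 2 * h ^ (2 * s) * Q / D) := by gcongr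
      _ ≤ ((h / R) ^ (1 + s) / ε)⁻¹ * (C₁ * (h / R) ^ (1 + s) * h ^ (2 * s) * Q / D) := by gcongr
      _ = h ^ (2 * s) / D * C₁ * (ε * Q) := by
          field_simp
      _ ≤ _ := by
          refine mul_le_mul_of_nonneg_left ?_ (by positivity)
          have : 0 ≤ ε⁻¹ * R ^ (-(2 * s)) * P := by positivity
          nlinarith [mul_nonneg hε.le hQ]

/-- Localization of the form `∫ |δv δe|` to mesh cells `T i` of sizes `h i ≤ R`. Here `e` is the
interpolation error: it vanishes off the cells, and on a cell it carries a factor `h i / R`. Pairs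
of points closer than the local mesh size are treated by Lipschitz bounds of `v` and `e`, the
remaining ones by the size of `e`. The factor `(h i / R) ^ (1 - s)` that is left over in the latter
makes up for the lack of a uniform mesh size: it lets the truncated kernels of exponent `1 + s`
replace the sum over the cells. -/
lemma exists_near_far_le (hd : 1 ≤ d) {s : ℝ} (hs0 : 0 < s) (hs1 : s < 1) {C₀ C₁ c : ℝ}
    (hC₀ : 0 < C₀) (hC₁ : 0 < C₁) (hc : 0 < c) (hc1 : c ≤ 1) :
    ∃ C : ℝ, 0 < C ∧ ∀ {ι : Type} (S : Finset ι) (T : ι → Set 𝔼) (h P Q : ι → ℝ) (R ε : ℝ)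
      (v e : 𝔼 → ℝ), 0 < ε → (∀ i ∈ S, MeasurableSet (T i)) →
      (∀ i ∈ S, 0 < h i) → (∀ i ∈ S, h i ≤ R) → 0 < R →
      (∀ i ∈ S, volume (T i) ≤ ENNReal.ofReal (C₀ * h i ^ d)) →
      (∀ i ∈ S, 0 ≤ P i) → (∀ i ∈ S, 0 ≤ Q i) → AEStronglyMeasurable v →
      (∀ i ∈ S, ∀ x ∈ T i, ∀ y, ‖x - y‖ < c * h i →
        h i ^ 2 * h i ^ d * (v x - v y) ^ 2 ≤ C₁ * P i * ‖x - y‖ ^ 2) →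
      (∀ i ∈ S, ∀ x ∈ T i, ∀ y, ‖x - y‖ < c * h i →
        R ^ 2 * h i ^ d * (e x - e y) ^ 2 ≤ C₁ * h i ^ (2 * s) * Q i * ‖x - y‖ ^ 2) →
      (∀ i ∈ S, ∀ x ∈ T i, h i ^ d * e x ^ 2 ≤ C₁ * (h i / R) ^ 2 * h i ^ (2 * s) * Q i) →
      (∀ x, (∀ i ∈ S, x ∉ T i) → e x = 0) →
      ∫⁻ p, ENNReal.ofReal |incr v p * incr e p| ∂gagliardoMeasure d s ≤
        ENNReal.ofReal (C * (ε * ∑ i ∈ S, Q i + ε⁻¹ * R ^ (-(2 * s)) * ∑ i ∈ S, P i)) +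
          ENNReal.ofReal (C * ε⁻¹ * R ^ (-(2 * s))) * sqNorm v := by
  obtain ⟨K₁, hK₁, hk₁⟩ := exists_lintegral_mul_trunc_le (d := d) (β := 2) hd hs0 (by linarith)
  obtain ⟨K₂, hK₂, hk₂⟩ := exists_lintegral_le_sqNorm (d := d) (s := s) (β := 1 + s) hd hs0
    (by linarith)
  obtain ⟨A, hA⟩ : ∃ A, A = K₁ * c ^ (-(2 * s)) * C₀ * C₁ := ⟨_, rfl⟩
  have hA0 : 0 < A := by rw [hA]; positivity
  refine ⟨2 * (2 * A) + 2 * (K₂ * (2 * (c ^ 2)⁻¹)), by positivity, ?_⟩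
  intro ι S T h P Q R ε v e hε hT hh hhR hR hvol hP hQ hvm hv he hfar hoff
  set α : ι → ℝ := fun i =>
    h i ^ (2 * s) / h i ^ d * C₁ * (ε⁻¹ * R ^ (-(2 * s)) * P i + 2 * ε * Q i) with hα
  have hα0 : ∀ i ∈ S, 0 ≤ α i := fun i hi => by
    have := hh i hi
    have := hP i hi
    have := hQ i hi
    simp only [hα]; positivity
  set Hn : 𝔼 × 𝔼 → ℝ≥0∞ := fun p => ∑ i ∈ S, (T i).indicator (fun _ => ENNReal.ofReal (α i)) p.1 *
    ENNReal.ofReal (min (‖p.1 - p.2‖ / (c * h i)) 1 ^ (2 : ℝ)) with hHn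
  set Hf : 𝔼 × 𝔼 → ℝ≥0∞ := fun p => ENNReal.ofReal (2 * (c ^ 2)⁻¹ * ε⁻¹ *
    (v p.1 ^ 2 + v p.2 ^ 2) * min (‖p.1 - p.2‖ / R) 1 ^ (1 + s)) with hHf
  have hHn_le : ∀ i ∈ S, ∀ x ∈ T i, ∀ y, ENNReal.ofReal (α i *
      min (‖x - y‖ / (c * h i)) 1 ^ (2 : ℝ)) ≤ Hn (x, y) := by
    intro i hi x hx y
    have := Finset.single_le_sum (f := fun i => (T i).indicator
      (fun _ => ENNReal.ofReal (α i)) x *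
      ENNReal.ofReal (min (‖x - y‖ / (c * h i)) 1 ^ (2 : ℝ))) (fun _ _ => zero_le) hi
    refine le_trans (le_of_eq ?_) this
    simp only [indicator_of_mem hx]
    rw [ENNReal.ofReal_mul (hα0 i hi)]
  -- the contribution of `e x`, when the two points are not close to each other
  have key : ∀ x y, (∀ i ∈ S, x ∈ T i → c * h i ≤ ‖x - y‖) →
      ENNReal.ofReal |(v x - v y) * e x| ≤ Hn (x, y) + Hf (x, y) := by
    intro x y hxy
    by_cases h0 : e x = 0
    · simp [h0]
    have : ∃ i ∈ S, x ∈ T i := by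
      by_contra hcon
      push Not at hcon
      exact h0 (hoff x hcon)
    obtain ⟨i, hi, hx⟩ := this
    refine le_trans (ENNReal.ofReal_le_ofReal (far_pointwise hs0 hs1 hC₁ hc hc1 (hh i hi) (hhR i hi)
      hε (hP i hi) (hQ i hi) (pow_pos (hh i hi) d) (hxy i hi hx) rfl (hfar i hi x hx))) ?_
    refine ENNReal.ofReal_add_le.trans (add_le_add ?_ le_rfl)
    exact hHn_le i hi x hx y
  have hsymm : ∀ x y, Hf (y, x) = Hf (x, y) := fun x y => by
    simp only [hHf, norm_sub_rev y x, add_comm (v y ^ 2)]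
  have hpt : ∀ p, ENNReal.ofReal |incr v p * incr e p| ≤ Hn p + Hn p.swap + 2 * Hf p := by
    rintro ⟨x, y⟩
    simp only [incr, Prod.swap_prod_mk]
    by_cases hA' : ∃ i ∈ S, x ∈ T i ∧ ‖x - y‖ < c * h i
    · obtain ⟨i, hi, hx, hr⟩ := hA'
      refine le_trans (ENNReal.ofReal_le_ofReal (near_pointwise hs0 hs1 hC₁ hc hc1 (hh i hi)
        (hhR i hi) hε (hP i hi) (hQ i hi) (pow_pos (hh i hi) d) (norm_nonneg _) hr
        (hv i hi x hx y hr) (he i hi x hx y hr))) ?_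
      rw [add_assoc]
      exact (hHn_le i hi x hx y).trans le_self_add
    by_cases hB' : ∃ i ∈ S, y ∈ T i ∧ ‖y - x‖ < c * h i
    · obtain ⟨i, hi, hx, hr⟩ := hB'
      have e1 : |(v x - v y) * (e x - e y)| = |(v y - v x) * (e y - e x)| := by
        congr 1; ring
      rw [e1]
      refine le_trans (ENNReal.ofReal_le_ofReal (near_pointwise hs0 hs1 hC₁ hc hc1 (hh i hi)
        (hhR i hi) hε (hP i hi) (hQ i hi) (pow_pos (hh i hi) d) (norm_nonneg _) hr
        (hv i hi y hx x hr) (he i hi y hx x hr))) ?_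
      rw [add_comm (Hn (x, y)), add_assoc]
      exact (hHn_le i hi y hx x).trans le_self_add
    push Not at hA' hB'
    have h1 := key x y hA'
    have h2 := key y x hB'
    rw [hsymm] at h2
    have h3 : |(v x - v y) * (e x - e y)| ≤ |(v x - v y) * e x| + |(v y - v x) * e y| := by
      have : (v x - v y) * (e x - e y) = (v x - v y) * e x + (v y - v x) * e y := by ring
      rw [this]; exact abs_add_le _ _
    calc ENNReal.ofReal |(v x - v y) * (e x - e y)|
        ≤ ENNReal.ofReal |(v x - v y) * e x| + ENNReal.ofReal |(v y - v x) * e y| :=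
          (ENNReal.ofReal_le_ofReal h3).trans ENNReal.ofReal_add_le
      _ ≤ (Hn (x, y) + Hf (x, y)) + (Hn (y, x) + Hf (x, y)) := add_le_add h1 h2
      _ = _ := by rw [two_mul]; abel
  have hHn_meas : Measurable Hn := by
    refine Finset.measurable_sum _ fun i hi => ?_
    exact ((measurable_const.indicator (hT i hi)).comp measurable_fst).mul (by fun_prop)
  have hHn_meas' : Measurable fun p : 𝔼 × 𝔼 => Hn p + Hn p.swap :=
    hHn_meas.add (hHn_meas.comp measurable_swap)
  have hHn_int : ∫⁻ p, Hn p ∂gagliardoMeasure d s ≤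
      ENNReal.ofReal (2 * A * (ε * ∑ i ∈ S, Q i + ε⁻¹ * R ^ (-(2 * s)) * ∑ i ∈ S, P i)) := by
    have hmeas : ∀ i ∈ S, AEMeasurable (fun p : 𝔼 × 𝔼 =>
        (T i).indicator (fun _ => ENNReal.ofReal (α i)) p.1 *
          ENNReal.ofReal (min (‖p.1 - p.2‖ / (c * h i)) 1 ^ (2 : ℝ))) (gagliardoMeasure d s) :=
      fun i hi => Measurable.aemeasurable
        (((measurable_const.indicator (hT i hi)).comp measurable_fst).mul (by fun_prop))
    simp only [hHn]
    rw [lintegral_finsetSum' S hmeas]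
    have hsum : ∀ i ∈ S, ∫⁻ p, (T i).indicator (fun _ => ENNReal.ofReal (α i)) p.1 *
        ENNReal.ofReal (min (‖p.1 - p.2‖ / (c * h i)) 1 ^ (2 : ℝ)) ∂gagliardoMeasure d s ≤
        ENNReal.ofReal (A * (ε⁻¹ * R ^ (-(2 * s)) * P i + 2 * ε * Q i)) := by
      intro i hi
      have hhi := hh i hi
      refine (hk₁ (c * h i) (by positivity) ((T i).indicator (fun _ => ENNReal.ofReal (α i)))
        (measurable_const.indicator (hT i hi)).aemeasurable).trans ?_
      rw [lintegral_indicator_const (hT i hi)]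
      refine (mul_le_mul_right (mul_le_mul_right (hvol i hi) _) _).trans (le_of_eq ?_)
      rw [← ENNReal.ofReal_mul (hα0 i hi), ← ENNReal.ofReal_mul (by positivity)]
      congr 1
      simp only [hα, hA]
      rw [Real.mul_rpow hc.le hhi.le, Real.rpow_neg hhi.le]
      have h1 : h i ^ (2 * s) ≠ 0 := by positivity
      have h2 : h i ^ d ≠ 0 := by positivity
      field_simp
    refine (Finset.sum_le_sum hsum).trans ?_
    rw [← ENNReal.ofReal_sum_of_nonneg (fun i hi => by
      have := hP i hi
      have := hQ i hi
      positivity)]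
    refine ENNReal.ofReal_le_ofReal ?_
    rw [← Finset.mul_sum, Finset.sum_add_distrib, ← Finset.mul_sum, ← Finset.mul_sum, mul_comm 2 A,
      mul_assoc A 2]
    refine mul_le_mul_of_nonneg_left ?_ hA0.le
    have : 0 ≤ ε⁻¹ * R ^ (-(2 * s)) * ∑ i ∈ S, P i :=
      mul_nonneg (by positivity) (Finset.sum_nonneg hP)
    linarith
  have hHf_int := hk₂ R hR (2 * (c ^ 2)⁻¹ * ε⁻¹) (by positivity) v hvm
  have hsum0 : 0 ≤ ε * ∑ i ∈ S, Q i + ε⁻¹ * R ^ (-(2 * s)) * ∑ i ∈ S, P i :=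
    add_nonneg (mul_nonneg hε.le (Finset.sum_nonneg hQ))
      (mul_nonneg (by positivity) (Finset.sum_nonneg hP))
  calc ∫⁻ p, ENNReal.ofReal |incr v p * incr e p| ∂gagliardoMeasure d s
      ≤ ∫⁻ p, Hn p + Hn p.swap + 2 * Hf p ∂gagliardoMeasure d s := lintegral_mono hpt
    _ = 2 * ∫⁻ p, Hn p ∂gagliardoMeasure d s + 2 * ∫⁻ p, Hf p ∂gagliardoMeasure d s := by
        rw [lintegral_add_left hHn_meas',
          lintegral_add_left hHn_meas, lintegral_swap_gagliardoMeasure,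
          lintegral_const_mul' _ _ (by simp), two_mul (∫⁻ p, Hn p ∂gagliardoMeasure d s)]
    _ ≤ 2 * ENNReal.ofReal (2 * A * (ε * ∑ i ∈ S, Q i + ε⁻¹ * R ^ (-(2 * s)) * ∑ i ∈ S, P i)) +
        2 * (ENNReal.ofReal (K₂ * (2 * (c ^ 2)⁻¹ * ε⁻¹) * R ^ (-(2 * s))) * sqNorm v) :=
        add_le_add (mul_le_mul_right hHn_int _) (mul_le_mul_right hHf_int _)
    _ ≤ _ := by
        have e2 : ∀ a : ℝ≥0∞, 2 * a = ENNReal.ofReal 2 * a := fun a => by simp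
        rw [e2 (ENNReal.ofReal _), e2 (_ * _), ← mul_assoc (ENNReal.ofReal 2), ← ENNReal.ofReal_mul (by norm_num),
          ← ENNReal.ofReal_mul (by norm_num)]
        refine add_le_add (ENNReal.ofReal_le_ofReal ?_) (mul_le_mul_left
          (ENNReal.ofReal_le_ofReal ?_) _)
        · rw [← mul_assoc]
          refine mul_le_mul_of_nonneg_right ?_ hsum0
          have : 0 < K₂ * (2 * (c ^ 2)⁻¹) := by positivity
          linarith
        · rw [← sub_nonneg]
          have : 0 ≤ (2 * (2 * A)) * ε⁻¹ * R ^ (-(2 * s)) := by positivity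
          nlinarith

/-! ### Affine functions and simplices -/

/-- A function that is `L`-Lipschitz on each of finitely many closed sets covering `[a, b]` does not
change by more than `L (b - a)` from `a` to `b`. -/
lemma abs_sub_le_of_closed_cover_Icc {ι : Type*} [DecidableEq ι] {L : ℝ} {f : ℝ → ℝ} {b : ℝ}
    {C : ι → Set ℝ} (hC : ∀ i, IsClosed (C i))
    (hf : ∀ i, ∀ x ∈ C i, ∀ y ∈ C i, |f x - f y| ≤ L * |x - y|) (S : Finset ι) :
    ∀ a, a ≤ b → Icc a b ⊆ ⋃ i ∈ S, C i → |f a - f b| ≤ L * (b - a) := by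
  induction hn : S.card generalizing S with
  | zero =>
    intro a hab hcov
    rw [Finset.card_eq_zero] at hn
    have := hcov (left_mem_Icc.2 hab)
    simp [hn] at this
  | succ n ih =>
    intro a hab hcov
    have ha := hcov (left_mem_Icc.2 hab)
    simp only [mem_iUnion, exists_prop] at ha
    obtain ⟨i, hi, hai⟩ := ha
    have hcpt : IsCompact (C i ∩ Icc a b) := isCompact_Icc.inter_left (hC i)
    obtain ⟨m, ⟨hmC, hm⟩, hmax⟩ := hcpt.exists_isGreatest ⟨a, hai, left_mem_Icc.2 hab⟩
    have h1 : |f a - f m| ≤ L * (m - a) := by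
      have := hf i a hai m hmC
      rwa [abs_sub_comm a m, abs_of_nonneg (by linarith [hm.1] : 0 ≤ m - a)] at this
    rcases hm.2.eq_or_lt with h | h
    · rw [h] at h1; exact h1
    have hcl : Icc m b ⊆ ⋃ j ∈ S.erase i, C j := by
      rw [← closure_Ioc h.ne]
      refine closure_minimal (fun t ht => ?_)
        ((S.erase i).finite_toSet.isClosed_biUnion fun j _ => hC j)
      have htI : t ∈ Icc a b := ⟨hm.1.trans ht.1.le, ht.2⟩
      have := hcov htI
      simp only [mem_iUnion, exists_prop] at this ⊢
      obtain ⟨j, hj, htj⟩ := this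
      refine ⟨j, Finset.mem_erase.2 ⟨fun hji => ?_, hj⟩, htj⟩
      subst hji
      exact absurd (hmax ⟨htj, htI⟩) (not_le.2 ht.1)
    have h2 := ih (S.erase i) (by rw [Finset.card_erase_of_mem hi, hn]; rfl) m h.le hcl
    calc |f a - f b| ≤ |f a - f m| + |f m - f b| := abs_sub_le _ _ _
      _ ≤ L * (m - a) + L * (b - m) := add_le_add h1 h2
      _ = _ := by ring

/-- The same along a segment. This is how elementwise bounds become bounds across elements. -/
lemma abs_sub_le_of_closed_cover {ι : Type*} {L : ℝ} {f : 𝔼 → ℝ}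
    {T : ι → Set 𝔼} (S : Finset ι) (hT : ∀ i ∈ S, IsClosed (T i))
    (hf : ∀ i ∈ S, ∀ x ∈ T i, ∀ y ∈ T i, |f x - f y| ≤ L * ‖x - y‖) {x y : 𝔼}
    (hcov : segment ℝ x y ⊆ ⋃ i ∈ S, T i) : |f x - f y| ≤ L * ‖x - y‖ := by
  classical
  set γ : ℝ → 𝔼 := fun t => AffineMap.lineMap x y t with hγ
  have hγc : Continuous γ := AffineMap.lineMap_continuous
  have hd : ∀ t u, ‖γ t - γ u‖ = |t - u| * ‖x - y‖ := by
    intro t u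
    have : γ t - γ u = (t - u) • (y - x) := by
      simp only [hγ, AffineMap.lineMap_apply, vsub_eq_sub, vadd_eq_add, sub_smul]; abel
    rw [this, norm_smul, Real.norm_eq_abs, norm_sub_rev]
  have key := abs_sub_le_of_closed_cover_Icc (L := L * ‖x - y‖) (f := f ∘ γ) (b := 1)
    (C := fun i : S => γ ⁻¹' T i) (fun i => (hT i i.2).preimage hγc) (fun i t ht u hu => by
      have := hf i i.2 (γ t) ht (γ u) hu
      rw [hd] at this
      simp only [Function.comp_apply]
      linarith) Finset.univ 0 zero_le_one (fun t ht => by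
      have : γ t ∈ segment ℝ x y := by
        rw [segment_eq_image_lineMap]; exact mem_image_of_mem _ ht
      have := hcov this
      simp only [mem_iUnion, exists_prop] at this
      obtain ⟨i, hi, h⟩ := this
      simp only [Finset.mem_univ, iUnion_true, mem_iUnion, mem_preimage]
      exact ⟨⟨i, hi⟩, h⟩)
  simpa [hγ] using key

/-- The norm of the gradient of an affine function. -/
noncomputable def gradNorm (g : 𝔼 →ᵃ[ℝ] ℝ) : ℝ := ‖g.linear.toContinuousLinearMap‖

lemma gradNorm_nonneg (g : 𝔼 →ᵃ[ℝ] ℝ) : 0 ≤ gradNorm g := norm_nonneg _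

lemma affine_sub (g : 𝔼 →ᵃ[ℝ] ℝ) (x y : 𝔼) : g x - g y = g.linear (x - y) := by
  have := g.linearMap_vsub x y
  simpa using this.symm

lemma abs_affine_sub_le (g : 𝔼 →ᵃ[ℝ] ℝ) (x y : 𝔼) : |g x - g y| ≤ gradNorm g * ‖x - y‖ := by
  rw [affine_sub, ← Real.norm_eq_abs]
  exact g.linear.toContinuousLinearMap.le_opNorm (x - y)

lemma exists_gradient_direction (g : 𝔼 →ᵃ[ℝ] ℝ) :
    ∃ e : 𝔼, ‖e‖ ≤ 1 ∧ g.linear e = gradNorm g := by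
  set a := (InnerProductSpace.toDual ℝ 𝔼).symm g.linear.toContinuousLinearMap with ha
  have h1 : ∀ v, g.linear v = inner ℝ a v := fun v => by
    rw [ha, InnerProductSpace.toDual_symm_apply (𝕜 := ℝ)]; rfl
  have h2 : ‖a‖ = gradNorm g := by rw [ha, LinearIsometryEquiv.norm_map]; rfl
  refine ⟨‖a‖⁻¹ • a, ?_, ?_⟩
  · rw [norm_smul, norm_inv, norm_norm]
    exact inv_mul_le_one
  · rw [h1, real_inner_smul_right, real_inner_self_eq_norm_sq, ← h2]
    by_cases h : ‖a‖ = 0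
    · simp [h]
    · field_simp

/-- An affine function bounded by `q` on a ball of radius `r` has gradient at most `q / r`. -/
lemma mul_gradNorm_le {g : 𝔼 →ᵃ[ℝ] ℝ} {c : 𝔼} {r q : ℝ} (hr : 0 ≤ r)
    (h : ∀ x ∈ Metric.closedBall c r, |g x| ≤ q) : r * gradNorm g ≤ q := by
  obtain ⟨e, he, hge⟩ := exists_gradient_direction g
  have hn : ‖r • e‖ ≤ r := by
    rw [norm_smul, Real.norm_of_nonneg hr]; nlinarith [norm_nonneg e]
  have h1 := h (c + r • e) (by simpa [Metric.mem_closedBall, dist_eq_norm] using hn)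
  have h2 := h (c - r • e) (by simpa [Metric.mem_closedBall, dist_eq_norm] using hn)
  have h3 := affine_sub g (c + r • e) (c - r • e)
  rw [show c + r • e - (c - r • e) = (2 * r) • e by rw [mul_smul, two_smul]; abel, map_smul, hge,
    smul_eq_mul] at h3
  rw [abs_le] at h1 h2
  linarith

/-- The closed simplex with vertex set `F`. -/
abbrev hull (F : Finset 𝔼) : Set 𝔼 := convexHull ℝ (F : Set 𝔼)

lemma isCompact_hull (F : Finset 𝔼) : IsCompact (hull F) :=
  F.finite_toSet.isCompact_convexHull (𝕜 := ℝ)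

lemma isClosed_hull (F : Finset 𝔼) : IsClosed (hull F) := (isCompact_hull F).isClosed

lemma affine_le_of_mem_hull {F : Finset 𝔼} {g : 𝔼 →ᵃ[ℝ] ℝ} {q : ℝ} (h : ∀ p ∈ F, g p ≤ q)
    {x : 𝔼} (hx : x ∈ hull F) : g x ≤ q :=
  convexHull_min (t := g ⁻¹' Iic q) h ((convex_Iic q).affine_preimage g) hx

lemma le_affine_of_mem_hull {F : Finset 𝔼} {g : 𝔼 →ᵃ[ℝ] ℝ} {q : ℝ} (h : ∀ p ∈ F, q ≤ g p)
    {x : 𝔼} (hx : x ∈ hull F) : q ≤ g x :=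
  convexHull_min (t := g ⁻¹' Ici q) h ((convex_Ici q).affine_preimage g) hx

lemma abs_affine_le_of_mem_hull {F : Finset 𝔼} {g : 𝔼 →ᵃ[ℝ] ℝ} {q : ℝ}
    (h : ∀ p ∈ F, |g p| ≤ q) {x : 𝔼} (hx : x ∈ hull F) : |g x| ≤ q :=
  abs_le.2 ⟨le_affine_of_mem_hull (fun p hp => (abs_le.1 (h p hp)).1) hx,
    affine_le_of_mem_hull (fun p hp => (abs_le.1 (h p hp)).2) hx⟩

lemma norm_sub_le_diam {F : Finset 𝔼} {x y : 𝔼} (hx : x ∈ hull F) (hy : y ∈ hull F) :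
    ‖x - y‖ ≤ Metric.diam (hull F) := by
  rw [← dist_eq_norm]
  exact Metric.dist_le_diam_of_mem (isCompact_hull F).isBounded hx hy

open Classical in
/-- The affine function with prescribed values at the vertices of `F`; the zero function if there is
none. -/
noncomputable def affineInterp (F : Finset 𝔼) (a : 𝔼 → ℝ) : 𝔼 →ᵃ[ℝ] ℝ :=
  if h : ∃ g : 𝔼 →ᵃ[ℝ] ℝ, ∀ p ∈ F, g p = a p then h.choose else 0

lemma affineInterp_apply {F : Finset 𝔼} (hF : AffineIndependent ℝ ((↑) : F → 𝔼))
    (hc : F.card = d + 1) (a : 𝔼 → ℝ) {p : 𝔼} (hp : p ∈ F) : affineInterp F a p = a p := by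
  have hex : ∃ g : 𝔼 →ᵃ[ℝ] ℝ, ∀ p ∈ F, g p = a p := by
    have htop : affineSpan ℝ (range ((↑) : F → 𝔼)) = ⊤ := by
      rw [hF.affineSpan_eq_top_iff_card_eq_finrank_add_one]
      simp [hc]
    set b : AffineBasis F ℝ 𝔼 := ⟨_, hF, htop⟩ with hb
    refine ⟨∑ i : F, a i • b.coord i, fun q hq => ?_⟩
    have e : ∀ (t : Finset F), (∑ i ∈ t, a i • b.coord i : 𝔼 →ᵃ[ℝ] ℝ) q =
        ∑ i ∈ t, a i * b.coord i q := by
      intro t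
      induction t using Finset.induction_on with
      | empty => simp
      | insert i t hi ih =>
        rw [Finset.sum_insert hi, Finset.sum_insert hi, AffineMap.coe_add, Pi.add_apply, ih]
        simp
    rw [e]
    have hq' : ∀ i : F, b.coord i q = if i = ⟨q, hq⟩ then 1 else 0 := fun i =>
      b.coord_apply i ⟨q, hq⟩
    rw [Finset.sum_eq_single ⟨q, hq⟩]
    · rw [hq', if_pos rfl, mul_one]
    · intro i _ hi
      rw [hq', if_neg hi, mul_zero]
    · simp
  rw [affineInterp, dif_pos hex]
  exact hex.choose_spec p hp

/-- Affine functions that agree at the points of a set agree on its convex hull. -/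
lemma affine_eqOn_convexHull {s : Set 𝔼} {g k : 𝔼 →ᵃ[ℝ] ℝ} (h : ∀ p ∈ s, g p = k p) {x : 𝔼}
    (hx : x ∈ convexHull ℝ s) : g x = k x := by
  have h1 : convexHull ℝ s ⊆ (g - k) ⁻¹' {0} :=
    convexHull_min (fun p hp => by simp [h p hp]) ((convex_singleton 0).affine_preimage _)
  have := h1 hx
  simpa [sub_eq_zero] using this

lemma volume_convexHull_eq_zero {F : Finset 𝔼} (hF : AffineIndependent ℝ ((↑) : F → 𝔼))
    (hc : F.card ≠ d + 1) : volume (convexHull ℝ (F : Set 𝔼)) = 0 := by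
  refine measure_mono_null (convexHull_subset_affineSpan _)
    (Measure.addHaar_affineSubspace volume _ fun htop => hc ?_)
  have h := hF.affineSpan_eq_top_iff_card_eq_finrank_add_one
  simp only [Subtype.range_coe_subtype, Finset.setOfPred_mem, Fintype.card_coe,
    finrank_euclideanSpace, Fintype.card_fin] at h
  exact h.1 htop

/-- Two vertices of a simplex that contains a ball of radius `r` have distance at least `r`. -/
lemma le_norm_sub_of_closedBall_subset {F : Finset 𝔼} (hF : AffineIndependent ℝ ((↑) : F → 𝔼))
    (hc : F.card = d + 1) {c : 𝔼} {r : ℝ} (hr : 0 ≤ r) (hb : Metric.closedBall c r ⊆ hull F)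
    {p q : 𝔼} (hp : p ∈ F) (hq : q ∈ F) (hpq : p ≠ q) : r ≤ ‖p - q‖ := by
  classical
  set g := affineInterp F (fun x => if x = p then 1 else 0) with hg
  have hv : ∀ x ∈ F, g x = if x = p then 1 else 0 := fun x hx => affineInterp_apply hF hc _ hx
  have h1 : r * gradNorm g ≤ 1 := mul_gradNorm_le hr fun x hx =>
    abs_affine_le_of_mem_hull (fun y hy => by rw [hv y hy]; split_ifs <;> simp) (hb hx)
  have h2 := abs_affine_sub_le g p q
  rw [hv p hp, hv q hq, if_pos rfl, if_neg hpq.symm, sub_zero, abs_one] at h2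
  nlinarith [norm_nonneg (p - q), gradNorm_nonneg g]

/-! ### Shape-regular triangulations -/

/-- The elements of a triangulation, given by their vertex sets. -/
def cells (K : 𝕂) : Set (Finset 𝔼) := {F | F ∈ K.faces ∧ F.card = d + 1}

/-- The diameter of the simplex with vertex set `F`. -/
noncomputable abbrev cellSize (F : Finset 𝔼) : ℝ := Metric.diam (hull F)

lemma cellSize_pos (hd : 1 ≤ d) {F : Finset 𝔼} (hF : F.card = d + 1) : 0 < cellSize F := by
  obtain ⟨p, hp, q, hq, hpq⟩ := Finset.one_lt_card.1 (by lia : 1 < F.card)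
  exact (norm_pos_iff.2 (sub_ne_zero.2 hpq)).trans_le
    (norm_sub_le_diam (subset_convexHull ℝ _ hp) (subset_convexHull ℝ _ hq))

/-- Shape regularity in the form used below: every element contains a ball of radius `τ` times its
size, and in dimension one the sizes of neighbours have ratio at most `τ⁻¹`. -/
structure IsRegularMesh (τ : ℝ) (K : 𝕂) : Prop where
  pos : 0 < τ
  le_one : τ ≤ 1
  exists_closedBall : ∀ F ∈ cells K, ∃ c, Metric.closedBall c (τ * cellSize F) ⊆ hull F
  dim_one : d = 1 → ∀ F ∈ cells K, ∀ G ∈ cells K, (hull F ∩ hull G).Nonempty →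
    cellSize F ≤ τ⁻¹ * cellSize G

lemma hull_mem_elements {K : 𝕂} {F : Finset 𝔼} (hF : F ∈ cells K) : hull F ∈ elements K :=
  ⟨F, hF.1, hF.2, rfl⟩

lemma isRegularMesh_of_isShapeRegular (hd : 1 ≤ d) {σ : ℝ} {K : 𝕂} (hK : IsShapeRegular σ K) :
    IsRegularMesh (1 / (4 * max σ 1)) K where
  pos := by positivity
  le_one := by
    rw [div_le_one (by positivity)]
    linarith [le_max_right σ 1]
  exists_closedBall F hF := by
    have hh := cellSize_pos hd hF.2
    have h1 := hK.1 _ (hull_mem_elements hF)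
    set A : Set ℝ := {ρ | ∃ c r, 0 ≤ r ∧ Metric.closedBall c r ⊆ hull F ∧ ρ = 2 * r} with hA
    have hρ : inDiam (hull F) = sSup A := rfl
    have h0 : 0 ≤ inDiam (hull F) := by
      refine Real.sSup_nonneg ?_
      rintro _ ⟨c, r, hr, _, rfl⟩
      positivity
    have hpos : 0 < inDiam (hull F) := by
      refine h0.lt_of_ne fun h => ?_
      rw [← h, mul_zero] at h1
      exact absurd hh (not_lt.2 h1)
    have h2 : cellSize F ≤ max σ 1 * inDiam (hull F) :=
      h1.trans (mul_le_mul_of_nonneg_right (le_max_left _ _) h0)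
    have hne : A.Nonempty := by
      rw [nonempty_iff_ne_empty]
      intro hemp
      rw [hρ, hemp, Real.sSup_empty] at hpos
      exact lt_irrefl _ hpos
    -- the supremum in `inDiam` need not be attained a priori: half of it is, hence the factor `1/4`
    obtain ⟨_, ⟨c, r, hr, hsub, rfl⟩, hlt⟩ := exists_lt_of_lt_csSup hne
      (by rw [← hρ]; linarith : inDiam (hull F) / 2 < sSup A)
    refine ⟨c, (Metric.closedBall_subset_closedBall ?_).trans hsub⟩
    have hm : 0 < max σ 1 := by positivity
    rw [one_div, inv_mul_le_iff₀ (by positivity)]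
    nlinarith
  dim_one h F hF G hG hne := by
    have h1 := hK.2 h _ (hull_mem_elements hF) _ (hull_mem_elements hG) hne
    rw [one_div, inv_inv]
    refine h1.trans (mul_le_mul_of_nonneg_right ?_ Metric.diam_nonneg)
    linarith [le_max_left σ 1, le_max_right σ 1]

lemma cells_finite {K : 𝕂} (hK : K.faces.Finite) : (cells K).Finite :=
  hK.subset fun _ h => h.1

lemma biUnion_hull_eq {Ω : Set 𝔼} {K : 𝕂} (hK : IsTriangulation Ω K) :
    ⋃ F ∈ cells K, hull F = closure Ω := by
  rw [← hK.2]
  ext x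
  simp only [mem_iUnion, exists_prop, mem_sUnion]
  constructor
  · rintro ⟨F, hF, hx⟩
    exact ⟨_, hull_mem_elements hF, hx⟩
  · rintro ⟨_, ⟨F, h1, h2, rfl⟩, hx⟩
    exact ⟨F, ⟨h1, h2⟩, hx⟩

lemma exists_cell_of_mem {Ω : Set 𝔼} {K : 𝕂} (hK : IsTriangulation Ω K) {x : 𝔼}
    (hx : x ∈ closure Ω) : ∃ F ∈ cells K, x ∈ hull F := by
  rw [← biUnion_hull_eq hK] at hx
  simpa using hx

lemma mem_of_vertex_mem_hull {K : 𝕂} {F G : Finset 𝔼} (hF : F ∈ cells K) (hG : G ∈ cells K)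
    {p : 𝔼} (hp : p ∈ F) (hpG : p ∈ hull G) : p ∈ G := by
  have h1 : ({p} : Finset 𝔼) ∈ K.faces :=
    K.down_closed hF.1 (Finset.singleton_subset_iff.2 hp) (Finset.singleton_nonempty p)
  have h2 := K.inter_subset_convexHull h1 hG.1
    (mem_inter (subset_convexHull ℝ _ (Finset.mem_coe.2 (Finset.mem_singleton_self p))) hpG)
  have h3 := convexHull_nonempty_iff.1 ⟨p, h2⟩
  obtain ⟨q, hq1, hq2⟩ := h3
  rw [Finset.coe_singleton, mem_singleton_iff] at hq1
  rwa [hq1] at hq2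

lemma aedisjoint_hull {K : 𝕂} {F G : Finset 𝔼} (hF : F ∈ cells K) (hG : G ∈ cells K)
    (hne : F ≠ G) : AEDisjoint volume (hull F) (hull G) := by
  classical
  refine measure_mono_null (K.inter_subset_convexHull hF.1 hG.1) ?_
  rw [← Finset.coe_inter]
  have hlt : (F ∩ G).card < F.card := by
    refine Finset.card_lt_card (Finset.inter_subset_left.ssubset_of_ne fun h => hne ?_)
    exact Finset.eq_of_subset_of_card_le (Finset.inter_eq_left.1 h) (by rw [hF.2, hG.2])
  refine volume_convexHull_eq_zero ?_ (by rw [← hF.2]; exact hlt.ne)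
  exact (K.indep hF.1).mono (t := (F : Set 𝔼)) (by simp)

/-- The number of elements around a vertex is bounded: shrunk towards the vertex to a common
size, they occupy a fixed portion of a common ball. -/
lemma card_star_mul_le (hd : 1 ≤ d) {τ : ℝ} {K : 𝕂} (hK : IsRegularMesh τ K) {p : 𝔼}
    {S : Finset (Finset 𝔼)} (hS : ∀ F ∈ S, F ∈ cells K) (hp : ∀ F ∈ S, p ∈ F) :
    (S.card : ℝ) * τ ^ d ≤ 1 := by
  have : Nonempty (Fin d) := ⟨⟨0, hd⟩⟩
  rcases S.eq_empty_or_nonempty with rfl | hne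
  · simp
  obtain ⟨F₀, hF₀, hmin⟩ := S.exists_min_image cellSize hne
  set δ := cellSize F₀ with hδ
  have hδ0 : 0 < δ := cellSize_pos hd (hS F₀ hF₀).2
  have hball : ∀ F ∈ S, ∃ c, Metric.ball c (τ * δ) ⊆ hull F ∩ Metric.closedBall p δ := by
    intro F hF
    have hh : 0 < cellSize F := cellSize_pos hd (hS F hF).2
    obtain ⟨c, hc⟩ := hK.exists_closedBall F (hS F hF)
    have hpF : p ∈ hull F := subset_convexHull ℝ _ (hp F hF)
    set t := δ / cellSize F with ht
    have ht0 : 0 < t := by positivity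
    have ht1 : t ≤ 1 := (div_le_one hh).2 (hmin F hF)
    have hth : t * cellSize F = δ := by rw [ht]; field_simp
    refine ⟨p + t • (c - p), fun x hx => ?_⟩
    set y := p + t⁻¹ • (x - p) with hy
    have hxy : x = p + t • (y - p) := by
      rw [hy, add_sub_cancel_left, smul_smul, mul_inv_cancel₀ ht0.ne', one_smul]; abel
    have hyc : y ∈ hull F := by
      refine hc ?_
      rw [Metric.mem_ball, dist_eq_norm, hxy,
        show p + t • (y - p) - (p + t • (c - p)) = t • (y - c) by simp only [smul_sub]; abel,
        norm_smul, Real.norm_of_nonneg ht0.le, ← hth] at hx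
      rw [Metric.mem_closedBall, dist_eq_norm]
      have : t * ‖y - c‖ < t * (τ * cellSize F) := by linarith
      exact (lt_of_mul_lt_mul_left this ht0.le).le
    refine ⟨?_, ?_⟩
    · have := (convex_convexHull ℝ (F : Set 𝔼)).add_smul_sub_mem hpF hyc ⟨ht0.le, ht1⟩
      rw [hxy]; exact this
    · rw [Metric.mem_closedBall, dist_eq_norm, hxy, add_sub_cancel_left, norm_smul,
        Real.norm_of_nonneg ht0.le, ← hth]
      exact mul_le_mul_of_nonneg_left (norm_sub_le_diam hyc hpF) ht0.le
  choose! c hc using hball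
  have hτδ : 0 ≤ τ * δ := mul_nonneg hK.pos.le hδ0.le
  have hdisj : Set.Pairwise (↑S) (Function.onFun (AEDisjoint volume)
      fun F => Metric.ball (c F) (τ * δ)) := by
    intro F hF G hG hFG
    exact (aedisjoint_hull (hS F hF) (hS G hG) hFG).mono
      (fun x hx => (hc F hF hx).1) (fun x hx => (hc G hG hx).1)
  have h1 : ∑ F ∈ S, volume (Metric.ball (c F) (τ * δ)) ≤ volume (Metric.closedBall p δ) := by
    rw [← measure_biUnion_finset₀ hdisj fun F _ =>
      Metric.isOpen_ball.measurableSet.nullMeasurableSet]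
    exact measure_mono (iUnion₂_subset fun F hF x hx => (hc F hF hx).2)
  simp_rw [Measure.addHaar_ball volume _ hτδ] at h1
  rw [Measure.addHaar_closedBall volume _ hδ0.le, Finset.sum_const, nsmul_eq_mul, ← mul_assoc] at h1
  have hb0 : volume (Metric.ball (0 : 𝔼) 1) ≠ 0 := (Metric.measure_ball_pos _ _ one_pos).ne'
  have hbt : volume (Metric.ball (0 : 𝔼) 1) ≠ ⊤ := measure_ball_lt_top.ne
  rw [ENNReal.mul_le_mul_iff_left hb0 hbt, ← ENNReal.ofReal_natCast, ← ENNReal.ofReal_mul (by simp),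
    ENNReal.ofReal_le_ofReal_iff (by positivity)] at h1
  simp only [finrank_euclideanSpace, Fintype.card_fin] at h1
  rw [mul_pow, ← mul_assoc] at h1
  exact le_of_mul_le_mul_right (by linarith) (pow_pos hδ0 d)

/-- If every proper nonempty subset of `S` can be enlarged by an element that is at most `κ` times
as big as one of its elements, the sizes in `S` have ratio at most `κ ^ S.card`. -/
lemma le_pow_card_mul_of_chain {α : Type*} {S : Finset α} {h : α → ℝ} {κ : ℝ} (hκ : 1 ≤ κ)
    (h0 : ∀ a ∈ S, 0 ≤ h a)
    (hstep : ∀ A ⊆ S, A.Nonempty → A ≠ S → ∃ a ∈ A, ∃ b ∈ S, b ∉ A ∧ h b ≤ κ * h a)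
    {a₀ : α} (ha₀ : a₀ ∈ S) : ∀ a ∈ S, h a ≤ κ ^ S.card * h a₀ := by
  classical
  have hκ0 : 0 < κ := by linarith
  set A : ℕ → Finset α := fun n => S.filter fun a => h a ≤ κ ^ n * h a₀ with hA
  have hmem : ∀ n, a₀ ∈ A n := fun n => by
    simp only [hA, Finset.mem_filter]
    exact ⟨ha₀, le_mul_of_one_le_left (h0 _ ha₀) (one_le_pow₀ hκ)⟩
  have hmono : ∀ n, A n ⊆ A (n + 1) := fun n a ha => by
    simp only [hA, Finset.mem_filter] at ha ⊢
    refine ⟨ha.1, ha.2.trans (mul_le_mul_of_nonneg_right ?_ (h0 _ ha₀))⟩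
    exact pow_le_pow_right₀ hκ n.le_succ
  have hcard : ∀ n, A n = S ∨ n + 1 ≤ (A n).card := by
    intro n
    induction n with
    | zero => exact Or.inr (Finset.card_pos.2 ⟨a₀, hmem 0⟩)
    | succ n ih =>
      by_cases hn : A n = S
      · left
        exact Finset.Subset.antisymm (Finset.filter_subset _ _) (hn ▸ hmono n)
      right
      have ih' := ih.resolve_left hn
      obtain ⟨a, ha, b, hb, hbA, hle⟩ := hstep (A n) (Finset.filter_subset _ _) ⟨a₀, hmem n⟩ hn
      have hb' : b ∈ A (n + 1) := by
        simp only [hA, Finset.mem_filter] at ha ⊢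
        refine ⟨hb, hle.trans ?_⟩
        rw [pow_succ', mul_assoc]
        exact mul_le_mul_of_nonneg_left ha.2 hκ0.le
      have : (A n).card < (A (n + 1)).card :=
        Finset.card_lt_card ⟨hmono n, fun hsub => hbA (hsub hb')⟩
      lia
  intro a ha
  have hS : A S.card = S := by
    refine (hcard S.card).resolve_right fun h1 => ?_
    have := Finset.card_le_card (Finset.filter_subset (fun a => h a ≤ κ ^ S.card * h a₀) S)
    simp only [hA] at h1
    lia
  rw [← hS] at ha
  simp only [hA, Finset.mem_filter] at ha
  exact ha.2

/-- Around an interior vertex in dimension at least two, any splitting of the elements into two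
classes is bridged by two elements with a common edge: otherwise the two classes would separate a
small sphere about the vertex. -/
lemma exists_bridge (hd : 2 ≤ d) {τ : ℝ} {Ω : Set 𝔼} (hΩ : IsOpen Ω) {K : 𝕂}
    (hT : IsTriangulation Ω K) (hK : IsRegularMesh τ K) {p : 𝔼} (hpΩ : p ∈ Ω)
    {S : Finset (Finset 𝔼)} (hS : ∀ F, F ∈ S ↔ F ∈ cells K ∧ p ∈ F) {A : Finset (Finset 𝔼)}
    (hAS : A ⊆ S) (hA : A.Nonempty) (hne : A ≠ S) :
    ∃ F ∈ A, ∃ G ∈ S, G ∉ A ∧ cellSize G ≤ τ⁻¹ * cellSize F := by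
  classical
  have hd1 : 1 ≤ d := by lia
  by_contra hcon
  push Not at hcon
  -- elements of different classes share no vertex besides `p`
  have hmeet : ∀ F ∈ A, ∀ G ∈ S, G ∉ A → hull F ∩ hull G ⊆ {p} := by
    intro F hF G hG hGA
    have hFc := (hS F).1 (hAS hF)
    have hGc := (hS G).1 hG
    refine (K.inter_subset_convexHull hFc.1.1 hGc.1.1).trans
      (convexHull_min ?_ (convex_singleton p))
    rintro q ⟨hqF, hqG⟩
    by_contra hqp
    have hqp' : p ≠ q := fun h => hqp h.symm
    -- a common edge `pq` has length at most `cellSize F` and at least `τ * cellSize G`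
    obtain ⟨c, hc⟩ := hK.exists_closedBall G hGc.1
    have h1 := le_norm_sub_of_closedBall_subset (K.indep hGc.1.1) hGc.1.2
      (mul_nonneg hK.pos.le Metric.diam_nonneg) hc hGc.2 hqG hqp'
    have h2 : ‖p - q‖ ≤ cellSize F :=
      norm_sub_le_diam (subset_convexHull ℝ _ hFc.2) (subset_convexHull ℝ _ hqF)
    have h3 := hcon F hF G hG hGA
    rw [inv_mul_lt_iff₀ hK.pos] at h3
    linarith
  -- a ball about `p` is covered by the elements with vertex `p`
  set U : Set 𝔼 := Ω ∩ (⋃ F ∈ cells K \ ↑S, hull F)ᶜ with hU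
  have hUo : IsOpen U := by
    refine hΩ.inter (IsClosed.isOpen_compl (self := ?_))
    exact ((cells_finite hT.1).subset sdiff_subset).isClosed_biUnion fun F _ => isClosed_hull F
  have hpU : p ∈ U := by
    refine ⟨hpΩ, ?_⟩
    simp only [mem_compl_iff, mem_iUnion, exists_prop, not_exists, not_and]
    intro F hF hpF
    obtain ⟨F₁, hF₁⟩ := hA
    have h1 := (hS F₁).1 (hAS hF₁)
    exact hF.2 ((hS F).2 ⟨hF.1, mem_of_vertex_mem_hull h1.1 hF.1 h1.2 hpF⟩)
  obtain ⟨r, hr, hrU⟩ := Metric.isOpen_iff.1 hUo p hpU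
  obtain ⟨F₀, hF₀, hmin⟩ := S.exists_min_image cellSize (hA.mono hAS)
  have hF₀pos : 0 < cellSize F₀ := cellSize_pos hd1 ((hS F₀).1 hF₀).1.2
  set δ := min (r / 2) (τ * cellSize F₀) with hδ
  have hδ0 : 0 < δ := lt_min (by positivity) (mul_pos hK.pos hF₀pos)
  have hsph : Metric.sphere p δ ⊆ ⋃ F ∈ S, hull F := by
    intro x hx
    have hxU : x ∈ U := by
      refine hrU ?_
      rw [Metric.mem_sphere] at hx
      rw [Metric.mem_ball, hx]
      exact (min_le_left _ _).trans_lt (by linarith)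
    obtain ⟨F, hF, hxF⟩ := exists_cell_of_mem hT (subset_closure hxU.1)
    simp only [mem_iUnion, exists_prop]
    refine ⟨F, ?_, hxF⟩
    by_contra hFS
    refine hxU.2 ?_
    simp only [mem_iUnion, exists_prop]
    exact ⟨F, ⟨hF, hFS⟩, hxF⟩
  -- the sphere is so small that every element of the star meets it along an edge from `p`
  have hhit : ∀ F ∈ S, (Metric.sphere p δ ∩ hull F).Nonempty := by
    intro F hF
    have hFc := (hS F).1 hF
    obtain ⟨q, hq, hqp⟩ := Finset.exists_mem_ne (by rw [hFc.1.2]; lia : 1 < F.card) p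
    obtain ⟨c, hc⟩ := hK.exists_closedBall F hFc.1
    have h1 := le_norm_sub_of_closedBall_subset (K.indep hFc.1.1) hFc.1.2
      (mul_nonneg hK.pos.le Metric.diam_nonneg) hc hq hFc.2 hqp
    have hq0 : 0 < ‖q - p‖ := norm_pos_iff.2 (sub_ne_zero.2 hqp)
    have h2 : δ ≤ ‖q - p‖ := (min_le_right _ _).trans
      ((mul_le_mul_of_nonneg_left (hmin F hF) hK.pos.le).trans h1)
    refine ⟨p + (δ / ‖q - p‖) • (q - p), ?_, ?_⟩
    · rw [Metric.mem_sphere, dist_eq_norm, add_sub_cancel_left, norm_smul, Real.norm_of_nonneg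
        (by positivity), div_mul_cancel₀ _ hq0.ne']
    · exact (convex_convexHull ℝ (F : Set 𝔼)).add_smul_sub_mem (subset_convexHull ℝ _ hFc.2)
        (subset_convexHull ℝ _ hq) ⟨by positivity, (div_le_one hq0).2 h2⟩
  have hrank : 1 < Module.rank ℝ 𝔼 := by
    rw [← Module.finrank_eq_rank, finrank_euclideanSpace, Fintype.card_fin]
    exact_mod_cast hd
  have hconn := isPreconnected_closed_iff.1 (isPreconnected_sphere hrank p δ)
    (⋃ F ∈ A, hull F) (⋃ F ∈ S \ A, hull F)
    (A.finite_toSet.isClosed_biUnion fun F _ => isClosed_hull F)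
    ((S \ A).finite_toSet.isClosed_biUnion fun F _ => isClosed_hull F)
    (fun x hx => by
      have := hsph hx
      simp only [mem_iUnion, exists_prop, mem_union, Finset.mem_sdiff] at this ⊢
      obtain ⟨F, hF, hxF⟩ := this
      by_cases hFA : F ∈ A
      · exact Or.inl ⟨F, hFA, hxF⟩
      · exact Or.inr ⟨F, ⟨hF, hFA⟩, hxF⟩)
    (by
      obtain ⟨F, hF⟩ := hA
      obtain ⟨x, hx, hxF⟩ := hhit F (hAS hF)
      exact ⟨x, hx, mem_biUnion hF hxF⟩)
    (by
      have : ∃ G ∈ S, G ∉ A := by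
        by_contra h
        push Not at h
        exact hne (Finset.Subset.antisymm hAS h)
      obtain ⟨G, hG, hGA⟩ := this
      obtain ⟨x, hx, hxG⟩ := hhit G hG
      exact ⟨x, hx, mem_biUnion (Finset.mem_sdiff.2 ⟨hG, hGA⟩) hxG⟩)
  obtain ⟨x, hx, hxA, hxB⟩ := hconn
  simp only [mem_iUnion, exists_prop, Finset.mem_sdiff] at hxA hxB
  obtain ⟨F, hF, hxF⟩ := hxA
  obtain ⟨G, ⟨hG, hGA⟩, hxG⟩ := hxB
  have hxp : x = p := hmeet F hF G hG hGA ⟨hxF, hxG⟩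
  rw [hxp, Metric.mem_sphere, dist_self] at hx
  exact hδ0.ne hx

/-- A bound for the number of elements around a vertex. -/
noncomputable def starBound (d : ℕ) (τ : ℝ) : ℕ := ⌈(τ ^ d)⁻¹⌉₊ + 1

/-- A bound for the ratio of the sizes of two elements with a common interior vertex. -/
noncomputable def sizeRatio (d : ℕ) (τ : ℝ) : ℝ := τ⁻¹ ^ starBound d τ

lemma card_star_le (hd : 1 ≤ d) {τ : ℝ} {K : 𝕂} (hK : IsRegularMesh τ K) {p : 𝔼}
    {S : Finset (Finset 𝔼)} (hS : ∀ F ∈ S, F ∈ cells K) (hp : ∀ F ∈ S, p ∈ F) :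
    S.card ≤ starBound d τ := by
  have h := card_star_mul_le hd hK hS hp
  have hτ : 0 < τ ^ d := pow_pos hK.pos d
  have h1 : (S.card : ℝ) ≤ (τ ^ d)⁻¹ := by
    rw [← one_div, le_div_iff₀ hτ]; exact h
  have h2 : S.card ≤ ⌈(τ ^ d)⁻¹⌉₊ := by exact_mod_cast h1.trans (Nat.le_ceil _)
  exact h2.trans (Nat.le_succ _)

lemma one_le_sizeRatio {τ : ℝ} {K : 𝕂} (hK : IsRegularMesh τ K) : 1 ≤ sizeRatio d τ :=
  one_le_pow₀ ((one_le_inv₀ hK.pos).2 hK.le_one)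

/-- Elements with a common interior vertex have comparable sizes. -/
lemma cellSize_le_of_common_vertex (hd : 1 ≤ d) {τ : ℝ} {Ω : Set 𝔼} (hΩ : IsOpen Ω) {K : 𝕂}
    (hT : IsTriangulation Ω K) (hK : IsRegularMesh τ K) {p : 𝔼} (hpΩ : p ∈ Ω) {F G : Finset 𝔼}
    (hF : F ∈ cells K) (hpF : p ∈ F) (hG : G ∈ cells K) (hpG : p ∈ G) :
    cellSize F ≤ sizeRatio d τ * cellSize G := by
  classical
  have hκ : 1 ≤ τ⁻¹ := (one_le_inv₀ hK.pos).2 hK.le_one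
  rcases hd.eq_or_lt with h1 | h2
  · refine (hK.dim_one h1.symm F hF G hG ⟨p, subset_convexHull ℝ _ hpF,
      subset_convexHull ℝ _ hpG⟩).trans (mul_le_mul_of_nonneg_right ?_ Metric.diam_nonneg)
    exact le_self_pow₀ hκ (Nat.succ_ne_zero _)
  set S : Finset (Finset 𝔼) := (cells_finite hT.1).toFinset.filter fun F => p ∈ F with hSdef
  have hS : ∀ F, F ∈ S ↔ F ∈ cells K ∧ p ∈ F := fun F => by simp [hSdef]
  have h := le_pow_card_mul_of_chain (S := S) (h := cellSize) hκ (fun _ _ => Metric.diam_nonneg)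
    (fun A hAS hA hne => exists_bridge h2 hΩ hT hK hpΩ hS hAS hA hne) ((hS G).2 ⟨hG, hpG⟩) F
    ((hS F).2 ⟨hF, hpF⟩)
  refine h.trans (mul_le_mul_of_nonneg_right ?_ Metric.diam_nonneg)
  exact pow_le_pow_right₀ hκ (card_star_le hd hK (fun F hF => ((hS F).1 hF).1)
    fun F hF => ((hS F).1 hF).2)

/-! ### Nodal interpolation -/

open Classical in
/-- The continuous piecewise affine function with vertex values `a`, extended by zero outside the
triangulated set. -/
noncomputable def nodal (K : 𝕂) (a : 𝔼 → ℝ) (x : 𝔼) : ℝ :=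
  if h : ∃ F ∈ cells K, x ∈ hull F then affineInterp h.choose a x else 0

lemma nodal_eq {K : 𝕂} (a : 𝔼 → ℝ) {F : Finset 𝔼} (hF : F ∈ cells K) {x : 𝔼} (hx : x ∈ hull F) :
    nodal K a x = affineInterp F a x := by
  have h : ∃ F ∈ cells K, x ∈ hull F := ⟨F, hF, hx⟩
  rw [nodal, dif_pos h]
  obtain ⟨h1, h2⟩ := h.choose_spec
  refine affine_eqOn_convexHull (fun p hp => ?_) (K.inter_subset_convexHull h1.1 hF.1 ⟨h2, hx⟩)
  rw [affineInterp_apply (K.indep h1.1) h1.2 a hp.1, affineInterp_apply (K.indep hF.1) hF.2 a hp.2]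

lemma nodal_eq_zero {K : 𝕂} (a : 𝔼 → ℝ) {x : 𝔼} (hx : ∀ F ∈ cells K, x ∉ hull F) :
    nodal K a x = 0 := by
  rw [nodal, dif_neg]
  rintro ⟨F, hF, h⟩
  exact hx F hF h

lemma continuousOn_nodal {K : 𝕂} (hK : (cells K).Finite) (a : 𝔼 → ℝ) :
    ContinuousOn (nodal K a) (⋃ F ∈ cells K, hull F) := by
  have : Finite (cells K) := hK
  rw [biUnion_eq_iUnion]
  refine (locallyFinite_of_finite _).continuousOn_iUnion (fun F => isClosed_hull _) fun F => ?_
  have hc : Continuous (affineInterp F.1 a) := AffineMap.continuous_of_finiteDimensional _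
  exact hc.continuousOn.congr fun x hx => nodal_eq a F.2 hx

/-- If a point `y` is closer to an element than a fixed multiple of its size, the segment from the
element to `y` stays in the star of one vertex `p` of the element: `p` is chosen such that its
nodal basis function is not small at `x`. -/
lemma exists_star_of_near (hd : 1 ≤ d) {τ : ℝ} {Ω : Set 𝔼} (hΩ : IsOpen Ω) {K : 𝕂}
    (hT : IsTriangulation Ω K) (hK : IsRegularMesh τ K) {F : Finset 𝔼} (hF : F ∈ cells K)
    (hFΩ : ∀ p ∈ F, p ∈ Ω) {x y : 𝔼} (hx : x ∈ hull F) (hseg : segment ℝ x y ⊆ closure Ω)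
    (hxy : ‖x - y‖ < τ / (sizeRatio d τ * (d + 1)) * cellSize F) :
    ∃ p ∈ F, ∀ z ∈ segment ℝ x y, ∃ G ∈ cells K, p ∈ G ∧ z ∈ hull G := by
  classical
  set φ : 𝔼 → 𝔼 → ℝ := fun p => nodal K fun q => if q = p then 1 else 0 with hφ
  have hΛ : 1 ≤ sizeRatio d τ := one_le_sizeRatio hK
  have hh : 0 < cellSize F := cellSize_pos hd hF.2
  have hτ := hK.pos
  have hv : ∀ p, ∀ G ∈ cells K, ∀ q ∈ G,
      affineInterp G (fun q => if q = p then 1 else 0) q = if q = p then 1 else 0 :=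
    fun p G hG q hq => affineInterp_apply (K.indep hG.1) hG.2 _ hq
  have hsum : ∑ p ∈ F, φ p x = 1 := by
    have e1 : ∑ p ∈ F, φ p x =
        ∑ p ∈ F, affineInterp F (fun q => if q = p then (1 : ℝ) else 0) x :=
      Finset.sum_congr rfl fun p _ => nodal_eq _ hF hx
    rw [e1]
    set g : 𝔼 →ᵃ[ℝ] ℝ := ∑ p ∈ F, affineInterp F (fun q => if q = p then (1 : ℝ) else 0) with hg
    have e : ∀ z, g z = ∑ p ∈ F, affineInterp F (fun q => if q = p then (1 : ℝ) else 0) z := by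
      intro z
      have : ∀ t : Finset 𝔼, (∑ p ∈ t, affineInterp F (fun q => if q = p then (1 : ℝ) else 0) :
          𝔼 →ᵃ[ℝ] ℝ) z = ∑ p ∈ t, affineInterp F (fun q => if q = p then (1 : ℝ) else 0) z := by
        intro t
        induction t using Finset.induction_on with
        | empty => simp
        | insert i t hi ih =>
          rw [Finset.sum_insert hi, Finset.sum_insert hi, AffineMap.coe_add, Pi.add_apply, ih]
      exact this F
    rw [← e]
    have h1 : g x = AffineMap.const ℝ 𝔼 (1 : ℝ) x := by
      refine affine_eqOn_convexHull (s := (F : Set 𝔼)) (fun q hq => ?_) hx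
      rw [e, Finset.sum_congr rfl fun p _ => hv p F hF q hq]
      simpa using hq
    simpa using h1
  have hex : ∃ p ∈ F, 1 / ((d : ℝ) + 1) ≤ φ p x := by
    by_contra hcon
    push Not at hcon
    have hne : F.Nonempty := Finset.card_pos.1 (by rw [hF.2]; lia)
    have := Finset.sum_lt_sum_of_nonempty hne hcon
    rw [hsum, Finset.sum_const, hF.2, nsmul_eq_mul] at this
    push_cast at this
    rw [mul_one_div, div_self (by positivity)] at this
    exact lt_irrefl _ this
  obtain ⟨p, hp, hpx⟩ := hex
  refine ⟨p, hp, fun z hz => ?_⟩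
  have hsegz : segment ℝ x z ⊆ ⋃ G ∈ (cells_finite hT.1).toFinset, hull G := by
    refine ((convex_segment x y).segment_subset (left_mem_segment ℝ x y) hz).trans
      (hseg.trans ((biUnion_hull_eq hT).ge.trans ?_))
    simp
  have hlip : ∀ G ∈ (cells_finite hT.1).toFinset, ∀ u ∈ hull G, ∀ v ∈ hull G,
      |φ p u - φ p v| ≤ sizeRatio d τ / (τ * cellSize F) * ‖u - v‖ := by
    intro G hG u hu v hv'
    have hGc : G ∈ cells K := by simpa using hG
    simp only [hφ]
    rw [nodal_eq _ hGc hu, nodal_eq _ hGc hv']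
    refine (abs_affine_sub_le _ u v).trans (mul_le_mul_of_nonneg_right ?_ (norm_nonneg _))
    set g := affineInterp G (fun q => if q = p then (1 : ℝ) else 0) with hg
    by_cases hpG : p ∈ G
    · obtain ⟨c, hc⟩ := hK.exists_closedBall G hGc
      have h1 : τ * cellSize G * gradNorm g ≤ 1 :=
        mul_gradNorm_le (mul_nonneg hτ.le Metric.diam_nonneg) fun w hw =>
          abs_affine_le_of_mem_hull (fun q hq => by
            rw [hg, hv p G hGc q hq]; split_ifs <;> simp) (hc hw)
      have h2 := cellSize_le_of_common_vertex hd hΩ hT hK (hFΩ p hp) hF hp hGc hpG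
      rw [le_div_iff₀ (by positivity)]
      have h3 : gradNorm g * (τ * cellSize F) ≤
          gradNorm g * (τ * (sizeRatio d τ * cellSize G)) := by
        have := gradNorm_nonneg g
        gcongr
      nlinarith
    · have h0 : τ * cellSize G * gradNorm g ≤ 0 := by
        obtain ⟨c, hc⟩ := hK.exists_closedBall G hGc
        refine mul_gradNorm_le (c := c) (mul_nonneg hτ.le Metric.diam_nonneg) fun w hw =>
          abs_affine_le_of_mem_hull (fun q hq => ?_) (hc hw)
        rw [hg, hv p G hGc q hq, if_neg (fun h : q = p => hpG (h ▸ hq)), abs_zero]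
      have h1 : 0 < τ * cellSize G := mul_pos hτ (cellSize_pos hd hGc.2)
      have h2 : gradNorm g ≤ 0 := by
        by_contra h
        push Not at h
        exact absurd h0 (not_le.2 (mul_pos h1 h))
      exact h2.trans (by positivity)
  have hle := abs_sub_le_of_closed_cover _ (fun G _ => isClosed_hull G) hlip hsegz
  have hzx : ‖x - z‖ ≤ ‖x - y‖ := by
    obtain ⟨a, b, ha, hb, hab, rfl⟩ := hz
    have : x - (a • x + b • y) = b • (x - y) := by
      have : a = 1 - b := by linarith
      rw [this, sub_smul, one_smul, smul_sub]; abel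
    rw [this, norm_smul, Real.norm_of_nonneg hb]
    exact mul_le_of_le_one_left (norm_nonneg _) (by linarith)
  have hpos : 0 < φ p z := by
    have h1 : sizeRatio d τ / (τ * cellSize F) * ‖x - z‖ < 1 / ((d : ℝ) + 1) := by
      have : ‖x - z‖ < τ / (sizeRatio d τ * (d + 1)) * cellSize F := hzx.trans_lt hxy
      calc sizeRatio d τ / (τ * cellSize F) * ‖x - z‖
          < sizeRatio d τ / (τ * cellSize F) *
            (τ / (sizeRatio d τ * (d + 1)) * cellSize F) := by gcongr
        _ = _ := by field_simp
    have := (abs_le.1 hle).2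
    linarith
  obtain ⟨G, hG, hzG⟩ := exists_cell_of_mem hT (hseg hz)
  refine ⟨G, hG, ?_, hzG⟩
  by_contra hpG
  have h0 : φ p z ≤ 0 := by
    simp only [hφ]
    rw [nodal_eq _ hG hzG]
    exact affine_le_of_mem_hull (fun q hq => by
      rw [hv p G hG q hq, if_neg (fun h : q = p => hpG (h ▸ hq))]) hzG
  linarith

/-- Elementwise Lipschitz bounds in the star of each vertex carry over to points at a distance
below the local mesh size. -/
lemma abs_sub_le_of_near (hd : 1 ≤ d) {τ : ℝ} {Ω : Set 𝔼} (hΩ : IsOpen Ω) {K : 𝕂}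
    (hT : IsTriangulation Ω K) (hK : IsRegularMesh τ K) {F : Finset 𝔼} (hF : F ∈ cells K)
    (hFΩ : ∀ p ∈ F, p ∈ Ω) {x y : 𝔼} (hx : x ∈ hull F) (hseg : segment ℝ x y ⊆ closure Ω)
    (hxy : ‖x - y‖ < τ / (sizeRatio d τ * (d + 1)) * cellSize F) {f : 𝔼 → ℝ} {L : ℝ}
    (hf : ∀ p ∈ F, ∀ G ∈ cells K, p ∈ G → ∀ u ∈ hull G, ∀ v ∈ hull G,
      |f u - f v| ≤ L * ‖u - v‖) : |f x - f y| ≤ L * ‖x - y‖ := by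
  obtain ⟨p, hp, h⟩ := exists_star_of_near hd hΩ hT hK hF hFΩ hx hseg hxy
  have hfin : {G | G ∈ cells K ∧ p ∈ G}.Finite := (cells_finite hT.1).subset fun G hG => hG.1
  refine abs_sub_le_of_closed_cover hfin.toFinset (T := hull) (fun G _ => isClosed_hull G)
    (fun G hG => ?_) (fun z hz => ?_)
  · have hG' : G ∈ cells K ∧ p ∈ G := by simpa using hG
    exact hf p hp G hG'.1 hG'.2
  · obtain ⟨G, hG, hpG, hzG⟩ := h z hz
    simp only [mem_iUnion, exists_prop, Finite.mem_toFinset, mem_ofPred_eq]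
    exact ⟨G, ⟨hG, hpG⟩, hzG⟩

/-- Finite element functions are Lipschitz. -/
lemma exists_lipschitz_of_mem_feSpace {Ω : Set 𝔼} (hΩ : IsOpen Ω) {K : 𝕂}
    (hT : IsTriangulation Ω K) {v : 𝔼 → ℝ} (hv : v ∈ feSpace Ω K) :
    ∃ L : ℝ, ∀ x y, |v x - v y| ≤ L * ‖x - y‖ := by
  classical
  obtain ⟨hvc, hv0, hva⟩ := hv
  have hfin := cells_finite hT.1
  have hg : ∀ F ∈ cells K, ∃ g : 𝔼 →ᵃ[ℝ] ℝ, ∀ x ∈ hull F, v x = g x :=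
    fun F hF => hva _ (hull_mem_elements hF)
  choose! g hg using hg
  set L := ∑ F ∈ hfin.toFinset, gradNorm (g F) with hL
  have hL0 : 0 ≤ L := Finset.sum_nonneg fun F _ => gradNorm_nonneg _
  refine ⟨L, fun x y => ?_⟩
  refine abs_sub_le_of_closed_cover (ι := Option (Finset 𝔼)) (f := v)
    (T := fun o => o.elim Ωᶜ hull) (Finset.insertNone hfin.toFinset) ?_ ?_ ?_
  · rintro (_ | F) _
    · exact hΩ.isClosed_compl
    · exact isClosed_hull F
  · rintro (_ | F) hF a ha b hb
    · rw [hv0 a ha, hv0 b hb, sub_self, abs_zero]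
      positivity
    · have hF' : F ∈ cells K := by simpa using hF
      have ha' : a ∈ hull F := ha
      have hb' : b ∈ hull F := hb
      rw [hg F hF' a ha', hg F hF' b hb']
      refine (abs_affine_sub_le _ a b).trans (mul_le_mul_of_nonneg_right ?_ (norm_nonneg _))
      exact Finset.single_le_sum (f := fun F => gradNorm (g F)) (fun F _ => gradNorm_nonneg _)
        (by simpa using hF')
  · intro z _
    by_cases hz : z ∈ Ω
    · obtain ⟨F, hF, hzF⟩ := exists_cell_of_mem hT (subset_closure hz)
      exact mem_biUnion (x := some F) (by simpa using hF) hzF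
    · exact mem_biUnion (x := none) (by simp) hz

lemma mem_fracSobolevZero_of_mem_feSpace (hd : 1 ≤ d) {s : ℝ} (hs0 : 0 < s) (hs1 : s < 1)
    {Ω : Set 𝔼} (hΩ : IsOpen Ω) (hΩb : Bornology.IsBounded Ω) {K : 𝕂} (hT : IsTriangulation Ω K)
    {v : 𝔼 → ℝ} (hv : v ∈ feSpace Ω K) : v ∈ fracSobolevZero s Ω := by
  obtain ⟨L, hL⟩ := exists_lipschitz_of_mem_feSpace hΩ hT hv
  obtain ⟨hvc, hv0, hva⟩ := hv
  have hcs : HasCompactSupport v := HasCompactSupport.of_support_subset_isCompact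
    (Metric.isCompact_of_isClosed_isBounded isClosed_closure hΩb.closure)
    (fun x hx => subset_closure (by
      by_contra h
      exact hx (hv0 x h)))
  obtain ⟨M, hM⟩ := hcs.exists_bound_of_continuous hvc
  refine ⟨hvc.memLp_of_hasCompactSupport hcs, ?_, ?_⟩
  · exact gagliardoEnergy_lt_top_of_lipschitz hd hs0 hs1 hΩ hΩb
      ((norm_nonneg _).trans (hM 0)) hvc hv0 hM hL
  · exact Filter.Eventually.of_forall fun x hx => hv0 x fun h => hx (subset_closure h)

/-! ### The cutoff function -/

/-- A cutoff function between `B(x₀, R/2)` and `B(x₀, 3R/4)`. The field `taylor` says that `η²` has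
a Lipschitz derivative, whose norm at `c` is controlled by `η c`. -/
structure IsCutoff (L R : ℝ) (x₀ : 𝔼) (η : 𝔼 → ℝ) : Prop where
  continuous : Continuous η
  nonneg : ∀ x, 0 ≤ η x
  le_one : ∀ x, η x ≤ 1
  eq_one : ∀ x ∈ Metric.ball x₀ (R / 2), η x = 1
  eq_zero : ∀ x, x ∉ Metric.ball x₀ (3 / 4 * R) → η x = 0
  lipschitz : ∀ x y, |η x - η y| ≤ L / R * ‖x - y‖
  taylor : ∀ c, ∃ b : 𝔼 →L[ℝ] ℝ, ‖b‖ ≤ L / R * η c ∧ ∀ h x y, ‖x - c‖ ≤ h → ‖y - c‖ ≤ h →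
    |η x ^ 2 - η y ^ 2 - b (x - y)| ≤ L / R ^ 2 * h * ‖x - y‖

/-- The cutoff functions are rescalings of one smooth bump function, so `L` does not depend on the
ball. -/
lemma exists_cutoff : ∃ L : ℝ, 0 < L ∧ ∀ R : ℝ, 0 < R → ∀ x₀ : 𝔼,
    ∃ η, IsCutoff L R x₀ η := by
  let f : ContDiffBump (0 : 𝔼) := ⟨1 / 2, 3 / 4, by norm_num, by norm_num⟩
  have hf : ContDiff ℝ 2 f := f.contDiff
  obtain ⟨L₁, hL₁⟩ := hf.lipschitzWith_of_hasCompactSupport f.hasCompactSupport two_ne_zero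
  set θ : 𝔼 → ℝ := fun x => f x ^ 2 with hθ
  have hθs : ContDiff ℝ 2 θ := hf.pow 2
  have hθd : Differentiable ℝ θ := hθs.differentiable two_ne_zero
  have hθc : HasCompactSupport θ := f.hasCompactSupport.comp_left (g := fun t => t ^ 2) (by simp)
  obtain ⟨L₂, hL₂⟩ := (hθs.fderiv_right (m := 1) (by norm_num)).lipschitzWith_of_hasCompactSupport
    (hθc.fderiv (𝕜 := ℝ)) one_ne_zero
  have hfd : ∀ x, HasFDerivAt f (fderiv ℝ f x) x := fun x =>
    (hf.differentiable two_ne_zero x).hasFDerivAt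
  have hθ' : ∀ x, ‖fderiv ℝ θ x‖ ≤ 2 * L₁ * f x := by
    intro x
    have h1 : HasFDerivAt θ ((2 * f x) • fderiv ℝ f x) x := by
      have := (hfd x).pow 2
      simpa using this
    rw [h1.fderiv, norm_smul, Real.norm_of_nonneg (by have := f.nonneg (x := x); positivity)]
    have := norm_fderiv_le_of_lipschitz ℝ hL₁ (x₀ := x)
    nlinarith [f.nonneg (x := x)]
  refine ⟨1 + 2 * L₁ + L₂, by positivity, fun R hR x₀ => ?_⟩
  set S : 𝔼 → 𝔼 := fun x => R⁻¹ • (x - x₀) with hS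
  have hSd : ∀ x y, ‖S x - S y‖ = ‖x - y‖ / R := by
    intro x y
    simp only [hS]
    rw [← smul_sub, norm_smul, norm_inv, Real.norm_of_nonneg hR.le, sub_sub_sub_cancel_right]
    field_simp
  have hS0 : ∀ x, ‖S x‖ = dist x x₀ / R := by
    intro x
    have := hSd x x₀
    simpa [hS, dist_eq_norm] using this
  refine ⟨f ∘ S, ?_, fun x => f.nonneg, fun x => f.le_one, ?_, ?_, ?_, ?_⟩
  · exact f.continuous.comp (by fun_prop)
  · intro x hx
    refine f.one_of_mem_closedBall ?_
    rw [Metric.mem_ball] at hx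
    rw [mem_closedBall_zero_iff, hS0]
    show dist x x₀ / R ≤ 1 / 2
    rw [div_le_iff₀ hR]; linarith
  · intro x hx
    refine f.zero_of_le_dist ?_
    rw [Metric.mem_ball, not_lt] at hx
    rw [dist_zero_right, hS0]
    show 3 / 4 ≤ dist x x₀ / R
    rwa [le_div_iff₀ hR]
  · intro x y
    have h1 := hL₁.dist_le_mul (S x) (S y)
    rw [dist_eq_norm (S x), hSd, Real.dist_eq] at h1
    refine h1.trans ?_
    rw [div_mul_eq_mul_div, mul_div_assoc]
    refine mul_le_mul_of_nonneg_right ?_ (by positivity)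
    have := L₁.2
    have := L₂.2
    linarith
  · intro c
    refine ⟨R⁻¹ • fderiv ℝ θ (S c), ?_, fun h x y hx hy => ?_⟩
    · rw [norm_smul, norm_inv, Real.norm_of_nonneg hR.le]
      have h1 := hθ' (S c)
      have h2 : (2 : ℝ) * L₁ * f (S c) ≤ (1 + 2 * L₁ + L₂) * f (S c) :=
        mul_le_mul_of_nonneg_right (by linarith [L₂.2]) f.nonneg
      calc R⁻¹ * ‖fderiv ℝ θ (S c)‖ ≤ R⁻¹ * ((1 + 2 * L₁ + L₂) * f (S c)) := by
            refine mul_le_mul_of_nonneg_left (h1.trans h2) (by positivity)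
        _ = _ := by simp only [Function.comp_apply]; ring
    · have hball : ∀ w, ‖w - c‖ ≤ h → S w ∈ Metric.closedBall (S c) (h / R) := by
        intro w hw
        rw [Metric.mem_closedBall, dist_eq_norm, hSd]
        exact div_le_div_of_nonneg_right hw hR.le
      have hmv := (convex_closedBall (S c) (h / R)).norm_image_sub_le_of_norm_hasFDerivWithin_le'
        (f := θ) (f' := fderiv ℝ θ) (φ := fderiv ℝ θ (S c)) (C := L₂ * (h / R))
        (fun w _ => (hθd w).hasFDerivAt.hasFDerivWithinAt)
        (fun w hw => by
          have := hL₂.dist_le_mul w (S c)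
          rw [dist_eq_norm] at this
          exact this.trans (mul_le_mul_of_nonneg_left (Metric.mem_closedBall.1 hw) L₂.2))
        (hball y hy) (hball x hx)
      rw [hSd, Real.norm_eq_abs] at hmv
      have e1 : fderiv ℝ θ (S c) (S x - S y) = (R⁻¹ • fderiv ℝ θ (S c)) (x - y) := by
        have : S x - S y = R⁻¹ • (x - y) := by
          simp only [hS]; rw [← smul_sub, sub_sub_sub_cancel_right]
        rw [this, map_smul]; rfl
      rw [e1] at hmv
      refine hmv.trans ?_
      have h0 : 0 ≤ h := (norm_nonneg _).trans hx
      calc (L₂ : ℝ) * (h / R) * (‖x - y‖ / R) = L₂ / R ^ 2 * h * ‖x - y‖ := by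
            field_simp
        _ ≤ _ := by
            gcongr
            have := L₁.2
            linarith

/-! ### Estimates on one element -/

/-- The interpolation error of `η² g`, for `g` affine. After subtraction of the affine part of
`η² g` at `c`, only the products of first order terms and the second order remainder of `η²` are
left; each first order factor of `η²` comes with `η c`. -/
lemma interp_error_le {L R τ : ℝ} (hR : 0 < R) (hL : 0 < L) (hτ : 0 < τ) {x₀ : 𝔼} {η : 𝔼 → ℝ}
    (hη : IsCutoff L R x₀ η) {F : Finset 𝔼} {c : 𝔼} (hpos : 0 < cellSize F)
    (hc : Metric.closedBall c (τ * cellSize F) ⊆ hull F) (g ψ : 𝔼 →ᵃ[ℝ] ℝ)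
    (hψ : ∀ p ∈ F, ψ p = η p ^ 2 * g p) {e : ℝ}
    (he : e = η c * cellSize F * gradNorm g +
      cellSize F / R * (|g c| + cellSize F * gradNorm g)) :
    (∀ x ∈ hull F, |η x ^ 2 * g x - ψ x| ≤ 4 * L * (1 + τ⁻¹) * (cellSize F / R) * e) ∧
    ∀ x ∈ hull F, ∀ y ∈ hull F, |(η x ^ 2 * g x - ψ x) - (η y ^ 2 * g y - ψ y)| ≤
      4 * L * (1 + τ⁻¹) / R * e * ‖x - y‖ := by
  obtain ⟨b, hb, hT⟩ := hη.taylor c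
  set h := cellSize F with hh
  set A := gradNorm g with hA
  have hA0 : 0 ≤ A := gradNorm_nonneg g
  have hcF : c ∈ hull F := hc (Metric.mem_closedBall_self (by positivity))
  have hη0 := hη.nonneg c
  have he0 : 0 ≤ e := by rw [he]; positivity
  set lin : 𝔼 →ₗ[ℝ] ℝ := g c • (b : 𝔼 →ₗ[ℝ] ℝ) + η c ^ 2 • g.linear with hlin
  set ℓ : 𝔼 →ᵃ[ℝ] ℝ := lin.toAffineMap + AffineMap.const ℝ 𝔼 (η c ^ 2 * g c - lin c) with hℓ
  have hℓx : ∀ x, ℓ x = η c ^ 2 * g c + g c * b (x - c) + η c ^ 2 * (g x - g c) := by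
    intro x
    have : ℓ x = lin (x - c) + η c ^ 2 * g c := by
      simp only [hℓ, AffineMap.coe_add, Pi.add_apply, LinearMap.coe_toAffineMap,
        AffineMap.const_apply, map_sub]; ring
    rw [this, affine_sub]
    simp [hlin]; ring
  set Q : 𝔼 → ℝ := fun x => η x ^ 2 * g x - ℓ x with hQ
  have hQc : Q c = 0 := by simp [hQ, hℓx]
  have hQlip : ∀ x ∈ hull F, ∀ y ∈ hull F, |Q x - Q y| ≤ 2 * L / R * e * ‖x - y‖ := by
    intro x hx y hy
    have hxc := norm_sub_le_diam hx hcF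
    have hyc := norm_sub_le_diam hy hcF
    have hn := norm_nonneg (x - y)
    set n := ‖x - y‖ with hnn
    have hB' : |b (y - c)| ≤ L / R * η c * h :=
      (b.le_opNorm _).trans (mul_le_mul hb hyc (norm_nonneg _) (by positivity))
    have hBB : |b (x - c) - b (y - c)| ≤ L / R * η c * n := by
      rw [← map_sub, sub_sub_sub_cancel_right]
      exact (b.le_opNorm _).trans (mul_le_mul_of_nonneg_right hb hn)
    have ha : |g x - g c| ≤ A * h :=
      (abs_affine_sub_le g x c).trans (mul_le_mul_of_nonneg_left hxc hA0)
    have haa : |g x - g y| ≤ A * n := abs_affine_sub_le g x y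
    have hrr := hT h x y hxc hyc
    have hr' : |η y ^ 2 - η c ^ 2 - b (y - c)| ≤ L / R ^ 2 * h * h :=
      (hT h y c hyc (by simp [hpos.le])).trans
        (mul_le_mul_of_nonneg_left hyc (by positivity))
    have hgx : |g x| ≤ |g c| + h * A := by
      have := abs_add_le (g c) (g x - g c)
      rw [add_sub_cancel] at this
      linarith
    have hbsub : b (x - y) = b (x - c) - b (y - c) := by
      rw [← map_sub, sub_sub_sub_cancel_right]
    have hdecomp : Q x - Q y = (b (x - c) - b (y - c)) * (g x - g c) + b (y - c) * (g x - g y) +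
        (η x ^ 2 - η y ^ 2 - b (x - y)) * g x +
        (η y ^ 2 - η c ^ 2 - b (y - c)) * (g x - g y) := by
      simp only [hQ, hℓx, hbsub]; ring
    rw [hdecomp]
    have t1 : |(b (x - c) - b (y - c)) * (g x - g c)| ≤ L / R * η c * n * (A * h) := by
      rw [abs_mul]; exact mul_le_mul hBB ha (abs_nonneg _) (by positivity)
    have t2 : |b (y - c) * (g x - g y)| ≤ L / R * η c * h * (A * n) := by
      rw [abs_mul]; exact mul_le_mul hB' haa (abs_nonneg _) (by positivity)
    have t3 : |(η x ^ 2 - η y ^ 2 - b (x - y)) * g x| ≤ L / R ^ 2 * h * n * (|g c| + h * A) := by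
      rw [abs_mul]; exact mul_le_mul hrr hgx (abs_nonneg _) (by positivity)
    have t4 : |(η y ^ 2 - η c ^ 2 - b (y - c)) * (g x - g y)| ≤ L / R ^ 2 * h * h * (A * n) := by
      rw [abs_mul]; exact mul_le_mul hr' haa (abs_nonneg _) (by positivity)
    have t5 : L / R ^ 2 * h * h * (A * n) ≤ L / R ^ 2 * h * n * (|g c| + h * A) := by
      have : 0 ≤ L / R ^ 2 * h * n * |g c| := by positivity
      nlinarith
    calc _ ≤ L / R * η c * n * (A * h) + L / R * η c * h * (A * n) +
          L / R ^ 2 * h * n * (|g c| + h * A) + L / R ^ 2 * h * n * (|g c| + h * A) := by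
          refine (abs_add_le _ _).trans (add_le_add ((abs_add_le _ _).trans
            (add_le_add ((abs_add_le _ _).trans (add_le_add t1 t2)) t3)) (t4.trans t5))
      _ = _ := by rw [he]; field_simp; ring
  set q := 2 * L / R * e * h with hq
  have hq0 : 0 ≤ q := by positivity
  have hQb : ∀ x ∈ hull F, |Q x| ≤ q := by
    intro x hx
    have h1 := hQlip x hx c hcF
    rw [hQc, sub_zero] at h1
    exact h1.trans (mul_le_mul_of_nonneg_left (norm_sub_le_diam hx hcF) (by positivity))
  have hψℓ : ∀ x ∈ hull F, |(ψ - ℓ) x| ≤ q := fun x hx =>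
    abs_affine_le_of_mem_hull (fun p hp => by
      have := hQb p (subset_convexHull ℝ _ hp)
      simp only [hQ] at this
      rwa [AffineMap.coe_sub, Pi.sub_apply, hψ p hp]) hx
  have hgrad : τ * h * gradNorm (ψ - ℓ) ≤ q :=
    mul_gradNorm_le (by positivity) fun x hx => hψℓ x (hc hx)
  have hgrad' : gradNorm (ψ - ℓ) ≤ τ⁻¹ * (2 * L / R * e) := by
    rw [← div_eq_inv_mul, le_div_iff₀ hτ]
    refine le_of_mul_le_mul_right ?_ hpos
    linarith
  have hE : ∀ x, η x ^ 2 * g x - ψ x = Q x - (ψ - ℓ) x := fun x => by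
    simp only [hQ, AffineMap.coe_sub, Pi.sub_apply]; ring
  have hτ1 : 0 < τ⁻¹ := by positivity
  refine ⟨fun x hx => ?_, fun x hx y hy => ?_⟩
  · rw [hE]
    refine (abs_sub _ _).trans ((add_le_add (hQb x hx) (hψℓ x hx)).trans ?_)
    have e1 : 4 * L * (1 + τ⁻¹) * (h / R) * e = (1 + τ⁻¹) * (q + q) := by rw [hq]; ring
    rw [e1]
    exact le_mul_of_one_le_left (by positivity) (by linarith)
  · rw [hE, hE, sub_sub_sub_comm]
    refine (abs_sub _ _).trans ((add_le_add (hQlip x hx y hy)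
      ((abs_affine_sub_le _ x y).trans (mul_le_mul_of_nonneg_right hgrad' (norm_nonneg _)))).trans ?_)
    have : 0 ≤ 2 * L / R * e * (1 + τ⁻¹) * ‖x - y‖ := by positivity
    have e1 : 4 * L * (1 + τ⁻¹) / R * e * ‖x - y‖ = 2 * (2 * L / R * e * (1 + τ⁻¹) * ‖x - y‖) := by
      ring
    rw [e1]
    nlinarith

/-- The volume of the unit ball. -/
noncomputable def unitVol (d : ℕ) : ℝ :=
  (volume (Metric.ball (0 : EuclideanSpace ℝ (Fin d)) 1)).toReal

lemma unitVol_pos : 0 < unitVol d :=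
  ENNReal.toReal_pos (Metric.measure_ball_pos _ _ one_pos).ne' measure_ball_lt_top.ne

lemma volume_ball_eq (hd : 1 ≤ d) (x : 𝔼) {r : ℝ} (hr : 0 ≤ r) :
    volume (Metric.ball x r) = ENNReal.ofReal (unitVol d * r ^ d) := by
  have : Nonempty (Fin d) := ⟨⟨0, hd⟩⟩
  rw [Measure.addHaar_ball volume _ hr, mul_comm, ENNReal.ofReal_mul unitVol_pos.le, unitVol,
    ENNReal.ofReal_toReal measure_ball_lt_top.ne, finrank_euclideanSpace, Fintype.card_fin]

lemma volume_hull_le (hd : 1 ≤ d) {F : Finset 𝔼} (hF : F.Nonempty) :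
    volume (hull F) ≤ ENNReal.ofReal (unitVol d * 2 ^ d * cellSize F ^ d) := by
  obtain ⟨p, hp⟩ := hF
  have hp' : p ∈ hull F := subset_convexHull ℝ _ hp
  have h0 : 0 ≤ cellSize F := Metric.diam_nonneg
  rcases h0.eq_or_lt with h | h
  · have : hull F ⊆ {p} := fun x hx => by
      have := norm_sub_le_diam hx hp'
      rw [mem_singleton_iff, ← sub_eq_zero, ← norm_le_zero_iff]
      exact this.trans h.symm.le
    have hne : Nonempty (Fin d) := ⟨⟨0, hd⟩⟩
    rw [measure_mono_null this (by simp)]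
    exact zero_le
  · have hsub : hull F ⊆ Metric.ball p (2 * cellSize F) := fun x hx => by
      rw [Metric.mem_ball, dist_eq_norm]
      exact (norm_sub_le_diam hx hp').trans_lt (by linarith)
    refine (measure_mono hsub).trans (le_of_eq ?_)
    rw [volume_ball_eq hd _ (by positivity), mul_pow, mul_assoc]

/-- An affine function is large on a fixed portion of an element. -/
lemma affine_sq_le_lintegral (hd : 1 ≤ d) {τ : ℝ} (hτ : 0 < τ) (hτ1 : τ ≤ 1) {F : Finset 𝔼} {c : 𝔼}
    (hpos : 0 < cellSize F) (hc : Metric.closedBall c (τ * cellSize F) ⊆ hull F) (g : 𝔼 →ᵃ[ℝ] ℝ) :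
    ENNReal.ofReal (unitVol d * (τ / 4) ^ (d + 2) * (cellSize F ^ d *
      (|g c| + cellSize F * gradNorm g) ^ 2)) ≤ ∫⁻ x in hull F, ENNReal.ofReal (g x ^ 2) := by
  obtain ⟨e, he, hge⟩ := exists_gradient_direction g
  set h := cellSize F with hh
  set A := gradNorm g with hA
  have hA0 : 0 ≤ A := gradNorm_nonneg g
  -- move from `c` in the direction in which `|g|` grows
  obtain ⟨ς, hς, hςg⟩ : ∃ ς : ℝ, |ς| = 1 ∧ ς * g c = |g c| := by
    rcases le_total 0 (g c) with h0 | h0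
    · exact ⟨1, abs_one, by rw [one_mul, abs_of_nonneg h0]⟩
    · exact ⟨-1, by simp, by rw [abs_of_nonpos h0]; ring⟩
  have hς2 : ς * ς = 1 := by rw [← abs_mul_abs_self, hς, one_mul]
  set r := τ * h with hr
  have hr0 : 0 < r := by positivity
  set c' := c + (ς * (r / 2)) • e with hc'
  have hcc : ‖c' - c‖ ≤ r / 2 := by
    rw [hc', add_sub_cancel_left, norm_smul, Real.norm_eq_abs, abs_mul, hς, one_mul,
      abs_of_pos (by positivity)]
    nlinarith
  have hsub : Metric.ball c' (r / 4) ⊆ hull F := fun x hx => hc (by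
    rw [Metric.mem_ball, dist_eq_norm] at hx
    rw [Metric.mem_closedBall, dist_eq_norm]
    have := norm_add_le (x - c') (c' - c)
    rw [sub_add_sub_cancel] at this
    linarith)
  have hlow : ∀ x ∈ Metric.ball c' (r / 4), (τ / 4 * (|g c| + h * A)) ^ 2 ≤ g x ^ 2 := by
    intro x hx
    rw [Metric.mem_ball, dist_eq_norm] at hx
    have h1 : g c' - g c = ς * (r / 2) * A := by
      rw [affine_sub, hc', add_sub_cancel_left, map_smul, hge, smul_eq_mul]
    have h2 : |g x - g c'| ≤ A * (r / 4) :=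
      (abs_affine_sub_le g x c').trans (mul_le_mul_of_nonneg_left hx.le hA0)
    have h3 : |g c| + A * (r / 4) ≤ ς * g x := by
      have h4 : ς * g x = |g c| + (ς * ς) * (r / 2) * A + ς * (g x - g c') := by
        rw [← hςg]
        have : g c' = g c + ς * (r / 2) * A := by linarith
        rw [this]; ring
      have h5 : -(A * (r / 4)) ≤ ς * (g x - g c') := by
        have : |ς * (g x - g c')| ≤ A * (r / 4) := by rw [abs_mul, hς, one_mul]; exact h2
        exact (abs_le.1 this).1
      rw [h4, hς2]; linarith
    have h6 : τ / 4 * (|g c| + h * A) ≤ ς * g x := by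
      refine le_trans ?_ h3
      rw [hr]
      nlinarith [abs_nonneg (g c)]
    have h7 : (ς * g x) ^ 2 = g x ^ 2 := by rw [mul_pow, sq ς, hς2, one_mul]
    rw [← h7]
    exact pow_le_pow_left₀ (by positivity) h6 2
  calc _ = ENNReal.ofReal ((τ / 4 * (|g c| + h * A)) ^ 2) * volume (Metric.ball c' (r / 4)) := by
        rw [volume_ball_eq hd _ (by positivity), ← ENNReal.ofReal_mul (by positivity)]
        congr 1
        rw [hr]; ring
    _ = ∫⁻ _ in Metric.ball c' (r / 4), ENNReal.ofReal ((τ / 4 * (|g c| + h * A)) ^ 2) := by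
        rw [setLIntegral_const]
    _ ≤ ∫⁻ x in Metric.ball c' (r / 4), ENNReal.ofReal (g x ^ 2) :=
        setLIntegral_mono' Metric.isOpen_ball.measurableSet fun x hx =>
          ENNReal.ofReal_le_ofReal (hlow x hx)
    _ ≤ _ := lintegral_mono_set hsub

lemma le_gagliardoMeasure_prod {s : ℝ} (hs0 : 0 < s) {A B : Set 𝔼} (hA : MeasurableSet A)
    (hB : MeasurableSet B) {h : ℝ} (hAB : ∀ x ∈ A, ∀ y ∈ B, ‖x - y‖ ≤ h)
    (hne : ∀ x ∈ A, ∀ y ∈ B, x ≠ y) :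
    ENNReal.ofReal (1 / h ^ ((d : ℝ) + 2 * s)) * (volume A * volume B) ≤
      gagliardoMeasure d s (A ×ˢ B) := by
  rw [gagliardoMeasure, withDensity_apply _ (hA.prod hB), ← Measure.prod_prod,
    ← setLIntegral_const]
  refine setLIntegral_mono' (hA.prod hB) fun p hp => ENNReal.ofReal_le_ofReal ?_
  have hpos : 0 < ‖p.1 - p.2‖ := norm_pos_iff.2 (sub_ne_zero.2 (hne _ hp.1 _ hp.2))
  exact one_div_le_one_div_of_le (by positivity)
    (Real.rpow_le_rpow hpos.le (hAB _ hp.1 _ hp.2) (by positivity))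

/-- The gradient of an affine `g` on an element, weighted by `η`, is controlled by the energy of
`η g` on that element, up to a term that stems from the variation of `η`. -/
lemma gradient_sq_le_energy (hd : 1 ≤ d) {s τ L R : ℝ} (hs0 : 0 < s) (hR : 0 < R) (hL : 0 < L)
    (hτ : 0 < τ) {x₀ : 𝔼} {η : 𝔼 → ℝ} (hη : IsCutoff L R x₀ η) {F : Finset 𝔼} {c : 𝔼}
    (hpos : 0 < cellSize F) (hc : Metric.closedBall c (τ * cellSize F) ⊆ hull F)
    (g : 𝔼 →ᵃ[ℝ] ℝ) {G : ℝ} (hG0 : 0 ≤ G)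
    (hG : ∫⁻ p in hull F ×ˢ hull F, ENNReal.ofReal (incr (fun x => η x * g x) p ^ 2)
      ∂gagliardoMeasure d s ≤ ENNReal.ofReal G) :
    (unitVol d * (τ / 4) ^ d) ^ 2 * (cellSize F ^ d / cellSize F ^ (2 * s)) *
      ((η c * gradNorm g * (τ * cellSize F) / 2) ^ 2 / 2 -
        (2 * (L / R) * cellSize F * (|g c| + cellSize F * gradNorm g)) ^ 2) ≤ G := by
  obtain ⟨e, he, hge⟩ := exists_gradient_direction g
  set h := cellSize F with hh
  set A := gradNorm g with hA
  have hA0 : 0 ≤ A := gradNorm_nonneg g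
  have hη0 := hη.nonneg c
  set r := τ * h with hr
  have hr0 : 0 < r := by positivity
  set X := η c * A * r / 2 with hX
  set m := |g c| + h * A with hm
  have hm0 : 0 ≤ m := by positivity
  set κ := X ^ 2 / 2 - (2 * (L / R) * h * m) ^ 2 with hκ
  have hω0 : 0 < unitVol d := unitVol_pos
  rcases le_or_gt κ 0 with hκ0 | hκ0
  · refine le_trans ?_ hG0
    exact mul_nonpos_of_nonneg_of_nonpos (by positivity) hκ0
  have hXpos : 0 < X := by
    have h1 : 0 < X ^ 2 := by
      have := sq_nonneg (2 * (L / R) * h * m)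
      linarith
    have h2 : 0 ≤ X := by positivity
    exact h2.lt_of_ne fun h => by rw [← h] at h1; simp at h1
  have hball : ∀ ς : ℝ, |ς| = 1 → ∀ x ∈ Metric.ball (c + (ς * (r / 2)) • e) (r / 4),
      x ∈ hull F := by
    intro ς hς x hx
    refine hc ?_
    rw [Metric.mem_ball, dist_eq_norm] at hx
    rw [Metric.mem_closedBall, dist_eq_norm]
    have h1 : ‖(ς * (r / 2)) • e‖ ≤ r / 2 := by
      rw [norm_smul, Real.norm_eq_abs, abs_mul, hς, one_mul, abs_of_pos (by positivity)]
      nlinarith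
    have := norm_add_le (x - (c + (ς * (r / 2)) • e)) ((ς * (r / 2)) • e)
    rw [show x - (c + (ς * (r / 2)) • e) + (ς * (r / 2)) • e = x - c by abel] at this
    linarith
  have hval : ∀ ς : ℝ, ∀ x ∈ Metric.ball (c + (ς * (r / 2)) • e) (r / 4),
      |g x - g c - ς * (r / 2) * A| ≤ A * (r / 4) := by
    intro ς x hx
    rw [Metric.mem_ball, dist_eq_norm] at hx
    have h1 : g (c + (ς * (r / 2)) • e) - g c = ς * (r / 2) * A := by
      rw [affine_sub, add_sub_cancel_left, map_smul, hge, smul_eq_mul]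
    rw [← h1, sub_sub_sub_cancel_right]
    exact (abs_affine_sub_le g _ _).trans (mul_le_mul_of_nonneg_left hx.le hA0)
  set B₁ := Metric.ball (c + ((1 : ℝ) * (r / 2)) • e) (r / 4) with hB₁
  set B₂ := Metric.ball (c + ((-1 : ℝ) * (r / 2)) • e) (r / 4) with hB₂
  have hcF : c ∈ hull F := hc (Metric.mem_closedBall_self hr0.le)
  have hdiff : ∀ x ∈ B₁, ∀ y ∈ B₂, A * (r / 2) ≤ g x - g y := by
    intro x hx y hy
    have h1 := (abs_le.1 (hval 1 x hx)).1
    have h2 := (abs_le.1 (hval (-1) y hy)).2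
    linarith
  have hApos : 0 < A := by
    refine hA0.lt_of_ne fun h0 => hXpos.ne ?_
    rw [hX, ← h0]; ring
  have hpt : ∀ x ∈ B₁, ∀ y ∈ B₂, κ ≤ (η x * g x - η y * g y) ^ 2 := by
    intro x hx y hy
    have hxF := hball 1 abs_one x hx
    have hyF := hball (-1) (by simp) y hy
    have hg : ∀ z ∈ hull F, |g z| ≤ m := by
      intro z hz
      have h1 := abs_add_le (g c) (g z - g c)
      rw [add_sub_cancel] at h1
      have h2 : |g z - g c| ≤ A * h := (abs_affine_sub_le g z c).trans
        (mul_le_mul_of_nonneg_left (norm_sub_le_diam hz hcF) hA0)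
      linarith
    have hηz : ∀ z ∈ hull F, |(η z - η c) * g z| ≤ L / R * h * m := by
      intro z hz
      rw [abs_mul]
      exact mul_le_mul ((hη.lipschitz z c).trans (mul_le_mul_of_nonneg_left
        (norm_sub_le_diam hz hcF) (by positivity))) (hg z hz) (abs_nonneg _) (by positivity)
    set W := (η x - η c) * g x - (η y - η c) * g y with hW
    have hWb : |W| ≤ 2 * (L / R) * h * m := by
      have := abs_sub ((η x - η c) * g x) ((η y - η c) * g y)
      linarith [hηz x hxF, hηz y hyF]
    have hW2 : W ^ 2 ≤ (2 * (L / R) * h * m) ^ 2 := by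
      rw [← sq_abs]; exact pow_le_pow_left₀ (abs_nonneg _) hWb 2
    have hXle : X ≤ η c * (g x - g y) := by
      have := mul_le_mul_of_nonneg_left (hdiff x hx y hy) hη0
      rw [hX]; linarith
    have hX2 : X ^ 2 ≤ (η c * (g x - g y)) ^ 2 := pow_le_pow_left₀ hXpos.le hXle 2
    have hsplit : η x * g x - η y * g y = η c * (g x - g y) + W := by rw [hW]; ring
    rw [hsplit, hκ]
    nlinarith [sq_nonneg (η c * (g x - g y) + 2 * W)]
  have hB₁m : MeasurableSet B₁ := Metric.isOpen_ball.measurableSet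
  have hB₂m : MeasurableSet B₂ := Metric.isOpen_ball.measurableSet
  have hν := le_gagliardoMeasure_prod (d := d) hs0 hB₁m hB₂m
    (fun x hx y hy => norm_sub_le_diam (hball 1 abs_one x hx) (hball (-1) (by simp) y hy))
    (fun x hx y hy hxy => by
      have := hdiff x hx y hy
      rw [hxy, sub_self] at this
      have h1 : 0 < A * (r / 2) := by positivity
      linarith)
  have hchain : ENNReal.ofReal κ * (ENNReal.ofReal (1 / h ^ ((d : ℝ) + 2 * s)) *
      (volume B₁ * volume B₂)) ≤ ENNReal.ofReal G := by
    calc _ ≤ ENNReal.ofReal κ * gagliardoMeasure d s (B₁ ×ˢ B₂) := mul_le_mul_right hν _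
      _ = ∫⁻ _ in B₁ ×ˢ B₂, ENNReal.ofReal κ ∂gagliardoMeasure d s := by rw [setLIntegral_const]
      _ ≤ ∫⁻ p in B₁ ×ˢ B₂, ENNReal.ofReal (incr (fun x => η x * g x) p ^ 2)
          ∂gagliardoMeasure d s :=
          setLIntegral_mono' (hB₁m.prod hB₂m) fun p hp =>
            ENNReal.ofReal_le_ofReal (hpt _ hp.1 _ hp.2)
      _ ≤ _ := (lintegral_mono_set (prod_mono (hball 1 abs_one) (hball (-1) (by simp)))).trans hG
  rw [volume_ball_eq hd _ (by positivity), volume_ball_eq hd _ (by positivity),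
    ← ENNReal.ofReal_mul (by positivity), ← ENNReal.ofReal_mul (by positivity),
    ← ENNReal.ofReal_mul hκ0.le, ENNReal.ofReal_le_ofReal_iff hG0] at hchain
  refine le_trans (le_of_eq ?_) hchain
  rw [Real.rpow_add hpos, Real.rpow_natCast, hr, show τ * h / 4 = τ / 4 * h by ring,
    mul_pow (τ / 4) h d]
  have h1 : h ^ d ≠ 0 := by positivity
  have h2 : h ^ (2 * s) ≠ 0 := by positivity
  field_simp

/-- The arithmetic behind `exists_element_estimates`. There `H = h ^ d`, `S = h ^ (2 s)`,
`ρ = R ^ (-2 s)`, `l = h / R`, `m` bounds `|g|` and `a` is `h` times the gradient of `g` weighted by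
`η`; the hypothesis `hN` is the inverse estimate for the gradient. -/
lemma weighted_sq_le {τ k c₀ H S ρ L l a m G Z : ℝ} (hτ : 0 < τ) (hk : 0 < k) (hc₀ : 0 < c₀)
    (hH : 0 < H) (hS : 0 < S) (hρ : 0 ≤ ρ) (hZ : 0 ≤ Z) (hG : 0 ≤ G)
    (hN : k * (H / S) * ((a * τ / 2) ^ 2 / 2 - (2 * L * l * m) ^ 2) ≤ G)
    (hm : H * m ^ 2 ≤ Z / c₀) (hl : l ^ 2 ≤ S * ρ) :
    H * (a + l * m) ^ 2 ≤
      (16 / (τ ^ 2 * k) + (64 * L ^ 2 / τ ^ 2 + 2) / c₀) * (S * (G + ρ * Z)) := by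
  have hm3 : l ^ 2 * (H * m ^ 2) ≤ S * (ρ * Z) / c₀ := by
    calc l ^ 2 * (H * m ^ 2) ≤ (S * ρ) * (Z / c₀) :=
          mul_le_mul hl hm (by positivity) (by positivity)
      _ = _ := by ring
  have h1 : H * ((a * τ / 2) ^ 2 / 2 - (2 * L * l * m) ^ 2) ≤ S * G / k := by
    rw [le_div_iff₀ hk]
    have h2 := mul_le_mul_of_nonneg_left hN hS.le
    refine le_trans (le_of_eq ?_) h2
    field_simp
  have h3 : H * a ^ 2 ≤ 8 / τ ^ 2 * (S * G / k + 4 * L ^ 2 * (S * (ρ * Z) / c₀)) := by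
    have h4 : 4 * L ^ 2 * (l ^ 2 * (H * m ^ 2)) ≤ 4 * L ^ 2 * (S * (ρ * Z) / c₀) :=
      mul_le_mul_of_nonneg_left hm3 (by positivity)
    have h5 : H * ((a * τ / 2) ^ 2 / 2) ≤ S * G / k + 4 * L ^ 2 * (S * (ρ * Z) / c₀) := by
      linarith
    calc H * a ^ 2 = 8 / τ ^ 2 * (H * ((a * τ / 2) ^ 2 / 2)) := by field_simp; norm_num
      _ ≤ _ := mul_le_mul_of_nonneg_left h5 (by positivity)
  have h6 : H * (a + l * m) ^ 2 ≤ 2 * (H * a ^ 2) + 2 * (l ^ 2 * (H * m ^ 2)) := by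
    have := mul_nonneg hH.le (sq_nonneg (a - l * m))
    linarith
  have p1 : 0 ≤ S * G / k := by positivity
  have p2 : 0 ≤ S * (ρ * Z) / c₀ := by positivity
  calc H * (a + l * m) ^ 2
      ≤ 2 * (8 / τ ^ 2 * (S * G / k + 4 * L ^ 2 * (S * (ρ * Z) / c₀))) +
        2 * (S * (ρ * Z) / c₀) := by linarith
    _ = 16 / (τ ^ 2 * k) * (S * G) + (64 * L ^ 2 / τ ^ 2 + 2) / c₀ * (S * (ρ * Z)) := by
        field_simp; ring
    _ ≤ (16 / (τ ^ 2 * k) * (S * G) + (64 * L ^ 2 / τ ^ 2 + 2) / c₀ * (S * (ρ * Z))) +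
        (16 / (τ ^ 2 * k) * (S * (ρ * Z)) + (64 * L ^ 2 / τ ^ 2 + 2) / c₀ * (S * G)) :=
        le_add_of_nonneg_right (by positivity)
    _ = _ := by ring

set_option maxHeartbeats 1000000 in
/-- All estimates on one element: `Z` and `G` are the squared `L²` norm of `g` and the energy of
`η g` on the element. The gain of the factor `(h / R) ^ 2` in the error of the interpolation of
`η² g`, with the energy of `η g` rather than that of `g` on the right, is the superapproximation
property of finite elements. -/
lemma exists_element_estimates (hd : 1 ≤ d) {s τ L : ℝ} (hs0 : 0 < s) (hs1 : s < 1) (hτ : 0 < τ)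
    (hτ1 : τ ≤ 1) (hL : 0 < L) :
    ∃ C : ℝ, 0 < C ∧ ∀ {R : ℝ} {x₀ : 𝔼} {η : 𝔼 → ℝ} {F : Finset 𝔼} {c : 𝔼}, 0 < R →
      IsCutoff L R x₀ η → 0 < cellSize F → cellSize F ≤ R →
      Metric.closedBall c (τ * cellSize F) ⊆ hull F → ∀ g ψ : 𝔼 →ᵃ[ℝ] ℝ,
      (∀ p ∈ F, ψ p = η p ^ 2 * g p) → ∀ {Z G : ℝ}, 0 ≤ Z → 0 ≤ G →
      ∫⁻ x in hull F, ENNReal.ofReal (g x ^ 2) ≤ ENNReal.ofReal Z →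
      ∫⁻ p in hull F ×ˢ hull F, ENNReal.ofReal (incr (fun x => η x * g x) p ^ 2)
        ∂gagliardoMeasure d s ≤ ENNReal.ofReal G →
      cellSize F ^ 2 * cellSize F ^ d * gradNorm g ^ 2 ≤ C * Z ∧
      (∀ x ∈ hull F, cellSize F ^ d * (η x ^ 2 * g x - ψ x) ^ 2 ≤
        C * (cellSize F / R) ^ 2 * cellSize F ^ (2 * s) * (G + R ^ (-(2 * s)) * Z)) ∧
      ∀ x ∈ hull F, ∀ y ∈ hull F,
        R ^ 2 * cellSize F ^ d * ((η x ^ 2 * g x - ψ x) - (η y ^ 2 * g y - ψ y)) ^ 2 ≤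
          C * cellSize F ^ (2 * s) * (G + R ^ (-(2 * s)) * Z) * ‖x - y‖ ^ 2 := by
  have hω : 0 < unitVol d := unitVol_pos
  obtain ⟨c₀, hc₀⟩ : ∃ c₀, c₀ = unitVol d * (τ / 4) ^ (d + 2) := ⟨_, rfl⟩
  obtain ⟨k, hk⟩ : ∃ k, k = (unitVol d * (τ / 4) ^ d) ^ 2 := ⟨_, rfl⟩
  obtain ⟨M, hM⟩ : ∃ M, M = 4 * L * (1 + τ⁻¹) := ⟨_, rfl⟩
  have hc₀0 : 0 < c₀ := by rw [hc₀]; positivity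
  have hk0 : 0 < k := by rw [hk]; positivity
  have hM0 : 0 < M := by rw [hM]; positivity
  obtain ⟨D, hD⟩ : ∃ D, D = 16 / (τ ^ 2 * k) + (64 * L ^ 2 / τ ^ 2 + 2) / c₀ := ⟨_, rfl⟩
  have hD0 : 0 < D := by rw [hD]; positivity
  refine ⟨1 / c₀ + M ^ 2 * D, by positivity, ?_⟩
  intro R x₀ η F c hR hη hpos hhR hc g ψ hψ Z G hZ0 hG0 hZ hG
  have hN1 := (affine_sq_le_lintegral hd hτ hτ1 hpos hc g).trans hZ
  rw [ENNReal.ofReal_le_ofReal_iff hZ0, ← hc₀] at hN1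
  have hN2 := gradient_sq_le_energy hd hs0 hR hL hτ hη hpos hc g hG0 hG
  rw [← hk] at hN2
  obtain ⟨hE1, hE2⟩ := interp_error_le hR hL hτ hη hpos hc g ψ hψ rfl
  rw [← hM] at hE1 hE2
  set h := cellSize F with hh
  set A := gradNorm g with hA
  have hA0 : 0 ≤ A := gradNorm_nonneg g
  have hη0 := hη.nonneg c
  set m := |g c| + h * A with hm
  have hm0 : 0 ≤ m := by positivity
  set e := η c * h * A + h / R * m with he
  have he0 : 0 ≤ e := by positivity
  have hhd : 0 < h ^ d := by positivity
  have hhs : 0 < h ^ (2 * s) := by positivity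
  have hRs : 0 < R ^ (-(2 * s)) := by positivity
  have hm2 : h ^ d * m ^ 2 ≤ Z / c₀ := by
    rw [le_div_iff₀ hc₀0]; linarith
  have hlam : (h / R) ^ 2 ≤ h ^ (2 * s) * R ^ (-(2 * s)) := by
    have h1 : (h / R) ^ (2 * s) = h ^ (2 * s) * R ^ (-(2 * s)) := by
      rw [Real.div_rpow hpos.le hR.le, Real.rpow_neg hR.le, div_eq_mul_inv]
    rw [← h1, ← Real.rpow_two]
    exact Real.rpow_le_rpow_of_exponent_ge (by positivity) ((div_le_one hR).2 hhR) (by linarith)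
  have he2 : h ^ d * e ^ 2 ≤ D * (h ^ (2 * s) * (G + R ^ (-(2 * s)) * Z)) := by
    rw [hD]
    refine weighted_sq_le hτ hk0 hc₀0 hhd hhs hRs.le hZ0 hG0 ?_ hm2 hlam
    refine le_trans (le_of_eq ?_) hN2
    field_simp
  have hQ0 : 0 ≤ G + R ^ (-(2 * s)) * Z := by positivity
  have hMD : M ^ 2 * D ≤ 1 / c₀ + M ^ 2 * D := by
    have : 0 < 1 / c₀ := by positivity
    linarith
  refine ⟨?_, fun x hx => ?_, fun x hx y hy => ?_⟩
  · have h1 : (h * A) ^ 2 ≤ m ^ 2 :=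
      pow_le_pow_left₀ (by positivity) (by rw [hm]; linarith [abs_nonneg (g c)]) 2
    have h2 := mul_le_mul_of_nonneg_left h1 hhd.le
    calc h ^ 2 * h ^ d * A ^ 2 ≤ Z / c₀ := by nlinarith
      _ = 1 / c₀ * Z := by ring
      _ ≤ _ := by
          have : 0 ≤ M ^ 2 * D * Z := by positivity
          linarith
  · have h1 : (η x ^ 2 * g x - ψ x) ^ 2 ≤ (M * (h / R) * e) ^ 2 := by
      rw [← sq_abs]; exact pow_le_pow_left₀ (abs_nonneg _) (hE1 x hx) 2
    calc h ^ d * (η x ^ 2 * g x - ψ x) ^ 2 ≤ h ^ d * (M * (h / R) * e) ^ 2 := by gcongr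
      _ = M ^ 2 * (h / R) ^ 2 * (h ^ d * e ^ 2) := by ring
      _ ≤ M ^ 2 * (h / R) ^ 2 * (D * (h ^ (2 * s) * (G + R ^ (-(2 * s)) * Z))) := by gcongr
      _ = (M ^ 2 * D) * ((h / R) ^ 2 * h ^ (2 * s) * (G + R ^ (-(2 * s)) * Z)) := by ring
      _ ≤ (1 / c₀ + M ^ 2 * D) * ((h / R) ^ 2 * h ^ (2 * s) * (G + R ^ (-(2 * s)) * Z)) := by
          gcongr
      _ = _ := by ring
  · have h1 : ((η x ^ 2 * g x - ψ x) - (η y ^ 2 * g y - ψ y)) ^ 2 ≤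
        (M / R * e * ‖x - y‖) ^ 2 := by
      rw [← sq_abs]; exact pow_le_pow_left₀ (abs_nonneg _) (hE2 x hx y hy) 2
    calc R ^ 2 * h ^ d * ((η x ^ 2 * g x - ψ x) - (η y ^ 2 * g y - ψ y)) ^ 2
        ≤ R ^ 2 * h ^ d * (M / R * e * ‖x - y‖) ^ 2 := by gcongr
      _ = M ^ 2 * ‖x - y‖ ^ 2 * (h ^ d * e ^ 2) := by field_simp
      _ ≤ M ^ 2 * ‖x - y‖ ^ 2 * (D * (h ^ (2 * s) * (G + R ^ (-(2 * s)) * Z))) := by gcongr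
      _ = (M ^ 2 * D) * (h ^ (2 * s) * (G + R ^ (-(2 * s)) * Z) * ‖x - y‖ ^ 2) := by ring
      _ ≤ (1 / c₀ + M ^ 2 * D) * (h ^ (2 * s) * (G + R ^ (-(2 * s)) * Z) * ‖x - y‖ ^ 2) := by
          gcongr
      _ = _ := by ring

/-! ### Summation over the elements -/

/-- The energy and the `L²` norm of a function `e` as in `exists_near_far_le`. The energy is
obtained from that lemma with `v = e`. -/
lemma exists_error_energy_le (hd : 1 ≤ d) {s : ℝ} (hs0 : 0 < s) (hs1 : s < 1) {C₀ C₁ c : ℝ}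
    (hC₀ : 0 < C₀) (hC₁ : 0 < C₁) (hc : 0 < c) (hc1 : c ≤ 1) :
    ∃ C : ℝ, 0 < C ∧ ∀ {ι : Type} (S : Finset ι) (T : ι → Set 𝔼) (h Q : ι → ℝ) (R : ℝ)
      (e : 𝔼 → ℝ), (∀ i ∈ S, MeasurableSet (T i)) →
      (∀ i ∈ S, 0 < h i) → (∀ i ∈ S, h i ≤ R) → 0 < R →
      (∀ i ∈ S, volume (T i) ≤ ENNReal.ofReal (C₀ * h i ^ d)) →
      (∀ i ∈ S, 0 ≤ Q i) → AEStronglyMeasurable e →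
      (∀ i ∈ S, ∀ x ∈ T i, ∀ y, ‖x - y‖ < c * h i →
        R ^ 2 * h i ^ d * (e x - e y) ^ 2 ≤ C₁ * h i ^ (2 * s) * Q i * ‖x - y‖ ^ 2) →
      (∀ i ∈ S, ∀ x ∈ T i, h i ^ d * e x ^ 2 ≤ C₁ * (h i / R) ^ 2 * h i ^ (2 * s) * Q i) →
      (∀ x, (∀ i ∈ S, x ∉ T i) → e x = 0) →
      sqNorm e ≤ ENNReal.ofReal (C * R ^ (2 * s) * ∑ i ∈ S, Q i) ∧
      ∫⁻ p, ENNReal.ofReal (incr e p ^ 2) ∂gagliardoMeasure d s ≤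
        ENNReal.ofReal (C * ∑ i ∈ S, Q i) := by
  obtain ⟨K, hK, hk⟩ := exists_near_far_le (d := d) hd hs0 hs1 hC₀ hC₁ hc hc1
  refine ⟨C₀ * C₁ + (2 * K + K * (C₀ * C₁)), by positivity, ?_⟩
  intro ι S T h Q R e hT hh hhR hR hvol hQ hem he hfar hoff
  have hsum : 0 ≤ ∑ i ∈ S, Q i := Finset.sum_nonneg hQ
  have hRs : 0 < R ^ (2 * s) := by positivity
  have hpow : ∀ i ∈ S, h i ^ (2 * s) ≤ R ^ (2 * s) := fun i hi =>
    Real.rpow_le_rpow (hh i hi).le (hhR i hi) (by positivity)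
  have hlam : ∀ i ∈ S, (h i / R) ^ 2 ≤ 1 := fun i hi =>
    pow_le_one₀ (div_nonneg (hh i hi).le hR.le) ((div_le_one hR).2 (hhR i hi))
  have hL2 : sqNorm e ≤ ENNReal.ofReal (C₀ * C₁ * R ^ (2 * s) * ∑ i ∈ S, Q i) := by
    set A : ι → ℝ := fun i => C₁ * R ^ (2 * s) * Q i / h i ^ d with hA
    have hA0 : ∀ i ∈ S, 0 ≤ A i := fun i hi => by
      have := hh i hi
      have := hQ i hi
      simp only [hA]; positivity
    have hpt : ∀ x, ENNReal.ofReal (e x ^ 2) ≤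
        ∑ i ∈ S, (T i).indicator (fun _ => ENNReal.ofReal (A i)) x := by
      intro x
      by_cases hx : ∀ i ∈ S, x ∉ T i
      · simp [hoff x hx]
      push Not at hx
      obtain ⟨i, hi, hxi⟩ := hx
      refine le_trans ?_ (Finset.single_le_sum (f := fun i => (T i).indicator
        (fun _ => ENNReal.ofReal (A i)) x) (fun _ _ => zero_le) hi)
      simp only [indicator_of_mem hxi]
      refine ENNReal.ofReal_le_ofReal ?_
      simp only [hA]
      have := hh i hi
      rw [le_div_iff₀ (by positivity), mul_comm]
      refine (hfar i hi x hxi).trans ?_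
      have h1 : (h i / R) ^ 2 * h i ^ (2 * s) ≤ 1 * R ^ (2 * s) :=
        mul_le_mul (hlam i hi) (hpow i hi) (by positivity) zero_le_one
      have h2 := mul_le_mul_of_nonneg_left h1 (mul_nonneg hC₁.le (hQ i hi))
      linarith
    refine (lintegral_mono hpt).trans ?_
    rw [lintegral_finsetSum' _ fun i hi => (measurable_const.indicator (hT i hi)).aemeasurable]
    have h1 : ∀ i ∈ S, ∫⁻ x, (T i).indicator (fun _ => ENNReal.ofReal (A i)) x ≤
        ENNReal.ofReal (C₀ * C₁ * R ^ (2 * s) * Q i) := by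
      intro i hi
      rw [lintegral_indicator_const (hT i hi)]
      refine (mul_le_mul_right (hvol i hi) _).trans (le_of_eq ?_)
      rw [← ENNReal.ofReal_mul (hA0 i hi)]
      congr 1
      have : h i ^ d ≠ 0 := (pow_pos (hh i hi) d).ne'
      simp only [hA]; field_simp
    refine (Finset.sum_le_sum h1).trans (le_of_eq ?_)
    rw [← ENNReal.ofReal_sum_of_nonneg (fun i hi => mul_nonneg (by positivity) (hQ i hi)),
      Finset.mul_sum]
  constructor
  · refine hL2.trans (ENNReal.ofReal_le_ofReal ?_)
    refine mul_le_mul_of_nonneg_right (mul_le_mul_of_nonneg_right ?_ hRs.le) hsum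
    have : 0 < 2 * K + K * (C₀ * C₁) := by positivity
    linarith
  · have hmain := hk S T h (fun i => R ^ (2 * s) * Q i) Q R 1 e e one_pos hT hh hhR hR hvol
      (fun i hi => mul_nonneg hRs.le (hQ i hi)) hQ hem (fun i hi x hx y hxy => by
        have h1 := he i hi x hx y hxy
        have hhi := hh i hi
        have h2 : h i ^ 2 * h i ^ d * (e x - e y) ^ 2 =
            (h i / R) ^ 2 * (R ^ 2 * h i ^ d * (e x - e y) ^ 2) := by field_simp
        rw [h2]
        calc (h i / R) ^ 2 * (R ^ 2 * h i ^ d * (e x - e y) ^ 2)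
            ≤ 1 * (C₁ * h i ^ (2 * s) * Q i * ‖x - y‖ ^ 2) :=
              mul_le_mul (hlam i hi) h1 (by positivity) zero_le_one
          _ ≤ C₁ * R ^ (2 * s) * Q i * ‖x - y‖ ^ 2 := by
              rw [one_mul]
              have := hQ i hi
              have := hpow i hi
              gcongr
          _ = _ := by ring) he hfar hoff
    have hsq : ∀ p, |incr e p * incr e p| = incr e p ^ 2 := fun p => by
      rw [← sq, abs_of_nonneg (sq_nonneg _)]
    simp_rw [hsq] at hmain
    refine hmain.trans ?_
    have hneg : R ^ (-(2 * s)) * R ^ (2 * s) = 1 := by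
      rw [← Real.rpow_add hR]; simp
    have h2 : ENNReal.ofReal (K * 1⁻¹ * R ^ (-(2 * s))) * sqNorm e ≤
        ENNReal.ofReal (K * (C₀ * C₁) * ∑ i ∈ S, Q i) := by
      refine (mul_le_mul_right hL2 _).trans (le_of_eq ?_)
      rw [← ENNReal.ofReal_mul (by positivity)]
      congr 1
      calc K * 1⁻¹ * R ^ (-(2 * s)) * (C₀ * C₁ * R ^ (2 * s) * ∑ i ∈ S, Q i)
          = K * (C₀ * C₁) * (∑ i ∈ S, Q i) * (R ^ (-(2 * s)) * R ^ (2 * s)) := by ring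
        _ = _ := by rw [hneg, mul_one]
    refine (add_le_add le_rfl h2).trans ?_
    rw [← Finset.mul_sum, ← ENNReal.ofReal_add (by positivity) (by positivity)]
    refine ENNReal.ofReal_le_ofReal ?_
    calc K * (1 * ∑ i ∈ S, Q i + 1⁻¹ * R ^ (-(2 * s)) * (R ^ (2 * s) * ∑ i ∈ S, Q i)) +
          K * (C₀ * C₁) * ∑ i ∈ S, Q i
        = (K + K * (R ^ (-(2 * s)) * R ^ (2 * s)) + K * (C₀ * C₁)) * ∑ i ∈ S, Q i := by ring
      _ = (2 * K + K * (C₀ * C₁)) * ∑ i ∈ S, Q i := by rw [hneg]; ring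
      _ ≤ _ := by
          refine mul_le_mul_of_nonneg_right ?_ hsum
          have : 0 < C₀ * C₁ := by positivity
          linarith

open Classical in
/-- The elements that have a vertex in common with `F`. -/
noncomputable def patch {K : 𝕂} (hK : (cells K).Finite) (F : Finset 𝔼) : Finset (Finset 𝔼) :=
  hK.toFinset.filter fun G => ∃ p ∈ F, p ∈ G

lemma mem_patch {K : 𝕂} {hK : (cells K).Finite} {F G : Finset 𝔼} :
    G ∈ patch hK F ↔ G ∈ cells K ∧ ∃ p ∈ F, p ∈ G := by
  simp [patch]

/-- Patches overlap finitely often. -/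
lemma sum_patch_le (hd : 1 ≤ d) {τ : ℝ} {K : 𝕂} (hfin : (cells K).Finite)
    (hK : IsRegularMesh τ K) {S : Finset (Finset 𝔼)} (hS : ∀ F ∈ S, F ∈ cells K)
    {a : Finset 𝔼 → ℝ} (ha : ∀ G, 0 ≤ a G) :
    ∑ F ∈ S, ∑ G ∈ patch hfin F, a G ≤
      ((d + 1) * starBound d τ : ℕ) * ∑ G ∈ hfin.toFinset, a G := by
  classical
  have h1 : ∀ F ∈ S, ∑ G ∈ patch hfin F, a G =
      ∑ G ∈ hfin.toFinset, if ∃ p ∈ F, p ∈ G then a G else 0 := fun F _ => by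
    rw [← Finset.sum_filter]
    refine Finset.sum_congr ?_ fun _ _ => rfl
    ext G; simp [mem_patch]
  rw [Finset.sum_congr rfl h1, Finset.sum_comm, Finset.mul_sum]
  refine Finset.sum_le_sum fun G hG => ?_
  rw [← Finset.sum_filter, Finset.sum_const, nsmul_eq_mul]
  refine mul_le_mul_of_nonneg_right ?_ (ha G)
  have hGc : G ∈ cells K := by simpa using hG
  have hsub : S.filter (fun F => ∃ p ∈ F, p ∈ G) ⊆ G.biUnion fun p => S.filter fun F => p ∈ F := by
    intro F hF
    simp only [Finset.mem_filter, Finset.mem_biUnion] at hF ⊢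
    obtain ⟨hFS, p, hpF, hpG⟩ := hF
    exact ⟨p, hpG, hFS, hpF⟩
  have h2 : (G.biUnion fun p => S.filter fun F => p ∈ F).card ≤ G.card * starBound d τ :=
    Finset.card_biUnion_le_card_mul _ _ _ fun p _ =>
      card_star_le hd hK (fun F hF => hS F (Finset.mem_filter.1 hF).1)
        fun F hF => (Finset.mem_filter.1 hF).2
  rw [hGc.2] at h2
  exact_mod_cast (Finset.card_le_card hsub).trans h2

lemma sum_setLIntegral_hull_le {K : 𝕂} (hfin : (cells K).Finite) (f : 𝔼 → ℝ≥0∞) :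
    ∑ F ∈ hfin.toFinset, ∫⁻ x in hull F, f x ≤ ∫⁻ x, f x := by
  rw [← lintegral_biUnion_finset₀]
  · exact setLIntegral_le_lintegral _ _
  · intro F hF G hG hne
    exact aedisjoint_hull (by simpa using hF) (by simpa using hG) hne
  · exact fun F _ => (isClosed_hull F).measurableSet.nullMeasurableSet

lemma sum_setLIntegral_hull_prod_le {K : 𝕂} (hfin : (cells K).Finite) (s : ℝ)
    (f : 𝔼 × 𝔼 → ℝ≥0∞) :
    ∑ F ∈ hfin.toFinset, ∫⁻ p in hull F ×ˢ hull F, f p ∂gagliardoMeasure d s ≤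
      ∫⁻ p, f p ∂gagliardoMeasure d s := by
  rw [← lintegral_biUnion_finset₀]
  · exact setLIntegral_le_lintegral _ _
  · intro F hF G hG hne
    refine gagliardoMeasure_absolutelyContinuous s ?_
    have h := aedisjoint_hull (K := K) (F := F) (G := G) (by simpa using hF) (by simpa using hG) hne
    refine measure_mono_null (t := (hull F ∩ hull G) ×ˢ univ)
      (fun p hp => ⟨⟨hp.1.1, hp.2.1⟩, mem_univ _⟩) ?_
    rw [Measure.prod_prod, h, zero_mul]
  · exact fun F _ => ((isClosed_hull F).measurableSet.prod
      (isClosed_hull F).measurableSet).nullMeasurableSet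

/-! ### The interpolation error of `η² z` -/

lemma cellSize_le_localMeshSize {K : 𝕂} (hK : K.faces.Finite) {B : Set 𝔼} {F : Finset 𝔼}
    (hF : F ∈ cells K) (hFB : (hull F ∩ B).Nonempty) : cellSize F ≤ localMeshSize K B := by
  refine le_csSup ?_ ⟨hull F, hull_mem_elements hF, hFB, rfl⟩
  refine (((cells_finite hK).image cellSize).subset ?_).bddAbove
  rintro _ ⟨_, ⟨G, h1, h2, rfl⟩, -, rfl⟩
  exact ⟨G, ⟨h1, h2⟩, rfl⟩

lemma dist_le_cellSize {F : Finset 𝔼} {x y : 𝔼} (hx : x ∈ hull F) (hy : y ∈ hull F) :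
    dist x y ≤ cellSize F := by
  rw [dist_eq_norm]; exact norm_sub_le_diam hx hy

/-- The nodal interpolant of `η² z`. -/
noncomputable abbrev cutInterp (K : 𝕂) (η z : 𝔼 → ℝ) : 𝔼 → ℝ :=
  nodal K fun p => η p ^ 2 * z p

/-- The support of the interpolant exceeds that of `η` by at most one layer of elements, of size at
most `R / 16`. -/
lemma cutInterp_eq_zero {K : 𝕂} (hK : K.faces.Finite) {x₀ : 𝔼} {R : ℝ} (hR : 0 < R)
    (hmesh : 16 * localMeshSize K (Metric.ball x₀ R) ≤ R) {L : ℝ} {η : 𝔼 → ℝ}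
    (hη : IsCutoff L R x₀ η) (z : 𝔼 → ℝ) {x : 𝔼} (hx : x ∉ Metric.ball x₀ (7 / 8 * R)) :
    cutInterp K η z x = 0 := by
  by_cases h : ∃ F ∈ cells K, x ∈ hull F
  · obtain ⟨F, hF, hxF⟩ := h
    rw [cutInterp, nodal_eq _ hF hxF, ← abs_nonpos_iff]
    refine abs_affine_le_of_mem_hull (fun p hp => ?_) hxF
    rw [affineInterp_apply (K.indep hF.1) hF.2 _ hp]
    by_cases hpB : p ∈ Metric.ball x₀ (3 / 4 * R)
    · exfalso
      have hpF : p ∈ hull F := subset_convexHull ℝ _ hp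
      rw [Metric.mem_ball] at hpB hx
      have h1 := cellSize_le_localMeshSize hK hF
        (⟨p, hpF, Metric.mem_ball.2 (by linarith)⟩ : (hull F ∩ Metric.ball x₀ R).Nonempty)
      have h2 := dist_le_cellSize hxF hpF
      have h3 := dist_triangle x p x₀
      linarith
    · rw [hη.eq_zero p hpB]; simp
  · push Not at h
    exact nodal_eq_zero _ h

/-- The interpolant is an admissible test function. -/
lemma cutInterp_mem_feSpace {Ω : Set 𝔼} {K : 𝕂} (hT : IsTriangulation Ω K) {x₀ : 𝔼} {R : ℝ}
    (hR : 0 < R) (hB : Metric.ball x₀ R ⊆ Ω)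
    (hmesh : 16 * localMeshSize K (Metric.ball x₀ R) ≤ R) {L : ℝ} {η : 𝔼 → ℝ}
    (hη : IsCutoff L R x₀ η) (z : 𝔼 → ℝ) : cutInterp K η z ∈ feSpace Ω K := by
  have h0 : ∀ x, x ∉ Metric.ball x₀ (7 / 8 * R) → cutInterp K η z x = 0 := fun x hx =>
    cutInterp_eq_zero hT.1 hR hmesh hη z hx
  have hsub : Metric.ball x₀ (7 / 8 * R) ⊆ Ω :=
    (Metric.ball_subset_ball (by linarith)).trans hB
  refine ⟨?_, fun x hx => h0 x fun h => hx (hsub h), ?_⟩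
  · have h1 := continuousOn_nodal (cells_finite hT.1) fun p => η p ^ 2 * z p
    rw [biUnion_hull_eq hT] at h1
    have h2 : ContinuousOn (cutInterp K η z) (Metric.ball x₀ (7 / 8 * R))ᶜ :=
      continuousOn_const.congr (f := fun _ => (0 : ℝ)) fun x hx => h0 x hx
    have h3 := h1.union_of_isClosed h2 isClosed_closure Metric.isOpen_ball.isClosed_compl
    rw [← continuousOn_univ]
    refine h3.mono fun x _ => ?_
    by_cases hx : x ∈ Metric.ball x₀ (7 / 8 * R)
    · exact Or.inl (subset_closure (hsub hx))
    · exact Or.inr hx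
  · rintro _ ⟨F, h1, h2, rfl⟩
    exact ⟨affineInterp F _, fun x hx => nodal_eq _ ⟨h1, h2⟩ hx⟩

/-- The squared form of `abs_sub_le_of_near`. -/
lemma sq_sub_le_of_near (hd : 1 ≤ d) {τ : ℝ} {Ω : Set 𝔼} (hΩ : IsOpen Ω) {K : 𝕂}
    (hT : IsTriangulation Ω K) (hK : IsRegularMesh τ K) {F : Finset 𝔼} (hF : F ∈ cells K)
    (hFΩ : ∀ p ∈ F, p ∈ Ω) {x y : 𝔼} (hx : x ∈ hull F) (hseg : segment ℝ x y ⊆ closure Ω)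
    (hxy : ‖x - y‖ < τ / (sizeRatio d τ * (d + 1)) * cellSize F) {f : 𝔼 → ℝ} {A B : ℝ}
    (hA : 0 < A) (hB : 0 ≤ B)
    (hf : ∀ p ∈ F, ∀ G ∈ cells K, p ∈ G → ∀ u ∈ hull G, ∀ v ∈ hull G,
      A * (f u - f v) ^ 2 ≤ B * ‖u - v‖ ^ 2) : A * (f x - f y) ^ 2 ≤ B * ‖x - y‖ ^ 2 := by
  have key : ∀ u v : 𝔼, A * (f u - f v) ^ 2 ≤ B * ‖u - v‖ ^ 2 ↔
      |f u - f v| ≤ √(B / A) * ‖u - v‖ := by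
    intro u v
    rw [← abs_of_nonneg (by positivity : 0 ≤ √(B / A) * ‖u - v‖), ← sq_le_sq, mul_pow,
      Real.sq_sqrt (by positivity), div_mul_eq_mul_div, le_div_iff₀ hA, mul_comm]
  rw [key]
  exact abs_sub_le_of_near hd hΩ hT hK hF hFΩ hx hseg hxy fun p hp G hG hpG u hu v hv =>
    (key u v).1 (hf p hp G hG hpG u hu v hv)

/-- The superapproximation estimates: the difference of `η² z` and its nodal interpolant, for a
finite element function `z`, is controlled by the energy of `η z` and the `L²` norm of `z`. -/
lemma exists_superapproximation (hd : 1 ≤ d) {s : ℝ} (hs0 : 0 < s) (hs1 : s < 1) {τ : ℝ}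
    (hτ : 0 < τ) (hτ1 : τ ≤ 1) {L : ℝ} (hL : 0 < L) :
    ∃ C : ℝ, 0 < C ∧ ∀ {Ω : Set 𝔼} {K : 𝕂} {x₀ : 𝔼} {R : ℝ} {η z : 𝔼 → ℝ}, IsOpen Ω →
      IsTriangulation Ω K → IsRegularMesh τ K → 0 < R → Metric.ball x₀ R ⊆ Ω →
      16 * localMeshSize K (Metric.ball x₀ R) ≤ R → IsCutoff L R x₀ η → z ∈ feSpace Ω K →
      ∀ {X Z : ℝ}, 0 ≤ X → 0 ≤ Z →
      ∫⁻ p, ENNReal.ofReal (incr (fun x => η x * z x) p ^ 2) ∂gagliardoMeasure d s ≤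
        ENNReal.ofReal X → sqNorm z ≤ ENNReal.ofReal Z →
      ∀ e : 𝔼 → ℝ, (∀ x, e x = η x ^ 2 * z x - cutInterp K η z x) →
      (∀ ε, 0 < ε → ε ≤ 1 → ∫⁻ p, ENNReal.ofReal |incr z p * incr e p| ∂gagliardoMeasure d s ≤
        ENNReal.ofReal (C * (ε * X + ε⁻¹ * R ^ (-(2 * s)) * Z))) ∧
      ∫⁻ p, ENNReal.ofReal (incr e p ^ 2) ∂gagliardoMeasure d s ≤
        ENNReal.ofReal (C * (X + R ^ (-(2 * s)) * Z)) ∧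
      sqNorm e ≤ ENNReal.ofReal (C * (R ^ (2 * s) * X + Z)) := by
  obtain ⟨Ce, hCe, hel⟩ := exists_element_estimates (d := d) hd hs0 hs1 hτ hτ1 hL
  set Λ := sizeRatio d τ with hΛdef
  have hΛ : 1 ≤ Λ := one_le_pow₀ ((one_le_inv₀ hτ).2 hτ1)
  have hC₀ : 0 < unitVol d * 2 ^ d := mul_pos unitVol_pos (by positivity)
  have hC₁ : 0 < Ce * Λ ^ (d + 2) := by positivity
  have hc : 0 < τ / (Λ * (d + 1)) := by positivity
  have hc1 : τ / (Λ * (d + 1)) ≤ 1 := by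
    rw [div_le_one (by positivity)]
    have : (1 : ℝ) * 1 ≤ Λ * (d + 1) :=
      mul_le_mul hΛ (by linarith [(Nat.cast_nonneg d : (0 : ℝ) ≤ d)]) zero_le_one (by linarith)
    linarith
  obtain ⟨C₂, hC₂, hnf⟩ := exists_near_far_le (d := d) hd hs0 hs1 hC₀ hC₁ hc hc1
  obtain ⟨C₃, hC₃, hee⟩ := exists_error_energy_le (d := d) hd hs0 hs1 hC₀ hC₁ hc hc1
  obtain ⟨N, hN⟩ : ∃ N : ℝ, N = ((d + 1) * starBound d τ : ℕ) := ⟨_, rfl⟩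
  have hN0 : 0 ≤ N := by rw [hN]; positivity
  refine ⟨C₂ * (2 * N + 1) + C₃ * N, by positivity, ?_⟩
  intro Ω K x₀ R η z hΩ hT hK hR hB hmesh hη hz X Z hX hZ hXz hZz e he
  have hfin := cells_finite hT.1
  obtain ⟨hzc, hz0, hza⟩ := id hz
  have hψ := cutInterp_mem_feSpace hT hR hB hmesh hη z
  have hec : Continuous e := by
    have : e = fun x => η x ^ 2 * z x - cutInterp K η z x := funext he
    rw [this]
    exact ((hη.continuous.pow 2).mul hzc).sub hψ.1
  have hRs : 0 < R ^ (-(2 * s)) := by positivity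
  -- squared `L²` norm of `z` and energy of `η z` on single elements
  set Zc : Finset 𝔼 → ℝ := fun G => (∫⁻ x in hull G, ENNReal.ofReal (z x ^ 2)).toReal with hZc
  set Xc : Finset 𝔼 → ℝ := fun G => (∫⁻ p in hull G ×ˢ hull G,
    ENNReal.ofReal (incr (fun x => η x * z x) p ^ 2) ∂gagliardoMeasure d s).toReal with hXc
  have hZc0 : ∀ G, 0 ≤ Zc G := fun G => ENNReal.toReal_nonneg
  have hXc0 : ∀ G, 0 ≤ Xc G := fun G => ENNReal.toReal_nonneg
  have hZe : ∀ G, ENNReal.ofReal (Zc G) = ∫⁻ x in hull G, ENNReal.ofReal (z x ^ 2) := fun G =>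
    ENNReal.ofReal_toReal
      (((setLIntegral_le_lintegral _ _).trans hZz).trans_lt ENNReal.ofReal_lt_top).ne
  have hXe : ∀ G, ENNReal.ofReal (Xc G) = ∫⁻ p in hull G ×ˢ hull G,
      ENNReal.ofReal (incr (fun x => η x * z x) p ^ 2) ∂gagliardoMeasure d s := fun G =>
    ENNReal.ofReal_toReal
      (((setLIntegral_le_lintegral _ _).trans hXz).trans_lt ENNReal.ofReal_lt_top).ne
  have hZsum : ∑ G ∈ hfin.toFinset, Zc G ≤ Z := by
    rw [← ENNReal.ofReal_le_ofReal_iff hZ, ENNReal.ofReal_sum_of_nonneg fun G _ => hZc0 G,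
      Finset.sum_congr rfl fun G _ => hZe G]
    exact (sum_setLIntegral_hull_le hfin _).trans hZz
  have hXsum : ∑ G ∈ hfin.toFinset, Xc G ≤ X := by
    rw [← ENNReal.ofReal_le_ofReal_iff hX, ENNReal.ofReal_sum_of_nonneg fun G _ => hXc0 G,
      Finset.sum_congr rfl fun G _ => hXe G]
    exact (sum_setLIntegral_hull_prod_le hfin s _).trans hXz
  set q : Finset 𝔼 → ℝ := fun G => Xc G + R ^ (-(2 * s)) * Zc G with hq
  have hq0 : ∀ G, 0 ≤ q G := fun G => by
    have := hZc0 G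
    have := hXc0 G
    simp only [hq]; positivity
  -- estimates on the elements that meet `B(x₀, R)`
  have hsmall : ∀ G ∈ cells K, (hull G ∩ Metric.ball x₀ R).Nonempty → cellSize G ≤ R / 16 := by
    intro G hG hGB
    have := cellSize_le_localMeshSize hT.1 hG hGB
    linarith
  have hcell : ∀ G ∈ cells K, (hull G ∩ Metric.ball x₀ R).Nonempty →
      (∀ x ∈ hull G, ∀ y ∈ hull G,
        cellSize G ^ 2 * cellSize G ^ d * (z x - z y) ^ 2 ≤ Ce * Zc G * ‖x - y‖ ^ 2) ∧
      (∀ x ∈ hull G, cellSize G ^ d * e x ^ 2 ≤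
        Ce * (cellSize G / R) ^ 2 * cellSize G ^ (2 * s) * q G) ∧
      ∀ x ∈ hull G, ∀ y ∈ hull G, R ^ 2 * cellSize G ^ d * (e x - e y) ^ 2 ≤
        Ce * cellSize G ^ (2 * s) * q G * ‖x - y‖ ^ 2 := by
    intro G hG hGB
    have hpos := cellSize_pos hd hG.2
    obtain ⟨c, hcb⟩ := hK.exists_closedBall G hG
    obtain ⟨g, hg⟩ := hza _ (hull_mem_elements hG)
    have hGR : cellSize G ≤ R := (hsmall G hG hGB).trans (by linarith)
    obtain ⟨h1, h2, h3⟩ := hel hR hη hpos hGR hcb g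
      (affineInterp G fun p => η p ^ 2 * z p) (fun p hp => by
        rw [affineInterp_apply (K.indep hG.1) hG.2 _ hp, hg p (subset_convexHull ℝ _ hp)])
      (hZc0 G) (hXc0 G) (by
        rw [hZe]
        exact (setLIntegral_congr_fun (isClosed_hull G).measurableSet fun x hx => by
          simp only [hg x hx]).le) (by
        rw [hXe]
        refine (setLIntegral_congr_fun ((isClosed_hull G).measurableSet.prod
          (isClosed_hull G).measurableSet) fun p hp => ?_).le
        simp only [incr, hg p.1 hp.1, hg p.2 hp.2])
    have hee' : ∀ x ∈ hull G, η x ^ 2 * g x - affineInterp G (fun p => η p ^ 2 * z p) x = e x :=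
      fun x hx => by rw [he, cutInterp, nodal_eq _ hG hx, hg x hx]
    refine ⟨fun x hx y hy => ?_, fun x hx => ?_, fun x hx y hy => ?_⟩
    · rw [hg x hx, hg y hy]
      have h4 := abs_affine_sub_le g x y
      have h5 : (g x - g y) ^ 2 ≤ (gradNorm g * ‖x - y‖) ^ 2 := by
        rw [← sq_abs]; exact pow_le_pow_left₀ (abs_nonneg _) h4 2
      calc cellSize G ^ 2 * cellSize G ^ d * (g x - g y) ^ 2
          ≤ cellSize G ^ 2 * cellSize G ^ d * (gradNorm g * ‖x - y‖) ^ 2 := by gcongr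
        _ = cellSize G ^ 2 * cellSize G ^ d * gradNorm g ^ 2 * ‖x - y‖ ^ 2 := by ring
        _ ≤ _ := by gcongr
    · rw [← hee' x hx]; exact h2 x hx
    · rw [← hee' x hx, ← hee' y hy]; exact h3 x hx y hy
  -- `e` vanishes outside the elements that meet `B(x₀, 7R/8)`, and their patches meet `B(x₀, R)`
  classical
  set S := hfin.toFinset.filter fun F => (hull F ∩ Metric.ball x₀ (7 / 8 * R)).Nonempty with hS
  have hSc : ∀ F ∈ S, F ∈ cells K := fun F hF => by
    have := (Finset.mem_filter.1 hF).1
    simpa using this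
  have hSR : ∀ F ∈ S, (hull F ∩ Metric.ball x₀ R).Nonempty := fun F hF =>
    (Finset.mem_filter.1 hF).2.mono (inter_subset_inter_right _
      (Metric.ball_subset_ball (by linarith)))
  have hSB : ∀ F ∈ S, hull F ⊆ Metric.ball x₀ (15 / 16 * R) := by
    intro F hF x hx
    obtain ⟨y, hy, hyB⟩ := (Finset.mem_filter.1 hF).2
    have h1 := hsmall F (hSc F hF) (hSR F hF)
    have h2 := dist_le_cellSize hx hy
    have h3 := dist_triangle x y x₀
    rw [Metric.mem_ball] at hyB ⊢
    linarith
  have hSB' : ∀ F ∈ S, hull F ⊆ Metric.ball x₀ R := fun F hF =>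
    (hSB F hF).trans (Metric.ball_subset_ball (by linarith))
  have hvert : ∀ F ∈ S, ∀ p ∈ F, p ∈ Metric.ball x₀ R := fun F hF p hp =>
    hSB' F hF (subset_convexHull ℝ _ hp)
  have hseg : ∀ F ∈ S, ∀ x ∈ hull F, ∀ y, ‖x - y‖ < τ / (Λ * (d + 1)) * cellSize F →
      segment ℝ x y ⊆ closure Ω := by
    intro F hF x hx y hxy
    refine Subset.trans ?_ (hB.trans subset_closure)
    refine (convex_ball x₀ R).segment_subset (hSB' F hF hx) ?_
    have h1 := hsmall F (hSc F hF) (hSR F hF)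
    have h2 : ‖x - y‖ < 1 * cellSize F :=
      hxy.trans_le (mul_le_mul_of_nonneg_right hc1 Metric.diam_nonneg)
    have h3 := hSB F hF hx
    have h4 := dist_triangle y x x₀
    rw [dist_comm y x, dist_eq_norm x y] at h4
    rw [Metric.mem_ball] at h3 ⊢
    linarith
  have hnear : ∀ F ∈ S, ∀ p ∈ F, ∀ G ∈ cells K, p ∈ G → (hull G ∩ Metric.ball x₀ R).Nonempty ∧
      cellSize F ≤ Λ * cellSize G ∧ cellSize G ≤ Λ * cellSize F ∧ G ∈ patch hfin F := by
    intro F hF p hp G hG hpG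
    have hpB := hvert F hF p hp
    exact ⟨⟨p, subset_convexHull ℝ _ hpG, hpB⟩,
      cellSize_le_of_common_vertex hd hΩ hT hK (hB hpB) (hSc F hF) hp hG hpG,
      cellSize_le_of_common_vertex hd hΩ hT hK (hB hpB) hG hpG (hSc F hF) hp,
      mem_patch.2 ⟨hG, p, hp, hpG⟩⟩
  set P : Finset 𝔼 → ℝ := fun F => ∑ G ∈ patch hfin F, Zc G with hP
  set Q : Finset 𝔼 → ℝ := fun F => ∑ G ∈ patch hfin F, q G with hQ
  have hP0 : ∀ F, 0 ≤ P F := fun F => Finset.sum_nonneg fun G _ => hZc0 G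
  have hQ0 : ∀ F, 0 ≤ Q F := fun F => Finset.sum_nonneg fun G _ => hq0 G
  have hPsum : ∑ F ∈ S, P F ≤ N * Z := by
    rw [hN]
    exact (sum_patch_le hd hfin hK hSc hZc0).trans (mul_le_mul_of_nonneg_left hZsum (by positivity))
  have hQsum : ∑ F ∈ S, Q F ≤ N * (X + R ^ (-(2 * s)) * Z) := by
    rw [hN]
    refine (sum_patch_le hd hfin hK hSc hq0).trans (mul_le_mul_of_nonneg_left ?_ (by positivity))
    simp only [hq]
    rw [Finset.sum_add_distrib, ← Finset.mul_sum]
    gcongr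
  have hmeas : ∀ F ∈ S, MeasurableSet (hull F) := fun F _ => (isClosed_hull F).measurableSet
  have hpos : ∀ F ∈ S, 0 < cellSize F := fun F hF => cellSize_pos hd (hSc F hF).2
  have hleR : ∀ F ∈ S, cellSize F ≤ R := fun F hF =>
    (hsmall F (hSc F hF) (hSR F hF)).trans (by linarith)
  have hvol : ∀ F ∈ S, volume (hull F) ≤ ENNReal.ofReal (unitVol d * 2 ^ d * cellSize F ^ d) :=
    fun F hF => volume_hull_le hd (Finset.card_pos.1 (by rw [(hSc F hF).2]; lia))
  have hnearz : ∀ F ∈ S, ∀ x ∈ hull F, ∀ y, ‖x - y‖ < τ / (Λ * (d + 1)) * cellSize F →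
      cellSize F ^ 2 * cellSize F ^ d * (z x - z y) ^ 2 ≤
        Ce * Λ ^ (d + 2) * P F * ‖x - y‖ ^ 2 := by
    intro F hF x hx y hxy
    have hF0 := hpos F hF
    refine sq_sub_le_of_near hd hΩ hT hK (hSc F hF) (fun p hp => hB (hvert F hF p hp)) hx
      (hseg F hF x hx y hxy) hxy (by positivity) (mul_nonneg hC₁.le (hP0 F)) ?_
    intro p hp G hG hpG u hu v hv
    obtain ⟨hGB, h1, h2, h3⟩ := hnear F hF p hp G hG hpG
    have hG0 := cellSize_pos hd hG.2
    have h4 := (hcell G hG hGB).1 u hu v hv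
    calc cellSize F ^ 2 * cellSize F ^ d * (z u - z v) ^ 2
        ≤ (Λ * cellSize G) ^ 2 * (Λ * cellSize G) ^ d * (z u - z v) ^ 2 := by gcongr
      _ = Λ ^ (d + 2) * (cellSize G ^ 2 * cellSize G ^ d * (z u - z v) ^ 2) := by
          rw [mul_pow, mul_pow, pow_add]; ring
      _ ≤ Λ ^ (d + 2) * (Ce * Zc G * ‖u - v‖ ^ 2) := by gcongr
      _ ≤ Λ ^ (d + 2) * (Ce * P F * ‖u - v‖ ^ 2) := by
          have : Zc G ≤ P F := Finset.single_le_sum (fun G _ => hZc0 G) h3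
          gcongr
      _ = _ := by ring
  have hneare : ∀ F ∈ S, ∀ x ∈ hull F, ∀ y, ‖x - y‖ < τ / (Λ * (d + 1)) * cellSize F →
      R ^ 2 * cellSize F ^ d * (e x - e y) ^ 2 ≤
        Ce * Λ ^ (d + 2) * cellSize F ^ (2 * s) * Q F * ‖x - y‖ ^ 2 := by
    intro F hF x hx y hxy
    have hF0 := hpos F hF
    refine sq_sub_le_of_near hd hΩ hT hK (hSc F hF) (fun p hp => hB (hvert F hF p hp)) hx
      (hseg F hF x hx y hxy) hxy (by positivity)
      (mul_nonneg (by positivity) (hQ0 F)) ?_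
    intro p hp G hG hpG u hu v hv
    obtain ⟨hGB, h1, h2, h3⟩ := hnear F hF p hp G hG hpG
    have hG0 := cellSize_pos hd hG.2
    have h4 := (hcell G hG hGB).2.2 u hu v hv
    have h5 : cellSize G ^ (2 * s) ≤ Λ ^ 2 * cellSize F ^ (2 * s) := by
      calc cellSize G ^ (2 * s) ≤ (Λ * cellSize F) ^ (2 * s) :=
            Real.rpow_le_rpow hG0.le h2 (by positivity)
        _ = Λ ^ (2 * s) * cellSize F ^ (2 * s) := Real.mul_rpow (by linarith) hF0.le
        _ ≤ Λ ^ (2 : ℝ) * cellSize F ^ (2 * s) := by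
            gcongr
            linarith
        _ = _ := by rw [Real.rpow_two]
    have h6 : q G ≤ Q F := Finset.single_le_sum (fun G _ => hq0 G) h3
    have := hq0 G
    have := hQ0 F
    calc R ^ 2 * cellSize F ^ d * (e u - e v) ^ 2
        ≤ R ^ 2 * (Λ * cellSize G) ^ d * (e u - e v) ^ 2 := by gcongr
      _ = Λ ^ d * (R ^ 2 * cellSize G ^ d * (e u - e v) ^ 2) := by rw [mul_pow]; ring
      _ ≤ Λ ^ d * (Ce * cellSize G ^ (2 * s) * q G * ‖u - v‖ ^ 2) := by gcongr
      _ ≤ Λ ^ d * (Ce * (Λ ^ 2 * cellSize F ^ (2 * s)) * Q F * ‖u - v‖ ^ 2) := by gcongr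
      _ = _ := by rw [pow_add]; ring
  have hfar : ∀ F ∈ S, ∀ x ∈ hull F, cellSize F ^ d * e x ^ 2 ≤
      Ce * Λ ^ (d + 2) * (cellSize F / R) ^ 2 * cellSize F ^ (2 * s) * Q F := by
    intro F hF x hx
    have hF0 := hpos F hF
    obtain ⟨p, hp⟩ : F.Nonempty := Finset.card_pos.1 (by rw [(hSc F hF).2]; lia)
    have h3 := (hnear F hF p hp F (hSc F hF) hp).2.2.2
    have h6 : q F ≤ Q F := Finset.single_le_sum (fun G _ => hq0 G) h3
    have h7 : Ce * 1 ≤ Ce * Λ ^ (d + 2) := mul_le_mul_of_nonneg_left (one_le_pow₀ hΛ) hCe.le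
    rw [mul_one] at h7
    refine ((hcell F (hSc F hF) (hSR F hF)).2.1 x hx).trans ?_
    have := hq0 F
    gcongr
  have hoff : ∀ x, (∀ F ∈ S, x ∉ hull F) → e x = 0 := by
    intro x hx
    by_cases hxB : x ∈ Metric.ball x₀ (7 / 8 * R)
    · exfalso
      obtain ⟨F, hF, hxF⟩ := exists_cell_of_mem hT
        (subset_closure (hB (Metric.ball_subset_ball (by linarith) hxB)))
      exact hx F (Finset.mem_filter.2 ⟨by simpa using hF, x, hxF, hxB⟩) hxF
    · have h1 : η x = 0 := hη.eq_zero x fun h => hxB (Metric.ball_subset_ball (by linarith) h)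
      rw [he, cutInterp_eq_zero hT.1 hR hmesh hη z hxB, h1]; simp
  obtain ⟨hL2, hen⟩ := hee S hull cellSize Q R e hmeas hpos hleR hR hvol (fun F _ => hQ0 F)
    hec.aestronglyMeasurable hneare hfar hoff
  refine ⟨fun ε hε hε1 => ?_, hen.trans ?_, hL2.trans ?_⟩
  · refine (hnf S hull cellSize P Q R ε z e hε hmeas hpos hleR hR hvol (fun F _ => hP0 F)
      (fun F _ => hQ0 F) hzc.aestronglyMeasurable hnearz hneare hfar hoff).trans ?_
    refine (add_le_add le_rfl (mul_le_mul_right hZz _)).trans ?_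
    have hP1 : 0 ≤ ∑ F ∈ S, P F := Finset.sum_nonneg fun F _ => hP0 F
    have hQ1 : 0 ≤ ∑ F ∈ S, Q F := Finset.sum_nonneg fun F _ => hQ0 F
    rw [← ENNReal.ofReal_mul (by positivity), ← ENNReal.ofReal_add (by positivity) (by positivity)]
    refine ENNReal.ofReal_le_ofReal ?_
    have hεi : ε ≤ ε⁻¹ := hε1.trans ((one_le_inv₀ hε).2 hε1)
    have hW : 0 ≤ R ^ (-(2 * s)) * Z := by positivity
    calc C₂ * (ε * ∑ F ∈ S, Q F + ε⁻¹ * R ^ (-(2 * s)) * ∑ F ∈ S, P F) +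
          C₂ * ε⁻¹ * R ^ (-(2 * s)) * Z
        ≤ C₂ * (ε * (N * (X + R ^ (-(2 * s)) * Z)) + ε⁻¹ * R ^ (-(2 * s)) * (N * Z)) +
          C₂ * ε⁻¹ * R ^ (-(2 * s)) * Z := by gcongr
      _ = C₂ * N * (ε * X) + C₂ * N * (ε * (R ^ (-(2 * s)) * Z)) +
          C₂ * (N + 1) * (ε⁻¹ * (R ^ (-(2 * s)) * Z)) := by ring
      _ ≤ C₂ * N * (ε * X) + C₂ * N * (ε⁻¹ * (R ^ (-(2 * s)) * Z)) +
          C₂ * (N + 1) * (ε⁻¹ * (R ^ (-(2 * s)) * Z)) := by gcongr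
      _ ≤ C₂ * N * (ε * X) + C₂ * N * (ε⁻¹ * (R ^ (-(2 * s)) * Z)) +
          C₂ * (N + 1) * (ε⁻¹ * (R ^ (-(2 * s)) * Z)) + (C₂ * (N + 1) + C₃ * N) * (ε * X) +
          C₃ * N * (ε⁻¹ * (R ^ (-(2 * s)) * Z)) := by
          have : 0 ≤ (C₂ * (N + 1) + C₃ * N) * (ε * X) := by positivity
          have : 0 ≤ C₃ * N * (ε⁻¹ * (R ^ (-(2 * s)) * Z)) := by positivity
          linarith
      _ = _ := by ring
  · refine ENNReal.ofReal_le_ofReal ?_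
    have hW : 0 ≤ X + R ^ (-(2 * s)) * Z := by positivity
    calc C₃ * ∑ F ∈ S, Q F ≤ C₃ * (N * (X + R ^ (-(2 * s)) * Z)) := by gcongr
      _ = (C₃ * N) * (X + R ^ (-(2 * s)) * Z) := by ring
      _ ≤ _ := by
          refine mul_le_mul_of_nonneg_right ?_ hW
          have : 0 ≤ C₂ * (2 * N + 1) := by positivity
          linarith
  · refine ENNReal.ofReal_le_ofReal ?_
    have hneg : R ^ (2 * s) * R ^ (-(2 * s)) = 1 := by
      rw [← Real.rpow_add hR]; simp
    calc C₃ * R ^ (2 * s) * ∑ F ∈ S, Q F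
        ≤ C₃ * R ^ (2 * s) * (N * (X + R ^ (-(2 * s)) * Z)) := by gcongr
      _ = (C₃ * N) * (R ^ (2 * s) * X + R ^ (2 * s) * R ^ (-(2 * s)) * Z) := by ring
      _ = (C₃ * N) * (R ^ (2 * s) * X + Z) := by rw [hneg, one_mul]
      _ ≤ _ := by
          refine mul_le_mul_of_nonneg_right ?_ (by positivity)
          have : 0 ≤ C₂ * (2 * N + 1) := by positivity
          linarith

/-! ### The local energy estimate -/

lemma ofReal_add_sq_le (a b : ℝ) :
    ENNReal.ofReal ((a + b) ^ 2) ≤ 2 * ENNReal.ofReal (a ^ 2) + 2 * ENNReal.ofReal (b ^ 2) := by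
  have e2 : ∀ t : ℝ≥0∞, 2 * t = ENNReal.ofReal 2 * t := fun t => by simp
  rw [e2, e2, ← ENNReal.ofReal_mul (by norm_num), ← ENNReal.ofReal_mul (by norm_num),
    ← ENNReal.ofReal_add (by positivity) (by positivity)]
  exact ENNReal.ofReal_le_ofReal (by nlinarith [sq_nonneg (a - b)])

lemma sqNorm_sub_le {v w : 𝔼 → ℝ} (hv : AEStronglyMeasurable v) :
    sqNorm (v - w) ≤ 2 * sqNorm v + 2 * sqNorm w := by
  rw [sqNorm, sqNorm, sqNorm, ← lintegral_const_mul' _ _ (by simp),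
    ← lintegral_const_mul' _ _ (by simp),
    ← lintegral_add_left' ((hv.aemeasurable.pow_const 2).ennreal_ofReal.const_mul 2)]
  refine lintegral_mono fun x => ?_
  have := ofReal_add_sq_le (v x) (-w x)
  rw [neg_sq] at this
  simpa [sub_eq_add_neg] using this

lemma lintegral_sq_incr_sub_le (s : ℝ) {v w : 𝔼 → ℝ} (hv : AEStronglyMeasurable v) :
    ∫⁻ p, ENNReal.ofReal (incr (v - w) p ^ 2) ∂gagliardoMeasure d s ≤
      2 * ∫⁻ p, ENNReal.ofReal (incr v p ^ 2) ∂gagliardoMeasure d s +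
        2 * ∫⁻ p, ENNReal.ofReal (incr w p ^ 2) ∂gagliardoMeasure d s := by
  rw [← lintegral_const_mul' _ _ (by simp), ← lintegral_const_mul' _ _ (by simp),
    ← lintegral_add_left' ((aemeasurable_sq_incr s hv).const_mul 2)]
  refine lintegral_mono fun p => ?_
  have := ofReal_add_sq_le (incr v p) (-incr w p)
  rw [neg_sq] at this
  refine le_trans (le_of_eq ?_) this
  congr 2
  simp only [incr, Pi.sub_apply]; ring

lemma sqNorm_lt_top {v : 𝔼 → ℝ} (hv : MemLp v 2 volume) : sqNorm v < ⊤ := by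
  have h := ((memLp_two_iff_integrable_sq hv.1).1 hv).2
  rwa [hasFiniteIntegral_iff_ofReal (Filter.Eventually.of_forall fun x => sq_nonneg _)] at h

lemma integral_le_of_lintegral_abs_le {α : Type*} [MeasurableSpace α] {μ : Measure α}
    {f : α → ℝ} {b : ℝ} (hb : 0 ≤ b)
    (h : ∫⁻ x, ENNReal.ofReal |f x| ∂μ ≤ ENNReal.ofReal b) : ∫ x, f x ∂μ ≤ b := by
  have h1 := norm_integral_le_lintegral_norm (μ := μ) f
  refine (le_abs_self _).trans (h1.trans ?_)
  exact ENNReal.toReal_le_of_le_ofReal hb h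

lemma IsCutoff.abs_sub_le_min {L R : ℝ} {x₀ : 𝔼} {η : 𝔼 → ℝ} (hη : IsCutoff L R x₀ η)
    (hR : 0 < R) (x y : 𝔼) : |η x - η y| ≤ max L 1 * min (‖x - y‖ / R) 1 := by
  rcases le_total (‖x - y‖ / R) 1 with h | h
  · rw [min_eq_left h]
    refine (hη.lipschitz x y).trans ?_
    rw [div_mul_eq_mul_div, mul_div_assoc]
    exact mul_le_mul_of_nonneg_right (le_max_left _ _) (by positivity)
  · rw [min_eq_right h, mul_one]
    refine le_trans ?_ (le_max_right _ _)
    rw [abs_le]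
    constructor <;> linarith [hη.nonneg x, hη.nonneg y, hη.le_one x, hη.le_one y]

/-- A discrete Caccioppoli inequality: the energy of a finite element function near the centre of a
ball is controlled by the `L²` norm and by any function `w` with the same form against all finite
element functions. -/
lemma exists_caccioppoli (hd : 1 ≤ d) {s : ℝ} (hs0 : 0 < s) (hs1 : s < 1) {τ : ℝ}
    (hτ : 0 < τ) (hτ1 : τ ≤ 1) :
    ∃ C : ℝ, 0 < C ∧ ∀ {Ω : Set 𝔼} {K : 𝕂} {x₀ : 𝔼} {R : ℝ} {z w : 𝔼 → ℝ}, IsOpen Ω →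
      Bornology.IsBounded Ω → IsTriangulation Ω K → IsRegularMesh τ K → 0 < R →
      Metric.ball x₀ R ⊆ Ω → 16 * localMeshSize K (Metric.ball x₀ R) ≤ R → z ∈ feSpace Ω K →
      MemLp w 2 volume → gagliardoEnergy s univ w < ⊤ →
      (∀ χ ∈ feSpace Ω K, ∫ p, incr z p * incr χ p ∂gagliardoMeasure d s =
        ∫ p, incr w p * incr χ p ∂gagliardoMeasure d s) →
      gagliardoEnergy s (Metric.ball x₀ (R / 2)) z ≤
        ENNReal.ofReal C * (gagliardoEnergy s (Metric.ball x₀ R) w +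
          ENNReal.ofReal (R ^ (-(2 * s))) * (sqNorm w + sqNorm z)) := by
  obtain ⟨L, hL, hcut⟩ := exists_cutoff (d := d)
  obtain ⟨C₁, hC₁, hmul⟩ := exists_energy_mul_le (d := d) hd hs0 hs1
  obtain ⟨C₂, hC₂, hsuper⟩ := exists_superapproximation (d := d) hd hs0 hs1 hτ hτ1 hL
  obtain ⟨C₃, hC₃, hcomm⟩ := exists_commutator_le (d := d) hd hs0 hs1
  obtain ⟨C₄, hC₄, hloc⟩ := exists_localized_form_le (d := d) hd hs0 hs1
  obtain ⟨M, hM⟩ : ∃ M, M = max L 1 := ⟨_, rfl⟩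
  have hM0 : 0 < M := by rw [hM]; positivity
  obtain ⟨C₆, hC₆⟩ : ∃ C₆, C₆ = 4 + 2 * (C₁ * M ^ 2) + 2 * C₂ + C₄ * (2 + 2 * C₂) := ⟨_, rfl⟩
  have hC₆0 : 0 < C₆ := by rw [hC₆]; positivity
  obtain ⟨ε, hε⟩ : ∃ ε, ε = 1 / (2 * (C₂ + C₆) + 1) := ⟨_, rfl⟩
  have hε0 : 0 < ε := by rw [hε]; positivity
  have hε1 : ε ≤ 1 := by
    rw [hε, div_le_one (by positivity)]
    linarith
  have habs : ε * (C₂ + C₆) ≤ 1 / 2 := by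
    rw [hε, div_mul_eq_mul_div, div_le_div_iff₀ (by positivity) (by norm_num)]
    linarith
  obtain ⟨C₇, hC₇⟩ : ∃ C₇, C₇ = C₂ * ε⁻¹ + C₃ * M ^ 2 + ε * C₆ + ε⁻¹ + C₄ * ε⁻¹ := ⟨_, rfl⟩
  have hC₇0 : 0 < C₇ := by rw [hC₇]; positivity
  refine ⟨2 * C₇, by positivity, ?_⟩
  intro Ω K x₀ R z w hΩ hΩb hT hK hR hB hmesh hz hw hwE hgal
  obtain ⟨η, hη⟩ := hcut R hR x₀
  have hηM : ∀ x y, |η x - η y| ≤ M * min (‖x - y‖ / R) 1 := by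
    rw [hM]; exact hη.abs_sub_le_min hR
  have hη1 : ∀ x, |η x| ≤ 1 := fun x => by rw [abs_of_nonneg (hη.nonneg x)]; exact hη.le_one x
  have hRs : 0 < R ^ (-(2 * s)) := by positivity
  have hneg : R ^ (-(2 * s)) * R ^ (2 * s) = 1 := by rw [← Real.rpow_add hR]; simp
  set ρ := R ^ (-(2 * s)) with hρ
  obtain ⟨hzL, hzE, -⟩ := mem_fracSobolevZero_of_mem_feSpace hd hs0 hs1 hΩ hΩb hT hz
  have hzc : Continuous z := hz.1
  have hzm : AEStronglyMeasurable z := hzc.aestronglyMeasurable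
  set g : 𝔼 → ℝ := fun x => η x * z x with hg
  have hgc : Continuous g := hη.continuous.mul hzc
  have hgm : AEStronglyMeasurable g := hgc.aestronglyMeasurable
  have hψ := cutInterp_mem_feSpace hT hR hB hmesh hη z
  set ψ := cutInterp K η z with hψdef
  obtain ⟨hψL, hψE, -⟩ := mem_fracSobolevZero_of_mem_feSpace hd hs0 hs1 hΩ hΩb hT hψ
  set h : 𝔼 → ℝ := fun x => η x * g x with hh
  have hhm : AEStronglyMeasurable h := (hη.continuous.mul hgc).aestronglyMeasurable
  set e : 𝔼 → ℝ := fun x => η x ^ 2 * z x - ψ x with he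
  have hem : AEStronglyMeasurable e :=
    (((hη.continuous.pow 2).mul hzc).sub hψ.1).aestronglyMeasurable
  have hψe : ψ = h - e := by
    ext x; simp only [he, hh, hg, Pi.sub_apply]; ring
  -- all quantities are finite, so that the energy `X` of `η z` can be absorbed at the end
  have hZtop : sqNorm z < ⊤ := sqNorm_lt_top hzL
  have hWtop : sqNorm w < ⊤ := sqNorm_lt_top hw
  have hEtop : gagliardoEnergy s (Metric.ball x₀ R) w < ⊤ := by
    refine lt_of_le_of_lt ?_ hwE
    rw [gagliardoEnergy_univ_eq s hw.1, gagliardoEnergy_eq s measurableSet_ball hw.1]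
    exact setLIntegral_le_lintegral _ _
  have hXtop : ∫⁻ p, ENNReal.ofReal (incr g p ^ 2) ∂gagliardoMeasure d s < ⊤ := by
    refine (hmul R hR M η z hzm hη1 hηM).trans_lt ?_
    rw [← gagliardoEnergy_univ_eq s hzm]
    exact ENNReal.add_lt_top.2 ⟨ENNReal.mul_lt_top (by simp) hzE,
      ENNReal.mul_lt_top ENNReal.ofReal_lt_top hZtop⟩
  set X := (∫⁻ p, ENNReal.ofReal (incr g p ^ 2) ∂gagliardoMeasure d s).toReal with hX
  set Z := (sqNorm z).toReal with hZ
  set W := (sqNorm w).toReal with hW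
  set E := (gagliardoEnergy s (Metric.ball x₀ R) w).toReal with hE
  have hX0 : 0 ≤ X := ENNReal.toReal_nonneg
  have hZ0 : 0 ≤ Z := ENNReal.toReal_nonneg
  have hW0 : 0 ≤ W := ENNReal.toReal_nonneg
  have hE0 : 0 ≤ E := ENNReal.toReal_nonneg
  have hXe : ∫⁻ p, ENNReal.ofReal (incr g p ^ 2) ∂gagliardoMeasure d s = ENNReal.ofReal X :=
    (ENNReal.ofReal_toReal hXtop.ne).symm
  have hZe : sqNorm z = ENNReal.ofReal Z := (ENNReal.ofReal_toReal hZtop.ne).symm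
  have hWe : sqNorm w = ENNReal.ofReal W := (ENNReal.ofReal_toReal hWtop.ne).symm
  have hEe : gagliardoEnergy s (Metric.ball x₀ R) w = ENNReal.ofReal E :=
    (ENNReal.ofReal_toReal hEtop.ne).symm
  obtain ⟨hs1', hs2, hs3⟩ := hsuper hΩ hT hK hR hB hmesh hη hz hX0 hZ0 hXe.le hZe.le e
    fun x => rfl
  have hs1'' := hs1' ε hε0 hε1
  -- norms of the interpolant `ψ = η (η z) - e`
  have hmulc : ∀ v : 𝔼 → ℝ, (∀ x, |v x| ≤ |z x|) → sqNorm v ≤ ENNReal.ofReal Z := fun v hv => by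
    rw [← hZe]
    exact lintegral_mono fun x => ENNReal.ofReal_le_ofReal (sq_le_sq.2 (hv x))
  have hgZ : ∀ x, |g x| ≤ |z x| := fun x => by
    rw [hg, abs_mul]; exact mul_le_of_le_one_left (abs_nonneg _) (hη1 x)
  have hhZ : ∀ x, |h x| ≤ |z x| := fun x => by
    rw [hh, abs_mul]; exact (mul_le_of_le_one_left (abs_nonneg _) (hη1 x)).trans (hgZ x)
  have hhE : ∫⁻ p, ENNReal.ofReal (incr h p ^ 2) ∂gagliardoMeasure d s ≤
      ENNReal.ofReal (2 * X + C₁ * M ^ 2 * ρ * Z) := by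
    refine (hmul R hR M η g hgm hη1 hηM).trans ?_
    rw [hXe, ENNReal.ofReal_add (by positivity) (by positivity),
      ENNReal.ofReal_mul (by norm_num : (0 : ℝ) ≤ 2), ENNReal.ofReal_mul (by positivity) (q := Z)]
    refine add_le_add (le_of_eq (by simp)) ?_
    exact mul_le_mul_right (hmulc g hgZ) _
  have hψE2 : ∫⁻ p, ENNReal.ofReal (incr ψ p ^ 2) ∂gagliardoMeasure d s ≤
      ENNReal.ofReal (2 * (2 * X + C₁ * M ^ 2 * ρ * Z) + 2 * (C₂ * (X + ρ * Z))) := by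
    rw [hψe]
    refine (lintegral_sq_incr_sub_le s hhm).trans ?_
    rw [ENNReal.ofReal_add (by positivity) (by positivity),
      ENNReal.ofReal_mul (by norm_num : (0 : ℝ) ≤ 2), ENNReal.ofReal_mul (by norm_num : (0 : ℝ) ≤ 2),
      ENNReal.ofReal_ofNat]
    gcongr
  have hψZ : sqNorm ψ ≤ ENNReal.ofReal (2 * Z + 2 * (C₂ * (R ^ (2 * s) * X + Z))) := by
    rw [hψe]
    refine (sqNorm_sub_le hhm).trans ?_
    rw [ENNReal.ofReal_add (by positivity) (by positivity),
      ENNReal.ofReal_mul (by norm_num : (0 : ℝ) ≤ 2), ENNReal.ofReal_mul (by norm_num : (0 : ℝ) ≤ 2),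
      ENNReal.ofReal_ofNat]
    have := hmulc h hhZ
    gcongr
  -- bounds for the three terms on the right of the identity `hsum` below
  have hI1 : ∫ p, incr z p * incr e p ∂gagliardoMeasure d s ≤ C₂ * (ε * X + ε⁻¹ * ρ * Z) :=
    integral_le_of_lintegral_abs_le (by positivity) hs1''
  have hI3 : ∫ p, z p.1 * z p.2 * incr η p ^ 2 ∂gagliardoMeasure d s ≤ C₃ * M ^ 2 * ρ * Z := by
    refine integral_le_of_lintegral_abs_le (by positivity) ?_
    have := hcomm R hR M η z hzm hηM
    rw [hZe, ← ENNReal.ofReal_mul (by positivity)] at this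
    refine le_trans (le_of_eq (lintegral_congr fun p => ?_)) this
    rw [abs_mul, abs_of_nonneg (sq_nonneg (incr η p))]
  have hI2 : ∫ p, incr w p * incr ψ p ∂gagliardoMeasure d s ≤
      ε * (C₆ * (X + ρ * Z)) + ε⁻¹ * E + C₄ * ε⁻¹ * ρ * W := by
    refine integral_le_of_lintegral_abs_le (by positivity) ?_
    refine (hloc R hR ε hε0 x₀ w ψ hw.1 hψ.1.aestronglyMeasurable fun x hx =>
      cutInterp_eq_zero hT.1 hR hmesh hη z hx).trans ?_
    rw [hEe, hWe]
    refine (add_le_add (add_le_add (mul_le_mul_right hψE2 _) le_rfl)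
      (add_le_add (mul_le_mul_right hψZ _) le_rfl)).trans ?_
    rw [← ENNReal.ofReal_mul (by positivity), ← ENNReal.ofReal_mul (by positivity),
      ← ENNReal.ofReal_mul (by positivity), ← ENNReal.ofReal_mul (by positivity),
      ← ENNReal.ofReal_add (by positivity) (by positivity),
      ← ENNReal.ofReal_add (by positivity) (by positivity),
      ← ENNReal.ofReal_add (by positivity) (by positivity)]
    refine ENNReal.ofReal_le_ofReal ?_
    have e1 : C₄ * ε * ρ * (2 * Z + 2 * (C₂ * (R ^ (2 * s) * X + Z))) =
        ε * (C₄ * (2 * (ρ * Z) + 2 * C₂ * ((ρ * R ^ (2 * s)) * X + ρ * Z))) := by ring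
    rw [e1, hneg, one_mul, hC₆]
    have p1 : 0 ≤ ε * (C₁ * M ^ 2 * X) := by positivity
    have p2 : 0 ≤ ε * (ρ * Z) := by positivity
    have p3 : 0 ≤ ε * (C₄ * X) := by positivity
    nlinarith
  -- `(δ(η z))² = δz δe + δz δψ + z(x) z(y) (δη)²`, and `z` may be replaced by `w` in `δz δψ`
  have hid : X ≤ C₂ * (ε * X + ε⁻¹ * ρ * Z) +
      (ε * (C₆ * (X + ρ * Z)) + ε⁻¹ * E + C₄ * ε⁻¹ * ρ * W) + C₃ * M ^ 2 * ρ * Z := by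
    have hmz := memLp_incr s hzm hzE
    have hmψ := memLp_incr s hψ.1.aestronglyMeasurable hψE
    have hme := memLp_incr s hem (by
      rw [gagliardoEnergy_univ_eq s hem]; exact hs2.trans_lt ENNReal.ofReal_lt_top)
    have hmg := memLp_incr s hgm (by rw [gagliardoEnergy_univ_eq s hgm]; exact hXtop)
    have i1 : Integrable (fun p => incr z p * incr e p) (gagliardoMeasure d s) :=
      hmz.integrable_mul hme
    have i2 : Integrable (fun p => incr z p * incr ψ p) (gagliardoMeasure d s) :=
      hmz.integrable_mul hmψ
    have i3 := hmg.integrable_sq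
    have hpt : ∀ p : 𝔼 × 𝔼, z p.1 * z p.2 * incr η p ^ 2 =
        incr g p ^ 2 - incr z p * incr e p - incr z p * incr ψ p := by
      intro p; simp only [incr, hg, he]; ring
    have hXi : X = ∫ p, incr g p ^ 2 ∂gagliardoMeasure d s := by
      rw [integral_eq_lintegral_of_nonneg_ae (Filter.Eventually.of_forall fun p => sq_nonneg _) i3.1]
    have hsum : X = ∫ p, incr z p * incr e p ∂gagliardoMeasure d s +
        ∫ p, incr w p * incr ψ p ∂gagliardoMeasure d s +
        ∫ p, z p.1 * z p.2 * incr η p ^ 2 ∂gagliardoMeasure d s := by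
      have e1 : ∫ p, z p.1 * z p.2 * incr η p ^ 2 ∂gagliardoMeasure d s =
          X - ∫ p, incr z p * incr e p ∂gagliardoMeasure d s -
            ∫ p, incr z p * incr ψ p ∂gagliardoMeasure d s := by
        have i4 : Integrable (fun p => incr g p ^ 2 - incr z p * incr e p)
            (gagliardoMeasure d s) := i3.sub i1
        rw [hXi, ← integral_sub i3 i1, ← integral_sub i4 i2]
        exact integral_congr_ae (Filter.Eventually.of_forall hpt)
      rw [e1, hgal ψ hψ]; ring
    linarith [hsum]
  have hfinal : X ≤ 2 * C₇ * (E + ρ * (W + Z)) := by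
    have p0 := mul_le_mul_of_nonneg_right habs hX0
    have hρZ : 0 ≤ ρ * Z := by positivity
    have hρW : 0 ≤ ρ * W := by positivity
    have k1 : X ≤ 2 * ((C₂ * ε⁻¹ + C₃ * M ^ 2 + ε * C₆) * (ρ * Z) + ε⁻¹ * E +
        C₄ * ε⁻¹ * (ρ * W)) := by linarith
    have k2 : (C₂ * ε⁻¹ + C₃ * M ^ 2 + ε * C₆) * (ρ * Z) ≤ C₇ * (ρ * Z) := by
      refine mul_le_mul_of_nonneg_right ?_ hρZ
      have : 0 < ε⁻¹ + C₄ * ε⁻¹ := by positivity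
      rw [hC₇]; linarith
    have k3 : ε⁻¹ * E ≤ C₇ * E := by
      refine mul_le_mul_of_nonneg_right ?_ hE0
      have : 0 < C₂ * ε⁻¹ + C₃ * M ^ 2 + ε * C₆ + C₄ * ε⁻¹ := by positivity
      rw [hC₇]; linarith
    have k4 : C₄ * ε⁻¹ * (ρ * W) ≤ C₇ * (ρ * W) := by
      refine mul_le_mul_of_nonneg_right ?_ hρW
      have : 0 < C₂ * ε⁻¹ + C₃ * M ^ 2 + ε * C₆ + ε⁻¹ := by positivity
      rw [hC₇]; linarith
    linarith
  have hlocal : gagliardoEnergy s (Metric.ball x₀ (R / 2)) z ≤ ENNReal.ofReal X := by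
    rw [← hXe, gagliardoEnergy_eq s measurableSet_ball hzm]
    refine le_trans (le_of_eq ?_) (setLIntegral_le_lintegral
      (Metric.ball x₀ (R / 2) ×ˢ Metric.ball x₀ (R / 2)) _)
    refine setLIntegral_congr_fun (measurableSet_ball.prod measurableSet_ball) fun p hp => ?_
    simp only [incr, hg, hη.eq_one _ hp.1, hη.eq_one _ hp.2, one_mul]
  refine (hlocal.trans (ENNReal.ofReal_le_ofReal hfinal)).trans (le_of_eq ?_)
  rw [hEe, hWe, hZe, ← ENNReal.ofReal_add hW0 hZ0, ← ENNReal.ofReal_mul hRs.le,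
    ← ENNReal.ofReal_add hE0 (by positivity), ← ENNReal.ofReal_mul (by positivity)]

lemma gagliardoEnergy_mono (s : ℝ) {D D' : Set 𝔼} (h : D ⊆ D') (v : 𝔼 → ℝ) :
    gagliardoEnergy s D v ≤ gagliardoEnergy s D' v :=
  (lintegral_mono fun _ => lintegral_mono_set h).trans (lintegral_mono_set h)

lemma l2Norm_eq {D : Set 𝔼} (hD : MeasurableSet D) {v : 𝔼 → ℝ} (hv : ∀ᵐ x, x ∉ D → v x = 0) :
    l2Norm D v = sqNorm v ^ (1 / 2 : ℝ) := by
  have h1 : ∫⁻ x in D, ENNReal.ofReal (v x ^ 2) = sqNorm v := by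
    rw [sqNorm, ← lintegral_indicator hD]
    refine lintegral_congr_ae ?_
    filter_upwards [hv] with x hx
    by_cases h : x ∈ D
    · rw [indicator_of_mem h]
    · rw [indicator_of_notMem h, hx h]; simp
  rw [l2Norm, eLpNorm_eq_lintegral_rpow_enorm_toReal two_ne_zero ENNReal.ofNat_ne_top, ← h1]
  simp only [ENNReal.toReal_ofNat]
  congr 1
  refine lintegral_congr fun x => ?_
  rw [← ofReal_norm, ENNReal.ofReal_rpow_of_nonneg (norm_nonneg _) (by norm_num),
    Real.rpow_two, Real.norm_eq_abs, sq_abs]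

lemma fracConst_pos (hd : 1 ≤ d) {s : ℝ} (hs0 : 0 < s) (hs1 : s < 1) : 0 < fracConst d s := by
  have hd' : (1 : ℝ) ≤ d := by exact_mod_cast hd
  have g1 : 0 < Real.Gamma (s + d / 2) := Real.Gamma_pos_of_pos (by positivity)
  have g2 : 0 < Real.Gamma (1 - s) := Real.Gamma_pos_of_pos (by linarith)
  unfold fracConst
  positivity

end LocalError

theorem corollary5p4 (d : ℕ) (hd : 1 ≤ d) (s : ℝ) (hs0 : 0 < s) (hs1 : s < 1) (σ : ℝ) :
    ∃ C : ℝ≥0,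
      ∀ (Ω : Set (EuclideanSpace ℝ (Fin d))), IsOpen Ω → Bornology.IsBounded Ω →
        volume (frontier Ω) = 0 →
      ∀ K : Geometry.SimplicialComplex ℝ (EuclideanSpace ℝ (Fin d)),
        IsTriangulation Ω K → IsShapeRegular σ K →
      ∀ f : fracSobolevZero s Ω →ₗ[ℝ] ℝ, IsDualElement f →
      ∀ u : EuclideanSpace ℝ (Fin d) → ℝ, IsWeakSolution f u →
      ∀ uh : EuclideanSpace ℝ (Fin d) → ℝ, IsGalerkinSolution K f uh →
      ∀ (x₀ : EuclideanSpace ℝ (Fin d)) (R : ℝ), 0 < R → Metric.ball x₀ R ⊆ Ω →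
        16 * localMeshSize K (Metric.ball x₀ R) ≤ R →
        fracSeminorm s (Metric.ball x₀ (R / 2)) (u - uh) ≤
          C * (⨅ vh ∈ feSpace Ω K,
              (fracSeminorm s (Metric.ball x₀ R) (u - vh) +
                ENNReal.ofReal (R ^ (-s)) * l2Norm Ω (u - vh))) +
            C * ENNReal.ofReal (R ^ (-s)) * l2Norm Ω (u - uh) := by
  have hτ : 0 < 1 / (4 * max σ 1) := by positivity
  have hτ1 : 1 / (4 * max σ 1) ≤ 1 := by
    rw [div_le_one (by positivity)]
    linarith [le_max_right σ 1]
  obtain ⟨C₀, hC₀, hcac⟩ := exists_caccioppoli (d := d) hd hs0 hs1 hτ hτ1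
  have hc₀ : 0 < fracConst d s / 2 := half_pos (fracConst_pos hd hs0 hs1)
  set c₀ := fracConst d s / 2 with hc₀def
  set B : ℝ≥0 := (2 + 6 * C₀).toNNReal * (1 + c₀.toNNReal) with hBdef
  have hB1 : ENNReal.ofReal (2 + 6 * C₀) ≤ B := by
    rw [ENNReal.ofReal, hBdef]
    exact_mod_cast le_mul_of_one_le_right zero_le (by simp)
  have hB2 : ENNReal.ofReal c₀ * ENNReal.ofReal (2 + 6 * C₀) ≤ B := by
    rw [ENNReal.ofReal, ENNReal.ofReal, hBdef, mul_comm]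
    norm_cast
    exact mul_le_mul_right (by simp) _
  have hB0 : B ≠ 0 := by
    have h1 : 0 < (2 + 6 * C₀).toNNReal := Real.toNNReal_pos.2 (by positivity)
    exact (mul_pos h1 (by positivity)).ne'
  refine ⟨B ^ (1 / 2 : ℝ), ?_⟩
  intro Ω hΩ hΩb hΩ0 K hT hreg f hf u hu uh huh x₀ R hR hBR hmesh
  have hK := isRegularMesh_of_isShapeRegular hd hreg
  have hBC : ((B ^ (1 / 2 : ℝ) : ℝ≥0) : ℝ≥0∞) = (B : ℝ≥0∞) ^ (1 / 2 : ℝ) :=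
    ENNReal.coe_rpow_of_nonneg _ (by norm_num)
  have hC0 : ((B ^ (1 / 2 : ℝ) : ℝ≥0) : ℝ≥0∞) ≠ 0 := by
    rw [ENNReal.coe_ne_zero]
    exact (NNReal.rpow_pos (pos_iff_ne_zero.2 hB0)).ne'
  -- functions of `H̃^s(Ω)` vanish almost everywhere outside `Ω`, as the boundary is a null set
  have hvanish : ∀ v ∈ fracSobolevZero s Ω, ∀ᵐ x, x ∉ Ω → v x = 0 := by
    intro v hv
    have h1 : ∀ᵐ x, x ∉ frontier Ω := measure_eq_zero_iff_ae_notMem.1 hΩ0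
    filter_upwards [h1, hv.2.2] with x hx1 hx2 hx
    refine hx2 fun hcl => hx1 ⟨hcl, fun hint => hx (interior_subset hint)⟩
  have hfe : ∀ v ∈ feSpace Ω K, v ∈ fracSobolevZero s Ω := fun v hv =>
    mem_fracSobolevZero_of_mem_feSpace hd hs0 hs1 hΩ hΩb hT hv
  have huh' := hfe uh huh.1
  have hform : ∀ v ∈ fracSobolevZero s Ω, ∀ χ ∈ fracSobolevZero s Ω, fracForm s v χ =
      c₀ * ∫ p, incr v p * incr χ p ∂gagliardoMeasure d s := fun v hv χ hχ =>
    fracForm_eq s hv.1.1 hχ.1.1 hv.2.1 hχ.2.1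
  -- it suffices to prove the estimate for each `vh`
  suffices hmain : ∀ vh ∈ feSpace Ω K, fracSeminorm s (Metric.ball x₀ (R / 2)) (u - uh) ≤
      (B : ℝ≥0∞) ^ (1 / 2 : ℝ) * (fracSeminorm s (Metric.ball x₀ R) (u - vh) +
        ENNReal.ofReal (R ^ (-s)) * l2Norm Ω (u - vh)) +
      (B : ℝ≥0∞) ^ (1 / 2 : ℝ) * ENNReal.ofReal (R ^ (-s)) * l2Norm Ω (u - uh) by
    rw [← tsub_le_iff_right, ← ENNReal.div_le_iff' hC0 ENNReal.coe_ne_top]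
    refine le_iInf₂ fun vh hvh => ?_
    rw [ENNReal.div_le_iff' hC0 ENNReal.coe_ne_top, tsub_le_iff_right, hBC]
    exact hmain vh hvh
  intro vh hvh
  have hvh' := hfe vh hvh
  set w := u - vh with hw
  set z := uh - vh with hz
  have hw' : w ∈ fracSobolevZero s Ω := Submodule.sub_mem _ hu.1 hvh'
  have hzV : z ∈ feSpace Ω K := Submodule.sub_mem _ huh.1 hvh
  have hz' := hfe z hzV
  have hr' : u - uh ∈ fracSobolevZero s Ω := Submodule.sub_mem _ hu.1 huh'
  have huzw : u - uh = w + (-1 : ℝ) • z := by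
    ext x; simp [hw, hz]
  have hzwu : z = w - (u - uh) := by
    ext x; simp [hw, hz]
  -- Galerkin orthogonality: both `u` and `uh` have the form `f` against `χ`
  have hgal : ∀ χ ∈ feSpace Ω K, ∫ p, incr z p * incr χ p ∂gagliardoMeasure d s =
      ∫ p, incr w p * incr χ p ∂gagliardoMeasure d s := by
    intro χ hχ
    have hχ' := hfe χ hχ
    have h1 := hu.2 ⟨χ, hχ'⟩
    have h2 := huh.2 ⟨χ, hχ'⟩ hχ
    rw [← h1] at h2
    simp only at h2
    rw [hform uh huh' χ hχ', hform u hu.1 χ hχ'] at h2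
    have h3 := mul_left_cancel₀ hc₀.ne' h2
    have hint : ∀ v ∈ fracSobolevZero s Ω,
        Integrable (fun p => incr v p * incr χ p) (gagliardoMeasure d s) := fun v hv =>
      (memLp_incr s hv.1.1 hv.2.1).integrable_mul (memLp_incr s hχ'.1.1 hχ'.2.1)
    have hsub : ∀ v ∈ fracSobolevZero s Ω,
        ∫ p, incr (v - vh) p * incr χ p ∂gagliardoMeasure d s =
          ∫ p, incr v p * incr χ p ∂gagliardoMeasure d s -
            ∫ p, incr vh p * incr χ p ∂gagliardoMeasure d s := fun v hv => by
      rw [← integral_sub (hint v hv) (hint vh hvh')]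
      refine integral_congr_ae (Filter.Eventually.of_forall fun p => ?_)
      simp only [incr, Pi.sub_apply]; ring
    rw [hz, hw, hsub uh huh', hsub u hu.1, h3]
  have hcz := hcac hΩ hΩb hT hK hR hBR hmesh hzV hw'.1 hw'.2.1 hgal
  set E := gagliardoEnergy s (Metric.ball x₀ R) w with hE
  set ρ := ENNReal.ofReal (R ^ (-(2 * s))) with hρ
  have hZle : sqNorm z ≤ 2 * sqNorm w + 2 * sqNorm (u - uh) := by
    conv_lhs => rw [hzwu]
    exact sqNorm_sub_le hw'.1.1
  have henergy : gagliardoEnergy s (Metric.ball x₀ (R / 2)) (u - uh) ≤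
      ENNReal.ofReal (2 + 6 * C₀) * (E + ρ * sqNorm w + ρ * sqNorm (u - uh)) := by
    conv_lhs => rw [huzw]
    refine (gagliardoEnergy_add_le s _ hw'.1.1).trans ?_
    rw [gagliardoEnergy_smul, show ((-1 : ℝ) ^ 2) = 1 by norm_num, ENNReal.ofReal_one, one_mul]
    have h1 : gagliardoEnergy s (Metric.ball x₀ (R / 2)) w ≤ E :=
      gagliardoEnergy_mono s (Metric.ball_subset_ball (by linarith)) w
    have h2 : gagliardoEnergy s (Metric.ball x₀ (R / 2)) z ≤
        ENNReal.ofReal C₀ * (E + ρ * (sqNorm w + (2 * sqNorm w + 2 * sqNorm (u - uh)))) :=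
      hcz.trans (by gcongr)
    have h3 : ENNReal.ofReal (2 + 6 * C₀) = 2 + 6 * ENNReal.ofReal C₀ := by
      rw [ENNReal.ofReal_add (by norm_num) (by positivity), ENNReal.ofReal_mul (by norm_num)]
      simp
    rw [h3]
    set c := ENNReal.ofReal C₀
    set W := sqNorm w
    set V := sqNorm (u - uh)
    calc _ ≤ 2 * E + 2 * (c * (E + ρ * (W + (2 * W + 2 * V)))) := by gcongr
      _ ≤ 2 * E + 2 * (c * (E + ρ * (W + (2 * W + 2 * V)))) +
          (4 * c * E + (2 * (ρ * W) + 2 * (ρ * V) + 2 * c * (ρ * V))) := le_self_add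
      _ = _ := by ring
  -- square roots, using `√(a + b) ≤ √a + √b`
  have hRs : ρ ^ (1 / 2 : ℝ) = ENNReal.ofReal (R ^ (-s)) := by
    rw [hρ, ENNReal.ofReal_rpow_of_nonneg (by positivity) (by norm_num), ← Real.rpow_mul hR.le]
    congr 2; ring
  have hroot : ∀ v ∈ fracSobolevZero s Ω,
      (ρ * sqNorm v) ^ (1 / 2 : ℝ) = ENNReal.ofReal (R ^ (-s)) * l2Norm Ω v := fun v hv => by
    rw [ENNReal.mul_rpow_of_nonneg _ _ (by norm_num), hRs, l2Norm_eq hΩ.measurableSet (hvanish v hv)]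
  have hsq : ENNReal.ofReal c₀ * gagliardoEnergy s (Metric.ball x₀ (R / 2)) (u - uh) ≤
      B * (ENNReal.ofReal c₀ * E + ρ * sqNorm w + ρ * sqNorm (u - uh)) := by
    calc _ ≤ ENNReal.ofReal c₀ *
          (ENNReal.ofReal (2 + 6 * C₀) * (E + ρ * sqNorm w + ρ * sqNorm (u - uh))) := by gcongr
      _ = ENNReal.ofReal (2 + 6 * C₀) * (ENNReal.ofReal c₀ * E) +
          ENNReal.ofReal c₀ * ENNReal.ofReal (2 + 6 * C₀) *
            (ρ * sqNorm w + ρ * sqNorm (u - uh)) := by ring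
      _ ≤ B * (ENNReal.ofReal c₀ * E) + B * (ρ * sqNorm w + ρ * sqNorm (u - uh)) := by gcongr
      _ = _ := by ring
  have hhalf : (0 : ℝ) ≤ 1 / 2 := by norm_num
  calc fracSeminorm s (Metric.ball x₀ (R / 2)) (u - uh)
      ≤ (B * (ENNReal.ofReal c₀ * E + ρ * sqNorm w + ρ * sqNorm (u - uh))) ^ (1 / 2 : ℝ) :=
        ENNReal.rpow_le_rpow hsq hhalf
    _ = (B : ℝ≥0∞) ^ (1 / 2 : ℝ) *
        (ENNReal.ofReal c₀ * E + ρ * sqNorm w + ρ * sqNorm (u - uh)) ^ (1 / 2 : ℝ) :=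
        ENNReal.mul_rpow_of_nonneg _ _ hhalf
    _ ≤ (B : ℝ≥0∞) ^ (1 / 2 : ℝ) * ((ENNReal.ofReal c₀ * E) ^ (1 / 2 : ℝ) +
        (ρ * sqNorm w) ^ (1 / 2 : ℝ) + (ρ * sqNorm (u - uh)) ^ (1 / 2 : ℝ)) := by
        refine mul_le_mul_right ?_ _
        refine (ENNReal.rpow_add_le_add_rpow _ _ hhalf (by norm_num)).trans ?_
        exact add_le_add (ENNReal.rpow_add_le_add_rpow _ _ hhalf (by norm_num)) le_rfl
    _ = _ := by
        rw [hroot w hw', hroot _ hr', mul_add, mul_assoc]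
        rfl
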